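/- Let $d,\ell$ be dimensions, $\sigma\in\mathbb R$, $g:\mathbb R^\ell\to\mathbb R^d$, $h:\mathbb R^\ell\to\mathbb R^{d\times d}$ and $f:\mathbb R^d\to\mathbb R$ such that 1. $g,h$ are $C^2$, and $g,h$ and their derivatives of orders $1,2$ are uniformly bounded on $\mathbb R^\ell$; 2. $h(\theta)$ is symmetric and uniformly positive definite: there is $c>0$ with $x^\top h(\theta)x\ge c|x|^2$ for all $\theta\in\mathbb R^\ell$, $x\in\mathbb R^d$; 3. $f$ is $C^3$ and $|f(x)|+\sum_{i=1}^3|\nabla^i f(x)|\le C(1+|x|^m)$ for all $x\in\mathbb R^d$, for some constants $C,m>0$. Let $W,\bar W$ be independent standard $d$-dimensional Brownian motions. For $\theta\in\mathbb R^\ell$, $x,\bar x\in\mathbb R^d$ and $\tilde x\in\mathbb R^{d\times\ell}$ let $(X_t^\theta,\tilde X_t^\theta,\bar X_t^\theta)_{t\ge0}$ be the solution of $$dX_t^\theta=(g(\theta)-h(\theta)X_t^\theta)\,dt+\sigma\,dW_t,\qquad \frac{d\tilde X_t^\theta}{dt}=\nabla_\theta g(\theta)-\nabla_\theta h(\theta)X_t^\theta-h(\theta)\tilde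 X_t^\theta,\qquad d\bar X_t^\theta=(g(\theta)-h(\theta)\bar X_t^\theta)\,dt+\sigma\,d\bar W_t,$$ with $X_0^\theta=x$, $\tilde X_0^\theta=\tilde x$, $\bar X_0^\theta=\bar x$, where $(\nabla_\theta h(\theta)x)_{ij}=\sum_k\frac{\partial h_{ik}(\theta)}{\partial\theta_j}x_k$; write $\mathbf E_{x,\tilde x,\bar x}$ for the expectation. Let $\pi_\theta$ be the stationary distribution of $X^\theta$, and put $$G^2(x,\tilde x,\bar x,\theta)=\bigl[f(\bar x)-\mathbf E_{\pi_\theta}f(Y)\bigr]\,\tilde x^\top\nabla f(x)\in\mathbb R^\ell,\qquad v^2(x,\tilde x,\bar x,\theta)=-\int_0^\infty\mathbf E_{x,\tilde x,\bar x}\,G^2(X_t^\theta,\tilde X_t^\theta,\bar X_t^\theta,\theta)\,dt .$$ Then the expectations and the time integral defining $v^2$ converge absolutely, and for every $\theta$ the function $v^2(\cdot,\cdot,\cdot,\theta)$ is a classical solution of the Poisson equation $$\mathcal L^\theta_{x,\tilde x,\bar x}u=G^2\qquad\text{(componentwise in }\mathbb R^\ell),$$ where, for scalar $\varphi(x,\tilde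 x,\bar x)$, $$\mathcal L^\theta_{x,\tilde x,\bar x}\varphi=\langle g(\theta)-h(\theta)x,\nabla_x\varphi\rangle+\tfrac{\sigma^2}{2}\Delta_x\varphi+\operatorname{tr}\bigl((\nabla_{\tilde x}\varphi)^\top(\nabla_\theta g(\theta)-\nabla_\theta h(\theta)x-h(\theta)\tilde x)\bigr)+\langle g(\theta)-h(\theta)\bar x,\nabla_{\bar x}\varphi\rangle+\tfrac{\sigma^2}{2}\Delta_{\bar x}\varphi$$ is the generator of $(X^\theta,\tilde X^\theta,\bar X^\theta)$; classical means that $u$ and its partial derivatives $\nabla_xu,\nabla_x^2u,\nabla_{\tilde x}u,\nabla_{\bar x}u,\nabla_{\bar x}^2u$ exist and are jointly continuous in $(x,\tilde x,\bar x)$, and that the equation holds at every point. Moreover $v^2$ is differentiable in $\theta$, and there are constants $C$ and $m'>0$, independent of $(x,\tilde x,\bar x,\theta)$, such that for all $x,\tilde x,\bar x,\theta$ $$|v^2(x,\tilde x,\bar x,\theta)|+|\nabla_{\bar x}v^2(x,\tilde x,\bar x,\theta)|+|\nabla_\theta v^2(x,\tilde x,\bar x,\theta)|+|\nabla_xv^2(x,\tilde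 x,\bar x,\theta)|\le C\bigl(1+|x|^{m'}+|\tilde x|^{m'}+|\bar x|^{m'}\bigr).$$ -/

import Mathlib

open MeasureTheory ProbabilityTheory Set Filter Topology
open scoped NNReal

/-- Euclidean space `ℝⁿ`. -/
abbrev Vec (n : ℕ) : Type := EuclideanSpace ℝ (Fin n)

/-- Real `d × l` matrices, seen as linear maps `ℝˡ → ℝᵈ` (so that the Jacobian matrix at a point of
a map `ℝˡ → ℝᵈ` is its `fderiv` there). -/
abbrev Mat (d l : ℕ) : Type := Vec l →L[ℝ] Vec d

/-- `W` is a standard `d`-dimensional Brownian motion: its coordinates are independent standard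
one-dimensional Brownian motions. -/
structure IsBrownianVec {Ω : Type*} [MeasurableSpace Ω] {d : ℕ}
    (W : ℝ≥0 → Ω → Vec d) (P : Measure Ω) : Prop where
  measurable : ∀ t, Measurable (W t)
  brownian : ∀ i, IsBrownianReal (fun t ω => W t ω i) P
  indep : iIndepFun (fun (i : Fin d) (ω : Ω) (t : ℝ≥0) => W t ω i) P

/-- `X` is a (continuous) solution of the SDE
`dX_t = (g(θ) - h(θ) X_t) dt + σ dW_t`, `X_0 = x`, at a fixed parameter, with `a = g(θ)` and
`H = h(θ)`. As the noise is additive, the equation is an integral equation along each path, and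
adaptedness of `X` (up to null sets) is a consequence. -/
def IsOUSolution {Ω : Type*} [MeasurableSpace Ω] {d : ℕ} (P : Measure Ω)
    (a : Vec d) (H : Mat d d) (σ : ℝ) (W : ℝ≥0 → Ω → Vec d) (x : Vec d)
    (X : ℝ≥0 → Ω → Vec d) : Prop :=
  ∀ᵐ ω ∂P, Continuous (fun t => X t ω) ∧
    ∀ t : ℝ≥0, X t ω = x + (∫ s in (0 : ℝ)..t, (a - H (X s.toNNReal ω))) + σ • W t ω

/-- `Y` solves `dY_t/dt = ∇g(θ) - ∇h(θ) X_t - h(θ) Y_t`, `Y_0 = y`, where the entry `(i, j)` of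
`∇h(θ) X` is `∑ₖ (∂h_{ik}/∂θ_j) X_k`. -/
def IsSensitivitySolution {Ω : Type*} [MeasurableSpace Ω] {d l : ℕ} (P : Measure Ω)
    (g : Vec l → Vec d) (h : Vec l → Mat d d) (θ : Vec l) (X : ℝ≥0 → Ω → Vec d)
    (y : Mat d l) (Y : ℝ≥0 → Ω → Mat d l) : Prop :=
  ∀ᵐ ω ∂P, Continuous (fun t => Y t ω) ∧
    ∀ t : ℝ≥0, Y t ω = y + ∫ s in (0 : ℝ)..t,
      (fderiv ℝ g θ - (fderiv ℝ h θ).flip (X s.toNNReal ω) - (h θ).comp (Y s.toNNReal ω))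

/-- `ν` is a stationary distribution of the Markov process whose version started at `x` is `X x`:
`∫ P(X_t^x ∈ B) ν(dx) = ν(B)` for all `t` and all Borel sets `B`. -/
structure IsStationaryDist {Ω : Type*} [MeasurableSpace Ω] {d : ℕ} (P : Measure Ω)
    (X : Vec d → ℝ≥0 → Ω → Vec d) (ν : Measure (Vec d)) : Prop where
  isProbabilityMeasure : IsProbabilityMeasure ν
  invariant : ∀ (t : ℝ≥0) (B : Set (Vec d)), MeasurableSet B →
    ∫⁻ x, P {ω | X x t ω ∈ B} ∂ν = ν B

/-- `G²(x, x̃, x̄) = (f(x̄) - E_ν f) x̃ᵀ ∇f(x)`, with `ν` the stationary distribution. -/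
noncomputable def poissonG {d l : ℕ} (f : Vec d → ℝ) (ν : Measure (Vec d))
    (x : Vec d) (y : Mat d l) (z : Vec d) : Vec l :=
  (f z - ∫ w, f w ∂ν) • (ContinuousLinearMap.adjoint y) (gradient f x)

/-- The generator of the triple `(X, X̃, X̄)` at the parameter `θ`, applied to a scalar function
`φ(x, x̃, x̄)`:
`⟨g - h x, ∇_x φ⟩ + (σ²/2) Δ_x φ + tr((∇_x̃ φ)ᵀ (∇g - ∇h x - h x̃)) + ⟨g - h x̄, ∇_x̄ φ⟩
+ (σ²/2) Δ_x̄ φ`. -/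
noncomputable def tripleGenerator {d l : ℕ} (g : Vec l → Vec d) (h : Vec l → Mat d d) (σ : ℝ)
    (θ : Vec l) (φ : Vec d → Mat d l → Vec d → ℝ) (x : Vec d) (y : Mat d l) (z : Vec d) : ℝ :=
  fderiv ℝ (fun x' => φ x' y z) x (g θ - h θ x)
    + σ ^ 2 / 2 * Laplacian.laplacian (fun x' => φ x' y z) x
    + fderiv ℝ (fun y' => φ x y' z) y
        (fderiv ℝ g θ - (fderiv ℝ h θ).flip x - (h θ).comp y)
    + fderiv ℝ (fun z' => φ x y z') z (g θ - h θ z)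
    + σ ^ 2 / 2 * Laplacian.laplacian (fun z' => φ x y z') z

/-- `u(x, x̃, x̄)` is a classical solution of `L^θ u = G`: `u` is jointly continuous, it is `C²` in
`x` and in `x̄` and `C¹` in `x̃`, all these partial derivatives are jointly continuous, and the
equation holds at every point, in each of the `l` components. -/
structure IsClassicalPoissonSolution {d l : ℕ} (g : Vec l → Vec d) (h : Vec l → Mat d d) (σ : ℝ)
    (θ : Vec l) (G u : Vec d → Mat d l → Vec d → Vec l) : Prop where
  contDiff_x : ∀ y z, ContDiff ℝ 2 (fun x => u x y z)
  contDiff_y : ∀ x z, ContDiff ℝ 1 (fun y => u x y z)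
  contDiff_z : ∀ x y, ContDiff ℝ 2 (fun z => u x y z)
  continuous_u : Continuous (fun p : Vec d × Mat d l × Vec d => u p.1 p.2.1 p.2.2)
  continuous_dx : Continuous (fun p : Vec d × Mat d l × Vec d =>
    fderiv ℝ (fun x => u x p.2.1 p.2.2) p.1)
  continuous_dxx : Continuous (fun p : Vec d × Mat d l × Vec d =>
    iteratedFDeriv ℝ 2 (fun x => u x p.2.1 p.2.2) p.1)
  continuous_dy : Continuous (fun p : Vec d × Mat d l × Vec d =>
    fderiv ℝ (fun y => u p.1 y p.2.2) p.2.1)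
  continuous_dz : Continuous (fun p : Vec d × Mat d l × Vec d =>
    fderiv ℝ (fun z => u p.1 p.2.1 z) p.2.2)
  continuous_dzz : Continuous (fun p : Vec d × Mat d l × Vec d =>
    iteratedFDeriv ℝ 2 (fun z => u p.1 p.2.1 z) p.2.2)
  equation : ∀ x y z, ∀ i : Fin l,
    tripleGenerator g h σ θ (fun x' y' z' => u x' y' z' i) x y z = G x y z i

/-- `v²(x, x̃, x̄, θ) = -∫₀^∞ E G²(X_t, X̃_t, X̄_t, θ) dt`, where `X θ x`, `Y θ x x̃` and `Z θ x̄` are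
the three processes at the parameter `θ` started at `x`, `x̃` and `x̄`. -/
noncomputable def poissonV {Ω : Type*} [MeasurableSpace Ω] {d l : ℕ} (P : Measure Ω)
    (f : Vec d → ℝ) (π : Vec l → Measure (Vec d))
    (X : Vec l → Vec d → ℝ≥0 → Ω → Vec d)
    (Y : Vec l → Vec d → Mat d l → ℝ≥0 → Ω → Mat d l)
    (Z : Vec l → Vec d → ℝ≥0 → Ω → Vec d)
    (x : Vec d) (y : Mat d l) (z : Vec d) (θ : Vec l) : Vec l :=
  -∫ t in Ioi (0 : ℝ), ∫ ω, poissonG f (π θ) (X θ x t.toNNReal ω) (Y θ x y t.toNNReal ω)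
      (Z θ z t.toNNReal ω) ∂P

/-! The noise is additive, so the triple `((X, X̃), X̄)` solves, path by path, one linear equation
`dU = (a(θ) - A(θ) U) dt + dn` on a product space. Subtracting the noise gives an explicit solution,
`affPath`, free of stochastic integrals and affine in the initial value, with linear part
`exp(-tA)`. Coercivity of `h` gives `‖exp(-t h)‖ ≤ exp(-ct)`, and block triangular extensions keep
an exponential decay at a smaller rate (`norm_flow_tri_le`). The random part is a limit of sums of
independent Gaussian increments; its characteristic function is explicit
(`IsNoise.integral_exp_affPath`). This yields moments uniform in time and parameter, and the
semigroup law of the transition operators `T_t` (`LinFam.transOp_transOp`).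

Decay. The integrand is `(φ - m(θ)) • ψ`, with `φ = f(x̄)`, `ψ = x̃ᵀ∇f(x)` and `m(θ)` the stationary
mean of `f`. The two factors are driven by independent noises, so `T_t G = (T_t φ - m) • T_t ψ`.
Averaging the coupling estimate over the stationary law, whose moments are bounded uniformly in `θ`,
makes the first factor decay exponentially (`LinFam.exists_ergodic`); the second keeps polynomial
growth. Hence `F = ∫₀^∞ T_t G dt` converges. Each derivative of `T_t G` in the initial value carries
a factor `exp(-tA)`, so `F` is `C²` without any smoothing by the noise, also in the noiseless
direction `x̃`.

Equation. The semigroup law gives `T_s F - F = -∫₀^s T_t G dt`. Divided by `s`, the right side tends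
to `-G`, and the left side tends to the generator applied to `F` by a second order Taylor expansion
(`LinFam.tendsto_generator`). So `v² = -F` solves the equation.

Parameter. A solution together with its `θ`-derivative solves a linear equation of the same class
(`LinFam.prol`). Thus `∂_θ T_t ψ(u)` is itself a transition operator, applied to `(v, y) ↦ Dψ(v) y`
(`LinFam.hasFDerivAt_transOp_param`), and all estimates apply to it. For `φ` it is exponentially
Cauchy in `t`, uniformly in `θ`: the stationary mean is differentiable and `∂_θ (T_t φ - m)` decays.
The Leibniz rule then permits differentiation under the time integral
(`LinFam.exists_product_potential`). Requiring `Df` to be `C²` is what uses three derivatives of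
`f`. -/

/-! ### Differentiation of parametric integrals. -/

section ParametricIntegral

variable {V E α : Type*} [NormedAddCommGroup V] [NormedSpace ℝ V] [FiniteDimensional ℝ V]
  [NormedAddCommGroup E] [NormedSpace ℝ E] [MeasurableSpace α] {μ : Measure α}

/-- In each direction the derivative is the limit of difference quotients along `1/(n+1)`; finite
dimension reduces the operator to finitely many directions. -/
theorem aestronglyMeasurable_of_hasFDerivAt {F : V → α → E} {F' : α → V →L[ℝ] E} {v₀ : V}
    (hmeas : ∀ v, AEStronglyMeasurable (F v) μ)
    (hF : ∀ᵐ a ∂μ, HasFDerivAt (F · a) (F' a) v₀) : AEStronglyMeasurable F' μ := by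
  let b := Module.finBasis ℝ V
  have happ : ∀ w : V, AEStronglyMeasurable (fun a => F' a w) μ := by
    intro w
    refine aestronglyMeasurable_of_tendsto_ae atTop
      (f := fun (n : ℕ) a => ((n : ℝ) + 1) • (F (v₀ + ((n : ℝ) + 1)⁻¹ • w) a - F v₀ a))
      (fun n => ((hmeas _).sub (hmeas _)).const_smul _) ?_
    filter_upwards [hF] with a ha
    exact (ha.lim_real w).comp (tendsto_atTop_add_const_right atTop (1 : ℝ)
      tendsto_natCast_atTop_atTop)
  have hrep : F' = fun a => ∑ i, (LinearMap.toContinuousLinearMap (b.coord i)).smulRight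
      (F' a (b i)) := by
    funext a
    ext w
    conv_lhs => rw [← b.sum_repr w, map_sum]
    simp
  rw [hrep]
  refine Finset.aestronglyMeasurable_fun_sum _ fun i _ => ?_
  exact (ContinuousLinearMap.smulRightL ℝ V E
    (LinearMap.toContinuousLinearMap (b.coord i))).continuous.comp_aestronglyMeasurable (happ (b i))

/-- Differentiation under the integral sign, with the measurability of the derivative deduced. -/
theorem hasFDerivAt_integral_of_bound {F : V → α → E} {F' : V → α → V →L[ℝ] E} {v₀ : V}
    {s : Set V} {b : α → ℝ} (hs : s ∈ 𝓝 v₀)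
    (hmeas : ∀ v, AEStronglyMeasurable (F v) μ) (hint : Integrable (F v₀) μ)
    (hbound : ∀ᵐ a ∂μ, ∀ v ∈ s, ‖F' v a‖ ≤ b a) (hb : Integrable b μ)
    (hF : ∀ᵐ a ∂μ, ∀ v ∈ s, HasFDerivAt (F · a) (F' v a) v) :
    Integrable (F' v₀) μ ∧ HasFDerivAt (fun v => ∫ a, F v a ∂μ) (∫ a, F' v₀ a ∂μ) v₀ := by
  have hm : AEStronglyMeasurable (F' v₀) μ := aestronglyMeasurable_of_hasFDerivAt hmeas
    (hF.mono fun a ha => ha v₀ (mem_of_mem_nhds hs))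
  exact ⟨hb.mono' hm (hbound.mono fun a ha => ha v₀ (mem_of_mem_nhds hs)),
    hasFDerivAt_integral_of_dominated_of_fderiv_le hs (Eventually.of_forall hmeas) hint hm
      hbound hb hF⟩

/-- A continuous weight is locally bounded, so a separated bound `b a * w v` dominates near every
point. Moment bounds come in this form, with `w` a power of `1 + ‖v‖`. -/
theorem hasFDerivAt_integral_of_weight {F : V → α → E} {F' : V → α → V →L[ℝ] E}
    {w : V → ℝ} {b : α → ℝ} (hw : Continuous w) (hb : Integrable b μ)
    (hmeas : ∀ v, AEStronglyMeasurable (F v) μ) (hint : ∀ v, Integrable (F v) μ)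
    (hbound : ∀ᵐ a ∂μ, ∀ v, ‖F' v a‖ ≤ b a * w v)
    (hF : ∀ᵐ a ∂μ, ∀ v, HasFDerivAt (F · a) (F' v a) v) (v₀ : V) :
    Integrable (F' v₀) μ ∧ HasFDerivAt (fun v => ∫ a, F v a ∂μ) (∫ a, F' v₀ a ∂μ) v₀ := by
  refine hasFDerivAt_integral_of_bound (s := {v | |w v| < |w v₀| + 1})
    (b := fun a => |b a| * (|w v₀| + 1)) ?_ hmeas (hint v₀) ?_ (hb.abs.mul_const _)
    (hF.mono fun a ha v _ => ha v)
  · exact (isOpen_lt (by fun_prop) (by fun_prop)).mem_nhds (by simp)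
  · filter_upwards [hbound] with a ha v hv
    refine (ha v).trans ((le_abs_self _).trans ?_)
    rw [abs_mul]
    exact mul_le_mul_of_nonneg_left (le_of_lt hv) (abs_nonneg _)

omit [NormedSpace ℝ V] [FiniteDimensional ℝ V] in
theorem continuous_integral_of_weight {F : V → α → E}
    {w : V → ℝ} {b : α → ℝ} (hw : Continuous w) (hb : Integrable b μ)
    (hmeas : ∀ v, AEStronglyMeasurable (F v) μ)
    (hbound : ∀ᵐ a ∂μ, ∀ v, ‖F v a‖ ≤ b a * w v)
    (hF : ∀ᵐ a ∂μ, Continuous (F · a)) : Continuous (fun v => ∫ a, F v a ∂μ) := by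
  refine continuous_iff_continuousAt.2 fun v₀ => ?_
  refine continuousAt_of_dominated (bound := fun a => |b a| * (|w v₀| + 1))
    (Eventually.of_forall hmeas) ?_ (hb.abs.mul_const _) (hF.mono fun a ha => ha.continuousAt)
  have : {v | |w v| < |w v₀| + 1} ∈ 𝓝 v₀ :=
    (isOpen_lt (by fun_prop) (by fun_prop)).mem_nhds (by simp)
  filter_upwards [this] with v hv
  filter_upwards [hbound] with a ha
  refine (ha v).trans ((le_abs_self _).trans ?_)
  rw [abs_mul]
  exact mul_le_mul_of_nonneg_left (le_of_lt hv) (abs_nonneg _)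

/-- Serves both for expectations over `ω` and for the time integral defining the potential. -/
theorem contDiff_two_integral_of_weight {F : V → α → E} {w : V → ℝ} {b : α → ℝ}
    (hw : Continuous w) (hb : Integrable b μ)
    (hmeas : ∀ v, AEStronglyMeasurable (F v) μ) (hint : ∀ v, Integrable (F v) μ)
    (hC : ∀ᵐ a ∂μ, ContDiff ℝ 2 (F · a))
    (h1 : ∀ᵐ a ∂μ, ∀ v, ‖fderiv ℝ (F · a) v‖ ≤ b a * w v)
    (h2 : ∀ᵐ a ∂μ, ∀ v, ‖fderiv ℝ (fderiv ℝ (F · a)) v‖ ≤ b a * w v) :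
    ContDiff ℝ 2 (fun v => ∫ a, F v a ∂μ) ∧
    (fderiv ℝ (fun v => ∫ a, F v a ∂μ) = fun v => ∫ a, fderiv ℝ (F · a) v ∂μ) ∧
    (fderiv ℝ (fderiv ℝ (fun v => ∫ a, F v a ∂μ)) =
      fun v => ∫ a, fderiv ℝ (fderiv ℝ (F · a)) v ∂μ) := by
  have d1 : ∀ᵐ a ∂μ, ∀ v, HasFDerivAt (F · a) (fderiv ℝ (F · a) v) v := by
    filter_upwards [hC] with a ha v
    exact (ha.differentiable (by norm_num) v).hasFDerivAt
  have d2 : ∀ᵐ a ∂μ, ∀ v, HasFDerivAt (fderiv ℝ (F · a)) (fderiv ℝ (fderiv ℝ (F · a)) v) v := by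
    filter_upwards [hC] with a ha v
    exact ((ha.fderiv_right (m := 1) (by norm_num)).differentiable (by norm_num) v).hasFDerivAt
  have c2 : ∀ᵐ a ∂μ, Continuous (fderiv ℝ (fderiv ℝ (F · a))) := by
    filter_upwards [hC] with a ha
    exact (ha.fderiv_right (m := 1) (by norm_num)).continuous_fderiv (by norm_num)
  have e1 := hasFDerivAt_integral_of_weight (F' := fun v a => fderiv ℝ (F · a) v)
    hw hb hmeas hint h1 d1
  have e2 := hasFDerivAt_integral_of_weight (F := fun v a => fderiv ℝ (F · a) v)
    (F' := fun v a => fderiv ℝ (fderiv ℝ (F · a)) v)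
    hw hb (fun v => (e1 v).1.1) (fun v => (e1 v).1) h2 d2
  have f1 : (fderiv ℝ (fun v => ∫ a, F v a ∂μ) = fun v => ∫ a, fderiv ℝ (F · a) v ∂μ) :=
    funext fun v => (e1 v).2.fderiv
  have f2 : (fderiv ℝ (fderiv ℝ (fun v => ∫ a, F v a ∂μ)) =
      fun v => ∫ a, fderiv ℝ (fderiv ℝ (F · a)) v ∂μ) := by
    rw [f1]; exact funext fun v => (e2 v).2.fderiv
  refine ⟨?_, f1, f2⟩
  rw [show (2 : WithTop ℕ∞) = 1 + 1 by norm_num, contDiff_succ_iff_fderiv]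
  refine ⟨fun v => (e1 v).2.differentiableAt, by simp, ?_⟩
  rw [contDiff_one_iff_fderiv]
  constructor
  · rw [f1]; exact fun v => (e2 v).2.differentiableAt
  · rw [f2]; exact continuous_integral_of_weight hw hb (fun v => (e2 v).1.1) h2 c2

end ParametricIntegral

/-! ### Linear flows and the pathwise solution of the linear equation. -/

section Flow

variable {V : Type*} [NormedAddCommGroup V] [NormedSpace ℝ V] [CompleteSpace V]

/-- The flow `exp (-t A)` of the linear equation `y' = -A y`. -/
noncomputable def flow (A : V →L[ℝ] V) (t : ℝ) : V →L[ℝ] V := NormedSpace.exp ((-t) • A)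

/-- The solution of `dU = (a - A U) dt + dn`, `U₀ = u`, along a path `n` with `n 0 = 0`. -/
noncomputable def affPath (A : V →L[ℝ] V) (a u : V) (n : ℝ → V) (t : ℝ) : V :=
  n t + flow A t u + ∫ s in (0 : ℝ)..t, flow A (t - s) (a - A (n s))

omit [CompleteSpace V] in
@[simp] theorem flow_zero (A : V →L[ℝ] V) : flow A 0 = 1 := by
  simp [flow]

theorem flow_add (A : V →L[ℝ] V) (s t : ℝ) : flow A (s + t) = flow A s * flow A t := by
  let : NormedAlgebra ℚ (V →L[ℝ] V) := NormedAlgebra.restrictScalars ℚ ℝ _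
  rw [flow, neg_add, add_smul, NormedSpace.exp_add_of_commute]
  · rfl
  · exact ((Commute.refl A).smul_left _).smul_right _

theorem flow_add_apply (A : V →L[ℝ] V) (s t : ℝ) (v : V) :
    flow A (s + t) v = flow A s (flow A t v) := by
  rw [flow_add]; rfl

theorem hasDerivAt_flow (A : V →L[ℝ] V) (t : ℝ) : HasDerivAt (flow A) (-(A * flow A t)) t := by
  have h := (hasDerivAt_exp_smul_const' (𝕂 := ℝ) A (-t)).scomp t (hasDerivAt_neg t)
  exact HasDerivAt.congr_deriv (f := flow A) h (by simp [flow])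

theorem hasDerivAt_flow' (A : V →L[ℝ] V) (t : ℝ) : HasDerivAt (flow A) (-(flow A t * A)) t := by
  have h := (hasDerivAt_exp_smul_const (𝕂 := ℝ) A (-t)).scomp t (hasDerivAt_neg t)
  exact HasDerivAt.congr_deriv (f := flow A) h (by simp [flow])

@[fun_prop] theorem continuous_flow (A : V →L[ℝ] V) : Continuous (flow A) :=
  continuous_iff_continuousAt.2 fun t => (hasDerivAt_flow A t).continuousAt

theorem flow_neg_apply_flow (A : V →L[ℝ] V) (t : ℝ) (v : V) : flow A t (flow A (-t) v) = v := by
  rw [← flow_add_apply]; simp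

theorem flow_sub_apply (A : V →L[ℝ] V) (t s : ℝ) (v : V) :
    flow A (t - s) v = flow A t (flow A (-s) v) := by
  rw [sub_eq_add_neg, flow_add_apply]

/-- Variation of constants: the explicit formula solves the linear equation. -/
theorem hasDerivAt_duhamel (A : V →L[ℝ] V) (y₀ : V) {p : ℝ → V} (hp : Continuous p) (t : ℝ) :
    HasDerivAt (fun t => flow A t y₀ + ∫ s in (0 : ℝ)..t, flow A (t - s) (p s))
      (p t - A (flow A t y₀ + ∫ s in (0 : ℝ)..t, flow A (t - s) (p s))) t := by
  have hc : Continuous fun s => flow A (-s) (p s) :=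
    ((continuous_flow A).comp continuous_neg).clm_apply hp
  -- Factoring out `flow A t` leaves an integral that depends on `t` only through its upper limit.
  have key : ∀ t, flow A t y₀ + ∫ s in (0 : ℝ)..t, flow A (t - s) (p s) =
      flow A t (y₀ + ∫ s in (0 : ℝ)..t, flow A (-s) (p s)) := by
    intro t
    rw [map_add, ← ContinuousLinearMap.intervalIntegral_comp_comm _ (hc.intervalIntegrable _ _)]
    simp only [flow_sub_apply]
  simp only [key]
  have h1 : HasDerivAt (fun t => y₀ + ∫ s in (0 : ℝ)..t, flow A (-s) (p s))
      (flow A (-t) (p t)) t := (hc.integral_hasStrictDerivAt 0 t).hasDerivAt.const_add _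
  have h2 := (hasDerivAt_flow A t).clm_apply h1
  convert h2 using 1
  rw [flow_neg_apply_flow]
  simp [sub_eq_add_neg, add_comm]

/-- Variation of constants: solutions of the linear integral equation are given by the explicit
formula. -/
theorem eq_duhamel (A : V →L[ℝ] V) {y₀ : V} {p y : ℝ → V} (hp : Continuous p) (hy : Continuous y)
    (h : ∀ t, 0 ≤ t → y t = y₀ + ∫ s in (0 : ℝ)..t, (p s - A (y s))) {t : ℝ} (ht : 0 ≤ t) :
    y t = flow A t y₀ + ∫ s in (0 : ℝ)..t, flow A (t - s) (p s) := by
  have hcq : Continuous fun s => p s - A (y s) := by fun_prop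
  -- The equation for `y` is known only for nonnegative times; its right side is differentiable on
  -- all of `ℝ` and agrees with `y` on `[0, t]`.
  set Y : ℝ → V := fun t => y₀ + ∫ s in (0 : ℝ)..t, (p s - A (y s)) with hY
  have hYd : ∀ s, HasDerivAt Y (p s - A (y s)) s := fun s =>
    (hcq.integral_hasStrictDerivAt 0 s).hasDerivAt.const_add _
  have hd : ∀ s ∈ uIcc 0 t, HasDerivAt (fun s => flow A (t - s) (Y s)) (flow A (t - s) (p s)) s := by
    intro s hs
    rw [uIcc_of_le ht] at hs
    have h1 := ((hasDerivAt_flow' A (t - s)).scomp s ((hasDerivAt_id s).const_sub t)).clm_apply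
      (hYd s)
    have hs' : y s = Y s := h s hs.1
    refine HasDerivAt.congr_deriv (f := fun s => flow A (t - s) (Y s)) h1 ?_
    simp [hs']
  have hc : Continuous fun s => flow A (t - s) (p s) :=
    ((continuous_flow A).comp (by fun_prop)).clm_apply hp
  have := intervalIntegral.integral_eq_sub_of_hasDerivAt hd (hc.intervalIntegrable _ _)
  rw [this, h t ht]
  simp [hY]

theorem continuous_duhamel_integrand (A : V →L[ℝ] V) {p : ℝ → V} (hp : Continuous p) (t : ℝ) :
    Continuous fun s => flow A (t - s) (p s) :=
  ((continuous_flow A).comp (by fun_prop)).clm_apply hp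

/-- By linearity the randomness sits in a summand that involves neither the initial value nor the
constant drift. Every question about laws reduces to this centred part. -/
theorem affPath_eq_add (A : V →L[ℝ] V) (a u : V) {n : ℝ → V} (hn : Continuous n) (t : ℝ) :
    affPath A a u n t = flow A t u + (∫ s in (0 : ℝ)..t, flow A s a) + affPath A 0 0 n t := by
  have h1 : ∫ s in (0 : ℝ)..t, flow A s a = ∫ s in (0 : ℝ)..t, flow A (t - s) a := by
    rw [intervalIntegral.integral_comp_sub_left (fun s => flow A s a) t, sub_self, sub_zero]
  have h2 : ∫ s in (0 : ℝ)..t, flow A (t - s) (a - A (n s)) =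
      (∫ s in (0 : ℝ)..t, flow A (t - s) a) + ∫ s in (0 : ℝ)..t, flow A (t - s) (0 - A (n s)) := by
    rw [← intervalIntegral.integral_add]
    · simp [sub_eq_add_neg]
    · exact (continuous_duhamel_integrand A continuous_const t).intervalIntegrable _ _
    · exact (continuous_duhamel_integrand A (by fun_prop) t).intervalIntegrable _ _
  rw [affPath, affPath, h1, h2, map_zero]
  abel

/-- The difference `U - n` solves an ordinary linear equation with continuous forcing `a - A n`, so
variation of constants determines it. -/
theorem eq_affPath (A : V →L[ℝ] V) {a u : V} {n U : ℝ → V} (hn : Continuous n) (hU : Continuous U)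
    (h : ∀ t, 0 ≤ t → U t = u + (∫ s in (0 : ℝ)..t, (a - A (U s))) + n t) {t : ℝ} (ht : 0 ≤ t) :
    U t = affPath A a u n t := by
  have := eq_duhamel A (y₀ := u) (p := fun s => a - A (n s)) (y := fun s => U s - n s)
    (by fun_prop) (by fun_prop) (by
      intro t ht
      rw [h t ht]
      have : ∀ s, a - A (n s) - A (U s - n s) = a - A (U s) := fun s => by rw [map_sub]; abel
      simp only [this, add_sub_cancel_right]) ht
  rw [affPath, add_assoc, ← this]
  simp

theorem continuous_affPath (A : V →L[ℝ] V) (a u : V) {n : ℝ → V} (hn : Continuous n) :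
    Continuous (affPath A a u n) := by
  have : Continuous fun t => flow A t u + ∫ s in (0 : ℝ)..t, flow A (t - s) (a - A (n s)) :=
    continuous_iff_continuousAt.2 fun t =>
      (hasDerivAt_duhamel A u (p := fun s => a - A (n s)) (by fun_prop) t).continuousAt
  refine (hn.add this).congr fun t => ?_
  simp only [affPath, Pi.add_apply, add_assoc]

theorem affPath_integral_eq (A : V →L[ℝ] V) (a u : V) {n : ℝ → V} (hn : Continuous n) (t : ℝ) :
    affPath A a u n t = u + (∫ s in (0 : ℝ)..t, (a - A (affPath A a u n s))) + n t := by
  have hd := hasDerivAt_duhamel A u (p := fun s => a - A (n s)) (by fun_prop)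
  have hi : ∀ s, a - A (n s) - A (flow A s u + ∫ r in (0 : ℝ)..s, flow A (s - r) (a - A (n r))) =
      a - A (affPath A a u n s) := by
    intro s
    simp only [affPath, map_add]; abel
  have hcont : Continuous fun s => a - A (affPath A a u n s) := by
    have := continuous_affPath A a u hn
    fun_prop
  have := intervalIntegral.integral_eq_sub_of_hasDerivAt (a := 0) (b := t)
    (f := fun t => flow A t u + ∫ s in (0 : ℝ)..t, flow A (t - s) (a - A (n s)))
    (f' := fun s => a - A (affPath A a u n s)) (fun s _ => by rw [← hi]; exact hd s)
    (hcont.intervalIntegrable _ _)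
  rw [this]
  simp [affPath]
  abel

/-- Uniqueness of solutions of intertwined linear equations. -/
theorem flow_intertwine {V' : Type*} [NormedAddCommGroup V'] [NormedSpace ℝ V'] [CompleteSpace V']
    {A : V →L[ℝ] V} {B : V' →L[ℝ] V'} {T : V →L[ℝ] V'} (h : ∀ v, T (A v) = B (T v)) (t : ℝ) (v : V) :
    T (flow A t v) = flow B t (T v) := by
  -- This interpolation takes one side of the identity at `s = t` and the other at `s = 0`; its
  -- derivative vanishes by the intertwining relation.
  have hd : ∀ s, HasDerivAt (fun s => flow B (t - s) (T (flow A s v))) 0 s := by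
    intro s
    have h1 := ((hasDerivAt_flow' B (t - s)).scomp s ((hasDerivAt_id s).const_sub t)).clm_apply
      (T.hasFDerivAt.comp_hasDerivAt s ((hasDerivAt_flow A s).clm_apply (hasDerivAt_const s v)))
    refine HasDerivAt.congr_deriv (f := fun s => flow B (t - s) (T (flow A s v))) h1 ?_
    simp [h]
  have := is_const_of_deriv_eq_zero (fun s => (hd s).differentiableAt) (fun s => (hd s).deriv) t 0
  simpa using this

/-- Exponential decay from an energy inequality. -/
theorem le_exp_mul_of_deriv_le {f f' : ℝ → ℝ} {c : ℝ} (hf : ∀ t, HasDerivAt f (f' t) t)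
    (h : ∀ t, f' t ≤ -c * f t) {t : ℝ} (ht : 0 ≤ t) : f t ≤ Real.exp (-c * t) * f 0 := by
  have hd : ∀ s, HasDerivAt (fun s => Real.exp (c * s) * f s)
      (Real.exp (c * s) * c * f s + Real.exp (c * s) * f' s) s := by
    intro s
    have := ((hasDerivAt_id s).const_mul c).exp.mul (hf s)
    exact HasDerivAt.congr_deriv (f := fun s => Real.exp (c * s) * f s) this (by simp)
  have hanti : Antitone fun s => Real.exp (c * s) * f s := by
    refine antitone_of_hasDerivAt_nonpos hd fun s => ?_
    have := mul_le_mul_of_nonneg_left (h s) (Real.exp_pos (c * s)).le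
    simp only [Pi.zero_apply]
    linarith
  have := hanti ht
  simp only [mul_zero, Real.exp_zero, one_mul] at this
  rw [neg_mul, Real.exp_neg, ← div_eq_inv_mul, le_div_iff₀ (Real.exp_pos _)]
  linarith

end Flow

/-! ### Riemann sums and summation by parts. -/

section Riemann

variable {E : Type*} [NormedAddCommGroup E] [NormedSpace ℝ E]

/-- Convergence of Riemann sums in one of the two variables of the integrand. -/
theorem tendsto_sum_integral_tag {F : ℝ → ℝ → E} (hF : Continuous fun p : ℝ × ℝ => F p.1 p.2)
    {t : ℝ} (ht : 0 ≤ t) {s : ℕ → ℕ → ℝ} (hs : ∀ m j, s m j = j * (t / (m + 1)))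
    {τ : ℕ → ℕ → ℝ} (hτ : ∀ m j, τ m j ∈ Icc (s m j) (s m (j + 1))) :
    Tendsto (fun m : ℕ => ∑ j ∈ Finset.range (m + 1), ∫ r in s m j..s m (j + 1), F r (τ m j))
      atTop (𝓝 (∫ r in (0 : ℝ)..t, F r r)) := by
  have hcd : Continuous fun r => F r r := hF.comp (by fun_prop : Continuous fun r : ℝ => (r, r))
  have hcs : ∀ x, Continuous fun r => F r x := fun x =>
    hF.comp (by fun_prop : Continuous fun r : ℝ => (r, x))
  have hs0 : ∀ m, s m 0 = 0 := fun m => by simp [hs]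
  have hst : ∀ m, s m (m + 1) = t := fun m => by rw [hs]; push_cast; field_simp
  have hstep : ∀ m j, s m (j + 1) - s m j = t / (m + 1) := fun m j => by
    rw [hs, hs]; push_cast; ring
  have hstep0 : ∀ m : ℕ, 0 ≤ t / ((m : ℝ) + 1) := fun m => by positivity
  have hmono : ∀ m, Monotone (s m) := fun m => monotone_nat_of_le_succ fun j => by
    linarith [hstep m j, hstep0 m]
  have hsum : ∀ m, ∫ r in (0 : ℝ)..t, F r r =
      ∑ j ∈ Finset.range (m + 1), ∫ r in s m j..s m (j + 1), F r r := by
    intro m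
    rw [intervalIntegral.sum_integral_adjacent_intervals
      (fun k _ => hcd.intervalIntegrable _ _), hs0, hst]
  have huc := (isCompact_Icc (a := (0 : ℝ)) (b := t)).prod (isCompact_Icc (a := (0 : ℝ)) (b := t))
    |>.uniformContinuousOn_of_continuous hF.continuousOn
  rw [Metric.tendsto_atTop]
  intro ε hε
  rw [Metric.uniformContinuousOn_iff] at huc
  -- Dividing by `t + 1` rather than `t` covers `t = 0` and leaves a strict inequality at the end.
  obtain ⟨δ, hδ, huc⟩ := huc (ε / (t + 1)) (by positivity)
  obtain ⟨N, hN⟩ := exists_nat_gt (t / δ)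
  refine ⟨N, fun m hm => ?_⟩
  have hsmall : t / ((m : ℝ) + 1) < δ := by
    rw [div_lt_iff₀ (by positivity)]
    rw [div_lt_iff₀ hδ] at hN
    have : (N : ℝ) ≤ m := by exact_mod_cast hm
    nlinarith
  rw [hsum m, dist_eq_norm, ← Finset.sum_sub_distrib]
  have hterm : ∀ j ∈ Finset.range (m + 1),
      ‖(∫ r in s m j..s m (j + 1), F r (τ m j)) - ∫ r in s m j..s m (j + 1), F r r‖ ≤
        ε / (t + 1) * (s m (j + 1) - s m j) := by
    intro j hj
    rw [← intervalIntegral.integral_sub ((hcs _).intervalIntegrable _ _)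
      (hcd.intervalIntegrable _ _)]
    have hle := hmono m (Nat.le_succ j)
    have hin : ∀ r ∈ Icc (s m j) (s m (j + 1)), r ∈ Icc 0 t := by
      intro r hr
      have h1 := hmono m (Nat.zero_le j)
      have h2 := hmono m (Nat.succ_le_of_lt (Finset.mem_range.1 hj))
      rw [hs0] at h1
      rw [Nat.succ_eq_add_one, hst] at h2
      exact ⟨h1.trans hr.1, hr.2.trans h2⟩
    refine (intervalIntegral.norm_integral_le_of_norm_le_const (C := ε / (t + 1)) ?_).trans_eq ?_
    · intro r hr
      rw [uIoc_of_le hle] at hr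
      have hr' : r ∈ Icc (s m j) (s m (j + 1)) := ⟨hr.1.le, hr.2⟩
      have := huc (r, τ m j) ⟨hin r hr', hin _ (hτ m j)⟩ (r, r) ⟨hin r hr', hin r hr'⟩ (by
        rw [Prod.dist_eq, dist_self, max_lt_iff, Real.dist_eq, abs_lt]
        have := (hτ m j).1
        have := (hτ m j).2
        have := hstep m j
        exact ⟨hδ, by linarith [hr'.1, hr'.2], by linarith [hr'.1, hr'.2]⟩)
      rw [dist_eq_norm] at this
      exact this.le
    · rw [abs_of_nonneg (sub_nonneg.2 hle)]
  refine (norm_sum_le_of_le _ hterm).trans_lt ?_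
  rw [← Finset.mul_sum, Finset.sum_range_sub, hst, hs0, sub_zero, div_mul_eq_mul_div,
    div_lt_iff₀ (by positivity)]
  nlinarith

/-- Abel summation: the increments pass from the rough path to the smooth operators. -/
theorem sum_apply_sub_eq {V : Type*} [NormedAddCommGroup V] [NormedSpace ℝ V]
    (a : ℕ → V →L[ℝ] E) (x : ℕ → V) (m : ℕ) :
    ∑ j ∈ Finset.range m, a (j + 1) (x (j + 1) - x j) =
      a m (x m) - a 0 (x 0) - ∑ j ∈ Finset.range m, (a (j + 1) - a j) (x j) := by
  induction m with
  | zero => simp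
  | succ k ih =>
    rw [Finset.sum_range_succ, Finset.sum_range_succ, ih]
    simp only [map_sub, sub_apply]
    abel

end Riemann

/-! ### Gaussian noise and the law of the solution that it drives. -/

section Noise

variable {Ω : Type*} [MeasurableSpace Ω] {P : Measure Ω} {ι : Type*} [Fintype ι]
  {V : Type*} [NormedAddCommGroup V] [NormedSpace ℝ V] [MeasurableSpace V]

/-- `n` has continuous paths starting at `0`, and independent centred Gaussian increments with
covariance `(t - s) ∑ᵢ eᵢ ⊗ eᵢ`. -/
structure IsNoise (P : Measure Ω) (e : ι → V) (n : ℝ → Ω → V) : Prop where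
  measurable : ∀ t, Measurable (n t)
  continuous : ∀ ω, Continuous (fun t => n t ω)
  zero : ∀ ω, n 0 ω = 0
  charFun : ∀ (m : ℕ) (s : ℕ → ℝ), 0 ≤ s 0 → Monotone s → ∀ L : ℕ → StrongDual ℝ V,
    ∫ ω, Complex.exp ((∑ j ∈ Finset.range m, L j (n (s (j + 1)) ω - n (s j) ω) : ℝ) * Complex.I) ∂P
      = Complex.exp (-((∑ j ∈ Finset.range m,
          (s (j + 1) - s j) * ∑ i, (L j (e i)) ^ 2 : ℝ) : ℂ) / 2)

variable [CompleteSpace V] [BorelSpace V]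

/-- These are Riemann–Stieltjes sums for `∫ flow A (t - s) dn`. After Abel summation the differences
fall on the flow, where they are integrals of its derivative, so continuity of the path suffices. -/
theorem tendsto_sum_flow_increments (A : V →L[ℝ] V) {n : ℝ → V} (hn : Continuous n) (h0 : n 0 = 0)
    {t : ℝ} (ht : 0 ≤ t) {s : ℕ → ℕ → ℝ} (hs : ∀ m j, s m j = j * (t / (m + 1))) :
    Tendsto (fun m : ℕ => ∑ j ∈ Finset.range (m + 1),
      flow A (t - s m (j + 1)) (n (s m (j + 1)) - n (s m j))) atTop
      (𝓝 (affPath A 0 0 n t)) := by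
  have hst : ∀ m, s m (m + 1) = t := fun m => by rw [hs]; push_cast; field_simp
  have hs0 : ∀ m, s m 0 = 0 := fun m => by simp [hs]
  have hle : ∀ m j, s m j ≤ s m (j + 1) := fun m j => by
    rw [hs, hs]
    have : 0 ≤ t / ((m : ℝ) + 1) := by positivity
    push_cast
    nlinarith
  have hd : ∀ r, HasDerivAt (fun r => flow A (t - r)) (flow A (t - r) * A) r := by
    intro r
    have := (hasDerivAt_flow' A (t - r)).scomp r ((hasDerivAt_id r).const_sub t)
    refine HasDerivAt.congr_deriv (f := fun r => flow A (t - r)) this (by simp)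
  have hcf : Continuous fun r => flow A (t - r) := (continuous_flow A).comp (by fun_prop)
  have key : ∀ m, ∑ j ∈ Finset.range (m + 1),
      flow A (t - s m (j + 1)) (n (s m (j + 1)) - n (s m j)) =
      n t - ∑ j ∈ Finset.range (m + 1),
        ∫ r in s m j..s m (j + 1), flow A (t - r) (A (n (s m j))) := by
    intro m
    rw [sum_apply_sub_eq (fun j => flow A (t - s m j)) (fun j => n (s m j))]
    simp only [hst, hs0, h0, sub_self, flow_zero, one_apply_eq_self, map_zero, sub_zero]
    congr 1
    refine Finset.sum_congr rfl fun j _ => ?_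
    have hint := intervalIntegral.integral_eq_sub_of_hasDerivAt (a := s m j) (b := s m (j + 1))
      (fun r _ => (hd r).clm_apply (hasDerivAt_const r (n (s m j))))
      (Continuous.intervalIntegrable (by
        simp only [map_zero, add_zero]
        exact (hcf.mul continuous_const).clm_apply continuous_const) _ _)
    rw [sub_apply, ← hint]
    simp
  simp only [key]
  have := tendsto_sum_integral_tag (F := fun r x => flow A (t - r) (A (n x))) (τ := s)
    (by
      refine Continuous.clm_apply (hcf.comp continuous_fst) ?_
      exact A.continuous.comp (hn.comp continuous_snd)) ht hs
    (fun m j => ⟨le_rfl, hle m j⟩)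
  convert tendsto_const_nhds.sub this using 2
  simp [affPath, intervalIntegral.integral_neg, sub_eq_add_neg]

/-- The characteristic function of the solution driven by the noise only. -/
theorem IsNoise.integral_exp_affPath [IsProbabilityMeasure P] {e : ι → V} {n : ℝ → Ω → V}
    (h : IsNoise P e n) (A : V →L[ℝ] V) {t : ℝ} (ht : 0 ≤ t) (L : StrongDual ℝ V) :
    ∫ ω, Complex.exp ((L (affPath A 0 0 (fun s => n s ω) t) : ℝ) * Complex.I) ∂P =
      Complex.exp (-((∫ r in (0 : ℝ)..t, ∑ i, (L (flow A r (e i))) ^ 2 : ℝ) : ℂ) / 2) := by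
  set s : ℕ → ℕ → ℝ := fun m j => j * (t / (m + 1)) with hs
  have hle : ∀ m j, s m j ≤ s m (j + 1) := fun m j => by
    rw [hs]
    have : 0 ≤ t / ((m : ℝ) + 1) := by positivity
    push_cast
    nlinarith
  set S : ℕ → Ω → ℝ := fun m ω => ∑ j ∈ Finset.range (m + 1),
    (L.comp (flow A (t - s m (j + 1)))) (n (s m (j + 1)) ω - n (s m j) ω) with hS
  have hlim : ∀ ω, Tendsto (fun m => S m ω) atTop
      (𝓝 (L (affPath A 0 0 (fun s => n s ω) t))) := by
    intro ω
    have := tendsto_sum_flow_increments A (h.continuous ω) (h.zero ω) ht (s := s) (fun _ _ => rfl)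
    have := (L.continuous.tendsto _).comp this
    refine this.congr fun m => ?_
    simp [hS]
  have hmeasS : ∀ m, Measurable (S m) := by
    intro m
    refine Finset.measurable_fun_sum _ fun j _ => ?_
    simp only [map_sub]
    exact ((ContinuousLinearMap.continuous _).measurable.comp (h.measurable _)).sub
      ((ContinuousLinearMap.continuous _).measurable.comp (h.measurable _))
  have h1 : Tendsto (fun m => ∫ ω, Complex.exp ((S m ω : ℝ) * Complex.I) ∂P) atTop
      (𝓝 (∫ ω, Complex.exp ((L (affPath A 0 0 (fun s => n s ω) t) : ℝ) * Complex.I) ∂P)) := by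
    refine tendsto_integral_of_dominated_convergence (fun _ => 1) (fun m => ?_)
      (integrable_const _) (fun m => ?_) ?_
    · exact ((Complex.continuous_exp.comp
        (by fun_prop : Continuous fun x : ℝ => (x : ℂ) * Complex.I)).measurable.comp
        (hmeasS m)).aestronglyMeasurable
    · exact Eventually.of_forall fun ω => (Complex.norm_exp_ofReal_mul_I _).le
    · refine Eventually.of_forall fun ω => ?_
      exact ((Complex.continuous_exp.comp
        (by fun_prop : Continuous fun x : ℝ => (x : ℂ) * Complex.I)).tendsto _).comp (hlim ω)
  have h2 : ∀ m, ∫ ω, Complex.exp ((S m ω : ℝ) * Complex.I) ∂P = Complex.exp (-((∑ j ∈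
      Finset.range (m + 1), ∫ r in s m j..s m (j + 1),
        ∑ i, (L (flow A (t - s m (j + 1)) (e i))) ^ 2 : ℝ) : ℂ) / 2) := by
    intro m
    rw [h.charFun (m + 1) (s m) (by simp [hs]) (monotone_nat_of_le_succ (hle m))
      (fun j => L.comp (flow A (t - s m (j + 1))))]
    simp
  -- The flow multiplying an increment is taken at the right end of its interval, so the variance is
  -- a Riemann sum with right tags, and the integration variable itself is idle.
  have h3 := tendsto_sum_integral_tag (F := fun _ x => ∑ i, (L (flow A (t - x) (e i))) ^ 2)
    (τ := fun m j => s m (j + 1)) (by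
      refine continuous_finsetSum _ fun i _ => ?_
      refine (L.continuous.comp (Continuous.clm_apply ((continuous_flow A).comp ?_)
        continuous_const)).pow 2
      fun_prop) ht (s := s) (fun _ _ => rfl) (fun m j => ⟨hle m j, le_rfl⟩)
  rw [intervalIntegral.integral_comp_sub_left (fun r => ∑ i, (L (flow A r (e i))) ^ 2) t, sub_self,
    sub_zero] at h3
  simp only [h2] at h1
  refine tendsto_nhds_unique h1 ?_
  exact ((by fun_prop : Continuous fun x : ℝ => Complex.exp (-(x : ℂ) / 2)).tendsto _).comp h3

end Noise

/-! ### Moments of centred Gaussian vectors. -/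

section Gaussian

variable {Ω : Type*} [MeasurableSpace Ω] {P : Measure Ω} [IsProbabilityMeasure P]
  {V : Type*} [NormedAddCommGroup V] [NormedSpace ℝ V] [FiniteDimensional ℝ V]
  [MeasurableSpace V] [BorelSpace V]

/-- `N` is a centred Gaussian vector and `q L` is the variance of `L N`. -/
structure IsCenteredGaussian (P : Measure Ω) (N : Ω → V) (q : StrongDual ℝ V → ℝ) : Prop where
  measurable : Measurable N
  nonneg : ∀ L, 0 ≤ q L
  smul : ∀ (r : ℝ) L, q (r • L) = r ^ 2 * q L
  charFun : ∀ L, ∫ ω, Complex.exp ((L (N ω) : ℝ) * Complex.I) ∂P = Complex.exp (-(q L : ℂ) / 2)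

namespace IsCenteredGaussian

variable {N : Ω → V} {q : StrongDual ℝ V → ℝ}

omit [FiniteDimensional ℝ V] in
theorem measurable_dual (h : IsCenteredGaussian P N q) (L : StrongDual ℝ V) :
    Measurable fun ω => L (N ω) :=
  L.continuous.measurable.comp h.measurable

omit [FiniteDimensional ℝ V] in
-- The characteristic function at `r` is the defining identity for the functional `r • L`, and `q`
-- is homogeneous of degree two.
theorem map_eq (h : IsCenteredGaussian P N q) (L : StrongDual ℝ V) :
    P.map (fun ω => L (N ω)) = gaussianReal 0 (q L).toNNReal := by
  have hm := h.measurable_dual L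
  have : IsProbabilityMeasure (P.map fun ω => L (N ω)) :=
    Measure.isProbabilityMeasure_map hm.aemeasurable
  refine Measure.ext_of_charFun (funext fun r => ?_)
  rw [charFun_apply_real, charFun_gaussianReal, integral_map hm.aemeasurable
    (by fun_prop : Continuous fun x : ℝ => Complex.exp (r * x * Complex.I)).aestronglyMeasurable]
  have := h.charFun (r • L)
  rw [h.smul] at this
  convert! this using 2
  · simp
  · congr 1
    simp [h.nonneg L]
    ring

theorem gaussianReal_moment (v : ℝ≥0) (p : ℕ) :
    Integrable (fun x : ℝ => |x| ^ p) (gaussianReal 0 v) ∧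
    ∫ x, |x| ^ p ∂(gaussianReal 0 v) = (√v) ^ p * ∫ x, |x| ^ p ∂(gaussianReal 0 1) := by
  constructor
  · have := (memLp_id_gaussianReal (μ := 0) (v := v) (p : ℝ≥0)).integrable_norm_pow'
    simpa using this
  · have hv : gaussianReal 0 v = (gaussianReal 0 1).map (fun x => √v * x) := by
      rw [gaussianReal_map_const_mul]
      congr 1
      · simp
      · ext; simp
    rw [hv, integral_map (by fun_prop) (by fun_prop : Continuous fun x : ℝ => |x| ^ p).aestronglyMeasurable]
    simp only [abs_mul, mul_pow, integral_const_mul, abs_of_nonneg (Real.sqrt_nonneg _)]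

omit [FiniteDimensional ℝ V] in
theorem moment_dual (h : IsCenteredGaussian P N q) (L : StrongDual ℝ V) (p : ℕ) :
    Integrable (fun ω => |L (N ω)| ^ p) P ∧
    ∫ ω, |L (N ω)| ^ p ∂P = (√(q L)) ^ p * ∫ x, |x| ^ p ∂(gaussianReal 0 1) := by
  have hm := h.measurable_dual L
  have hc : Continuous fun x : ℝ => |x| ^ p := by fun_prop
  have := gaussianReal_moment (q L).toNNReal p
  rw [← h.map_eq L] at this
  rw [integrable_map_measure hc.aestronglyMeasurable hm.aemeasurable,
    integral_map hm.aemeasurable hc.aestronglyMeasurable, Real.coe_toNNReal _ (h.nonneg L)] at this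
  exact this

/-- Moments of a Gaussian vector, in terms of a bound for its covariance. -/
theorem exists_moment_bound (V : Type*) [NormedAddCommGroup V] [NormedSpace ℝ V]
    [FiniteDimensional ℝ V] [MeasurableSpace V] [BorelSpace V] (P : Measure Ω)
    [IsProbabilityMeasure P] (p : ℕ) : ∃ M : ℝ, 0 ≤ M ∧
    ∀ (N : Ω → V) (q : StrongDual ℝ V → ℝ) (κ : ℝ), IsCenteredGaussian P N q → 0 ≤ κ →
      (∀ L, q L ≤ κ ^ 2 * ‖L‖ ^ 2) →
      Integrable (fun ω => ‖N ω‖ ^ p) P ∧ ∫ ω, ‖N ω‖ ^ p ∂P ≤ M * κ ^ p := by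
  rcases Nat.eq_zero_or_pos p with rfl | hp
  · exact ⟨1, zero_le_one, fun N q κ _ _ _ => by simp⟩
  obtain ⟨k, rfl⟩ : ∃ k, p = k + 1 := ⟨p - 1, by omega⟩
  let b := Module.finBasis ℝ V
  let ℓ : Fin (Module.finrank ℝ V) → StrongDual ℝ V :=
    fun i => LinearMap.toContinuousLinearMap (b.coord i)
  set D : ℝ := ((Finset.univ : Finset (Fin (Module.finrank ℝ V))).card : ℝ) with hD
  set m : ℝ := ∫ x, |x| ^ (k + 1) ∂(gaussianReal 0 1) with hm
  have hm0 : 0 ≤ m := integral_nonneg fun x => by positivity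
  -- The power mean inequality in a fixed basis reduces the norm to its coordinates. The constant
  -- involves only the basis and a standard Gaussian moment; all dependence on the vector is in `κ`.
  refine ⟨D ^ k * ∑ i, (‖b i‖ ^ (k + 1) * (‖ℓ i‖ ^ (k + 1) * m)),
    by positivity, fun N q κ h hκ hq => ?_⟩
  have hle : ∀ v : V, ‖v‖ ^ (k + 1) ≤ D ^ k * ∑ i, ‖b i‖ ^ (k + 1) * |ℓ i v| ^ (k + 1) := by
    intro v
    have h1 : ‖v‖ ≤ ∑ i, ‖b i‖ * |ℓ i v| := by
      conv_lhs => rw [← b.sum_repr v]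
      refine norm_sum_le_of_le _ fun i _ => ?_
      rw [norm_smul, mul_comm]
      simp [ℓ]
    calc ‖v‖ ^ (k + 1) ≤ (∑ i, ‖b i‖ * |ℓ i v|) ^ (k + 1) := by gcongr
      _ ≤ D ^ k * ∑ i, (‖b i‖ * |ℓ i v|) ^ (k + 1) := by
        rw [hD]
        exact pow_sum_le_card_mul_sum_pow (fun i _ => by positivity) k
      _ = _ := by simp only [mul_pow]
  have hi : Integrable (fun ω => D ^ k * ∑ i, ‖b i‖ ^ (k + 1) * |ℓ i (N ω)| ^ (k + 1)) P :=
    (integrable_finsetSum _ fun i _ => ((h.moment_dual (ℓ i) (k + 1)).1.const_mul _)).const_mul _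
  have hI : Integrable (fun ω => ‖N ω‖ ^ (k + 1)) P := by
    refine hi.mono' (by
      exact ((by fun_prop : Continuous fun v : V => ‖v‖ ^ (k + 1)).measurable.comp
        h.measurable).aestronglyMeasurable) (Eventually.of_forall fun ω => ?_)
    rw [Real.norm_of_nonneg (by positivity)]
    exact hle _
  refine ⟨hI, (integral_mono hI hi fun ω => hle _).trans ?_⟩
  rw [integral_const_mul, integral_finsetSum _ fun i _ =>
    ((h.moment_dual (ℓ i) (k + 1)).1.const_mul _), mul_assoc, Finset.sum_mul]
  refine mul_le_mul_of_nonneg_left (Finset.sum_le_sum fun i _ => ?_) (by positivity)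
  rw [integral_const_mul, (h.moment_dual (ℓ i) (k + 1)).2, mul_assoc]
  refine mul_le_mul_of_nonneg_left ?_ (by positivity)
  have hs : √(q (ℓ i)) ≤ κ * ‖ℓ i‖ := by
    rw [Real.sqrt_le_left (by positivity), mul_pow]
    exact hq _
  calc √(q (ℓ i)) ^ (k + 1) * m ≤ (κ * ‖ℓ i‖) ^ (k + 1) * m := by gcongr
    _ = _ := by rw [mul_pow]; ring

omit [FiniteDimensional ℝ V] in
theorem integral_dual (h : IsCenteredGaussian P N q) (L : StrongDual ℝ V) :
    Integrable (fun ω => L (N ω)) P ∧ ∫ ω, L (N ω) ∂P = 0 := by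
  have hm := h.measurable_dual L
  have h1 : Integrable (fun x : ℝ => x) (P.map fun ω => L (N ω)) := by
    rw [h.map_eq L]
    exact (memLp_id_gaussianReal (μ := 0) (v := (q L).toNNReal) 1).integrable le_rfl
  have h2 : ∫ x, x ∂(P.map fun ω => L (N ω)) = 0 := by
    rw [h.map_eq L, integral_id_gaussianReal]
  rw [integrable_map_measure (by fun_prop) hm.aemeasurable] at h1
  rw [integral_map hm.aemeasurable (by fun_prop)] at h2
  exact ⟨h1, h2⟩

omit [FiniteDimensional ℝ V] in
theorem integral_dual_sq (h : IsCenteredGaussian P N q) (L : StrongDual ℝ V) :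
    Integrable (fun ω => L (N ω) ^ 2) P ∧ ∫ ω, L (N ω) ^ 2 ∂P = q L := by
  have h0 := h.moment_dual L 2
  simp only [sq_abs] at h0
  refine ⟨h0.1, ?_⟩
  have hv : ∫ x, x ^ 2 ∂(gaussianReal 0 1) = 1 := by
    have := variance_id_gaussianReal (μ := 0) (v := 1)
    rw [variance_eq_integral (by fun_prop)] at this
    simpa using this
  rw [h0.2, hv, Real.sq_sqrt (h.nonneg L), mul_one]

/-- The mean of a linear image of a centred Gaussian vector. -/
theorem integral_clm {E : Type*} [NormedAddCommGroup E] [NormedSpace ℝ E] [CompleteSpace E]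
    (h : IsCenteredGaussian P N q) (T : V →L[ℝ] E) :
    Integrable (fun ω => T (N ω)) P ∧ ∫ ω, T (N ω) ∂P = 0 := by
  let b := Module.finBasis ℝ V
  have hrep : ∀ ω, T (N ω) = ∑ i, (LinearMap.toContinuousLinearMap (b.coord i)) (N ω) • T (b i) := by
    intro ω
    conv_lhs => rw [← b.sum_repr (N ω), map_sum]
    simp
  simp only [hrep]
  have hI := fun i => (h.integral_dual (LinearMap.toContinuousLinearMap (b.coord i))).1.smul_const
    (T (b i))
  refine ⟨integrable_finsetSum _ fun i _ => hI i, ?_⟩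
  rw [integral_finsetSum _ fun i _ => hI i]
  refine Finset.sum_eq_zero fun i _ => ?_
  rw [integral_smul_const, (h.integral_dual _).2, zero_smul]

omit [FiniteDimensional ℝ V] in
-- Polarisation of the variance.
theorem integral_dual_mul (h : IsCenteredGaussian P N q) (L L' : StrongDual ℝ V) :
    Integrable (fun ω => L (N ω) * L' (N ω)) P ∧
    ∫ ω, L (N ω) * L' (N ω) ∂P = (q (L + L') - q L - q L') / 2 := by
  have h1 := h.integral_dual_sq (L + L')
  have h2 := h.integral_dual_sq L
  have h3 := h.integral_dual_sq L'
  have he : (fun ω => L (N ω) * L' (N ω)) =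
      fun ω => (((L + L') (N ω)) ^ 2 - L (N ω) ^ 2 - L' (N ω) ^ 2) / 2 := by
    funext ω
    simp only [add_apply]
    ring
  rw [he]
  have hs : Integrable (fun ω => (L + L') (N ω) ^ 2 - L (N ω) ^ 2) P := h1.1.sub h2.1
  refine ⟨(hs.sub h3.1).div_const 2, ?_⟩
  rw [integral_div, integral_sub hs h3.1, integral_sub h1.1 h2.1, h1.2, h2.2, h3.2]

end IsCenteredGaussian

end Gaussian

/-! ### An exponential integral. -/

section ExpIntegral

theorem integral_exp_neg_mul_le {c : ℝ} (hc : 0 < c) (t : ℝ) :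
    ∫ r in (0 : ℝ)..t, Real.exp (-c * r) ≤ 1 / c := by
  have hd : ∀ r, HasDerivAt (fun r => -(Real.exp (-c * r)) / c) (Real.exp (-c * r)) r := by
    intro r
    have := (((hasDerivAt_id r).const_mul (-c)).exp.neg).div_const c
    refine HasDerivAt.congr_deriv (f := fun r => -(Real.exp (-c * r)) / c) this ?_
    simp only [mul_one, id]
    field_simp
  rw [intervalIntegral.integral_eq_sub_of_hasDerivAt (fun r _ => hd r)
    (Continuous.intervalIntegrable (by fun_prop) _ _)]
  have := Real.exp_pos (-c * t)
  simp only [mul_zero, Real.exp_zero]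
  rw [← sub_div]
  gcongr
  linarith

end ExpIntegral

/-! ### Uniform moment bounds for families of linear equations. -/

section LinFam

variable {Ω : Type*} [MeasurableSpace Ω] {P : Measure Ω} [IsProbabilityMeasure P]
  {ι : Type*} [Fintype ι] {Θ : Type*}
  {V : Type*} [NormedAddCommGroup V] [NormedSpace ℝ V] [FiniteDimensional ℝ V] [CompleteSpace V]
  [MeasurableSpace V] [BorelSpace V]
  {E : Type*} [NormedAddCommGroup E] [NormedSpace ℝ E] [CompleteSpace E]

/-- A family of linear equations `dU = (a(θ) - A(θ) U) dt + dn`, with uniformly bounded coefficients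
and a uniform exponential decay of the flow. -/
structure LinFam (P : Measure Ω) (A : Θ → V →L[ℝ] V) (a : Θ → V) (e : ι → V) (n : ℝ → Ω → V)
    (K c : ℝ) : Prop where
  one_le : 1 ≤ K
  pos : 0 < c
  norm_A : ∀ θ, ‖A θ‖ ≤ K
  norm_a : ∀ θ, ‖a θ‖ ≤ K
  norm_e : ∀ i, ‖e i‖ ≤ K
  decay : ∀ θ t, 0 ≤ t → ‖flow (A θ) t‖ ≤ K * Real.exp (-c * t)
  noise : IsNoise P e n

omit [CompleteSpace V] in
theorem IsNoise.measurable_uncurry {e : ι → V} {n : ℝ → Ω → V} (h : IsNoise P e n) :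
    Measurable (Function.uncurry n) := by
  have := FiniteDimensional.proper ℝ V
  exact measurable_uncurry_of_continuous_of_measurable h.continuous h.measurable

/-- A Carathéodory argument: continuity in time plus measurability in `ω` gives joint measurability.
-/
theorem IsNoise.measurable_affPath {e : ι → V} {n : ℝ → Ω → V} (h : IsNoise P e n)
    (A : V →L[ℝ] V) (a u : V) :
    Measurable fun p : ℝ × Ω => affPath A a u (fun s => n s p.2) p.1 := by
  have := FiniteDimensional.proper ℝ V
  refine measurable_uncurry_of_continuous_of_measurable
    (u := fun t ω => affPath A a u (fun s => n s ω) t)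
    (fun ω => continuous_affPath A a u (h.continuous ω)) fun t => ?_
  unfold affPath
  refine ((h.measurable t).add measurable_const).add ?_
  have hm : Measurable fun p : Ω × ℝ => flow A (t - p.2) (a - A (n p.2 p.1)) := by
    have h1 : Continuous fun p : ℝ × V => flow A (t - p.1) (a - A p.2) :=
      Continuous.clm_apply ((continuous_flow A).comp (by fun_prop)) (by fun_prop)
    have h2 : Measurable fun p : Ω × ℝ => (p.2, n p.2 p.1) :=
      measurable_snd.prodMk (h.measurable_uncurry.comp measurable_swap)
    exact h1.measurable.comp h2
  simp only [intervalIntegral]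
  exact (hm.stronglyMeasurable.integral_prod_right (ν := volume.restrict (Ioc 0 t))).measurable.sub
    (hm.stronglyMeasurable.integral_prod_right (ν := volume.restrict (Ioc t 0))).measurable

theorem IsNoise.isCenteredGaussian_affPath {e : ι → V} {n : ℝ → Ω → V} (h : IsNoise P e n)
    (A : V →L[ℝ] V) {t : ℝ} (ht : 0 ≤ t) :
    IsCenteredGaussian P (fun ω => affPath A 0 0 (fun s => n s ω) t)
      (fun L => ∫ r in (0 : ℝ)..t, ∑ i, (L (flow A r (e i))) ^ 2) where
  measurable := (h.measurable_affPath A 0 0).comp (measurable_const.prodMk measurable_id)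
  nonneg L := intervalIntegral.integral_nonneg ht fun r _ => by positivity
  smul r L := by
    rw [← intervalIntegral.integral_const_mul]
    congr 1
    funext x
    rw [Finset.mul_sum]
    simp [mul_pow]
  charFun L := h.integral_exp_affPath A ht L

/-- The value at `t` is the single increment from time `0`. -/
theorem IsNoise.isCenteredGaussian {e : ι → V} {n : ℝ → Ω → V} (h : IsNoise P e n)
    {t : ℝ} (ht : 0 ≤ t) :
    IsCenteredGaussian P (n t) (fun L => t * ∑ i, (L (e i)) ^ 2) where
  measurable := h.measurable t
  nonneg L := by positivity
  smul r L := by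
    rw [Finset.mul_sum, Finset.mul_sum, Finset.mul_sum]
    refine Finset.sum_congr rfl fun i _ => ?_
    simp only [smul_apply, smul_eq_mul]
    ring
  charFun L := by
    have := h.charFun 1 (fun j => j * t) (by simp) (fun i j hij => by
      dsimp only
      gcongr) (fun _ => L)
    simpa [h.zero] using this

namespace LinFam

variable {A : Θ → V →L[ℝ] V} {a : Θ → V} {e : ι → V} {n : ℝ → Ω → V} {K c : ℝ}

omit [IsProbabilityMeasure P] [FiniteDimensional ℝ V] [BorelSpace V] [CompleteSpace V] in
theorem norm_flow_le (h : LinFam P A a e n K c) (θ : Θ) {t : ℝ} (ht : 0 ≤ t) :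
    ‖flow (A θ) t‖ ≤ K := by
  refine (h.decay θ t ht).trans (mul_le_of_le_one_right (by linarith [h.one_le]) ?_)
  rw [Real.exp_le_one_iff]
  nlinarith [h.pos]

omit [IsProbabilityMeasure P] [FiniteDimensional ℝ V] [BorelSpace V] in
theorem norm_drift_le (h : LinFam P A a e n K c) (θ : Θ) {t : ℝ} (ht : 0 ≤ t) :
    ‖∫ s in (0 : ℝ)..t, flow (A θ) s (a θ)‖ ≤ K ^ 2 / c ∧
    ‖∫ s in (0 : ℝ)..t, flow (A θ) s (a θ)‖ ≤ K ^ 2 * t := by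
  have hK : 0 ≤ K := by linarith [h.one_le]
  constructor
  · calc ‖∫ s in (0 : ℝ)..t, flow (A θ) s (a θ)‖
        ≤ ∫ s in (0 : ℝ)..t, K ^ 2 * Real.exp (-c * s) := by
          refine intervalIntegral.norm_integral_le_of_norm_le ht ?_
            (Continuous.intervalIntegrable (by fun_prop) _ _)
          refine Eventually.of_forall fun s hs => ?_
          refine (ContinuousLinearMap.le_opNorm _ _).trans ?_
          calc _ ≤ K * Real.exp (-c * s) * K :=
                mul_le_mul (h.decay θ s hs.1.le) (h.norm_a θ) (norm_nonneg _) (by positivity)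
            _ = _ := by ring
      _ ≤ K ^ 2 * (1 / c) := by
          rw [intervalIntegral.integral_const_mul]
          exact mul_le_mul_of_nonneg_left (integral_exp_neg_mul_le h.pos t) (by positivity)
      _ = _ := by ring
  · refine (intervalIntegral.norm_integral_le_of_norm_le_const (C := K ^ 2) fun s hs => ?_).trans_eq
      (by rw [sub_zero, abs_of_nonneg ht])
    rw [uIoc_of_le ht] at hs
    refine (ContinuousLinearMap.le_opNorm _ _).trans ?_
    rw [sq]
    exact mul_le_mul (h.norm_flow_le θ hs.1.le) (h.norm_a θ) (norm_nonneg _) hK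

omit [IsProbabilityMeasure P] [FiniteDimensional ℝ V] [BorelSpace V] in
-- Two regimes: the decay of the flow bounds the variance for all times, while the bound linear in
-- `t` shows that short-time increments have size `√t`, as the generator requires.
theorem variance_le (h : LinFam P A a e n K c) (θ : Θ) {t : ℝ} (ht : 0 ≤ t) (L : StrongDual ℝ V) :
    ∫ r in (0 : ℝ)..t, ∑ i, (L (flow (A θ) r (e i))) ^ 2 ≤
      Fintype.card ι * K ^ 4 / (2 * c) * ‖L‖ ^ 2 ∧
    ∫ r in (0 : ℝ)..t, ∑ i, (L (flow (A θ) r (e i))) ^ 2 ≤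
      Fintype.card ι * K ^ 4 * t * ‖L‖ ^ 2 := by
  have hK : 0 ≤ K := by linarith [h.one_le]
  have hc := h.pos
  have hcont : Continuous fun r => ∑ i, (L (flow (A θ) r (e i))) ^ 2 :=
    continuous_finsetSum _ fun i _ => (L.continuous.comp
      ((continuous_flow (A θ)).clm_apply continuous_const)).pow 2
  have hterm : ∀ r, 0 ≤ r → ∑ i, (L (flow (A θ) r (e i))) ^ 2 ≤
      Fintype.card ι * K ^ 4 * ‖L‖ ^ 2 * Real.exp (-(2 * c) * r) := by
    intro r hr
    have h1 : ∀ i ∈ (Finset.univ : Finset ι), (L (flow (A θ) r (e i))) ^ 2 ≤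
        K ^ 4 * ‖L‖ ^ 2 * Real.exp (-(2 * c) * r) := by
      intro i _
      have : |L (flow (A θ) r (e i))| ≤ ‖L‖ * (K * Real.exp (-c * r) * K) :=
        (L.le_opNorm _).trans (mul_le_mul_of_nonneg_left
          (((flow (A θ) r).le_opNorm _).trans (mul_le_mul (h.decay θ r hr) (h.norm_e i)
            (norm_nonneg _) (by positivity))) (norm_nonneg _))
      rw [← sq_abs]
      calc _ ≤ (‖L‖ * (K * Real.exp (-c * r) * K)) ^ 2 := by gcongr
        _ = K ^ 4 * ‖L‖ ^ 2 * (Real.exp (-c * r) * Real.exp (-c * r)) := by ring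
        _ = _ := by rw [← Real.exp_add]; congr 2; ring
    refine (Finset.sum_le_card_nsmul _ _ _ h1).trans_eq ?_
    rw [nsmul_eq_mul, Finset.card_univ]
    ring
  constructor
  · calc _ ≤ ∫ r in (0 : ℝ)..t, Fintype.card ι * K ^ 4 * ‖L‖ ^ 2 * Real.exp (-(2 * c) * r) :=
          intervalIntegral.integral_mono_on ht (hcont.intervalIntegrable _ _)
            (Continuous.intervalIntegrable (by fun_prop) _ _) fun r hr => hterm r hr.1
      _ ≤ Fintype.card ι * K ^ 4 * ‖L‖ ^ 2 * (1 / (2 * c)) := by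
          rw [intervalIntegral.integral_const_mul]
          exact mul_le_mul_of_nonneg_left (integral_exp_neg_mul_le (by positivity) t)
            (by positivity)
      _ = _ := by ring
  · calc _ ≤ ∫ r in (0 : ℝ)..t, Fintype.card ι * K ^ 4 * ‖L‖ ^ 2 :=
          intervalIntegral.integral_mono_on ht (hcont.intervalIntegrable _ _)
            (Continuous.intervalIntegrable (by fun_prop) _ _) fun r hr =>
            (hterm r hr.1).trans (mul_le_of_le_one_right (by positivity) (by
              rw [Real.exp_le_one_iff]; nlinarith [hr.1]))
      _ = _ := by simp; ring

/-- Moments of the noise, uniform in time and in the parameter. -/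
theorem exists_noise_moment (h : LinFam P A a e n K c) (p : ℕ) : ∃ M : ℝ, 0 ≤ M ∧
    ∀ θ t, 0 ≤ t → Integrable (fun ω => ‖affPath (A θ) 0 0 (fun s => n s ω) t‖ ^ p) P ∧
      ∫ ω, ‖affPath (A θ) 0 0 (fun s => n s ω) t‖ ^ p ∂P ≤ M ∧
      ∫ ω, ‖affPath (A θ) 0 0 (fun s => n s ω) t‖ ^ p ∂P ≤ M * √t ^ p := by
  obtain ⟨M, hM, hb⟩ := IsCenteredGaussian.exists_moment_bound V P p
  have hK : 0 ≤ K := by linarith [h.one_le]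
  have hc := h.pos
  set κ₁ := √(Fintype.card ι * K ^ 4 / (2 * c))
  set κ₂ := √(Fintype.card ι * K ^ 4)
  refine ⟨max (M * κ₁ ^ p) (M * κ₂ ^ p), le_max_of_le_left (by positivity), fun θ t ht => ?_⟩
  have hG := h.noise.isCenteredGaussian_affPath (A θ) ht
  have h1 := hb _ _ κ₁ hG (Real.sqrt_nonneg _) (fun L => by
    rw [Real.sq_sqrt (by positivity)]; exact (h.variance_le θ ht L).1)
  have h2 := hb _ _ (κ₂ * √t) hG (by positivity) (fun L => by
    rw [mul_pow, Real.sq_sqrt (by positivity), Real.sq_sqrt ht]; exact (h.variance_le θ ht L).2)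
  refine ⟨h1.1, h1.2.trans (le_max_left _ _), h2.2.trans ?_⟩
  rw [mul_pow, ← mul_assoc]
  exact mul_le_mul_of_nonneg_right (le_max_right _ _) (by positivity)

/-- Polynomial moments of the solutions, uniform in time and in the parameter. -/
theorem exists_moment (h : LinFam P A a e n K c) (p : ℕ) : ∃ M : ℝ, 0 ≤ M ∧
    ∀ θ t, 0 ≤ t → ∃ b : Ω → ℝ, Integrable b P ∧ ∫ ω, b ω ∂P ≤ M ∧
      ∀ u ω, (1 + ‖affPath (A θ) (a θ) u (fun s => n s ω) t‖) ^ p ≤ b ω * (1 + ‖u‖) ^ p := by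
  obtain ⟨M, hM, hb⟩ := h.exists_noise_moment p
  have hK := h.one_le
  have hc := h.pos
  have hK2 : 0 ≤ K ^ 2 / c := by positivity
  set κ := (1 + K) * (1 + K ^ 2 / c) with hκ
  have hκ0 : 0 ≤ κ := by positivity
  refine ⟨κ ^ p * (2 ^ (p - 1) * (1 + M)), by positivity, fun θ t ht => ?_⟩
  have hb' := hb θ t ht
  -- The dominating function does not involve the initial value, so it can serve as the integrable
  -- weight for derivatives in `u`; `κ` absorbs the flow and the drift.
  refine ⟨fun ω => κ ^ p * (2 ^ (p - 1) * (1 + ‖affPath (A θ) 0 0 (fun s => n s ω) t‖ ^ p)),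
    (((integrable_const _).add hb'.1).const_mul _).const_mul _, ?_, fun u ω => ?_⟩
  · rw [integral_const_mul, integral_const_mul, integral_add (integrable_const _) hb'.1]
    simp only [integral_const, probReal_univ, one_smul]
    have := hb'.2.1
    gcongr
  · rw [affPath_eq_add _ _ _ (h.noise.continuous ω)]
    set N := affPath (A θ) 0 0 (fun s => n s ω) t
    have h1 : ‖flow (A θ) t u‖ ≤ K * ‖u‖ := ((flow (A θ) t).le_opNorm u).trans
      (mul_le_mul_of_nonneg_right (h.norm_flow_le θ ht) (norm_nonneg _))
    have h2 := (h.norm_drift_le θ ht).1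
    set D := ∫ s in (0 : ℝ)..t, flow (A θ) s (a θ)
    have h3 : 1 + ‖flow (A θ) t u + D + N‖ ≤ κ * (1 + ‖u‖) * (1 + ‖N‖) := by
      have h4 := norm_add₃_le (a := flow (A θ) t u) (b := D) (c := N)
      have h5 : 1 + K * ‖u‖ + K ^ 2 / c ≤ κ * (1 + ‖u‖) := by
        rw [hκ]
        have := norm_nonneg u
        have h6 : 0 ≤ K * (K ^ 2 / c) := by positivity
        nlinarith [mul_nonneg hK2 this, mul_nonneg h6 this]
      have h7 : 1 ≤ κ * (1 + ‖u‖) := by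
        refine le_trans ?_ h5
        have : 0 ≤ K * ‖u‖ := by positivity
        linarith
      nlinarith [norm_nonneg N]
    calc (1 + ‖flow (A θ) t u + D + N‖) ^ p ≤ (κ * (1 + ‖u‖) * (1 + ‖N‖)) ^ p := by gcongr
      _ = κ ^ p * (1 + ‖N‖) ^ p * (1 + ‖u‖) ^ p := by rw [mul_pow, mul_pow]; ring
      _ ≤ κ ^ p * (2 ^ (p - 1) * (1 ^ p + ‖N‖ ^ p)) * (1 + ‖u‖) ^ p := by
        gcongr
        exact add_pow_le zero_le_one (norm_nonneg _) p
      _ = _ := by rw [one_pow]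

end LinFam

end LinFam

/-! ### Transition operators: smoothness, contraction and the semigroup law. -/

section Semigroup

variable {Ω : Type*} [MeasurableSpace Ω] {P : Measure Ω} [IsProbabilityMeasure P]
  {ι : Type*} [Fintype ι] {Θ : Type*}
  {V : Type*} [NormedAddCommGroup V] [NormedSpace ℝ V] [FiniteDimensional ℝ V] [CompleteSpace V]
  [MeasurableSpace V] [BorelSpace V]
  {E : Type*} [NormedAddCommGroup E] [NormedSpace ℝ E] [CompleteSpace E]

/-- The transition operators of the solutions of `dU = (a - A U) dt + dn`. -/
noncomputable def transOp (P : Measure Ω) (A : V →L[ℝ] V) (a : V) (n : ℝ → Ω → V) (t : ℝ)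
    (ψ : V → E) (u : V) : E :=
  ∫ ω, ψ (affPath A a u (fun s => n s ω) t) ∂P

/-- Polynomial growth of a function. -/
def PolyBdd (C : ℝ) (N : ℕ) (ψ : V → E) : Prop := ∀ v, ‖ψ v‖ ≤ C * (1 + ‖v‖) ^ N

/-- `C²` functions which have polynomial growth together with their derivatives. -/
structure PolyC2 (C : ℝ) (N : ℕ) (ψ : V → E) : Prop where
  contDiff : ContDiff ℝ 2 ψ
  bdd : PolyBdd C N ψ
  bdd_fderiv : PolyBdd C N (fderiv ℝ ψ)
  bdd_fderiv_fderiv : PolyBdd C N (fderiv ℝ (fderiv ℝ ψ))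

omit [FiniteDimensional ℝ V] [CompleteSpace V] [MeasurableSpace V] [BorelSpace V]
  [CompleteSpace E] in
theorem PolyBdd.nonneg {C : ℝ} {N : ℕ} {ψ : V → E} (h : PolyBdd C N ψ) : 0 ≤ C := by
  have := (norm_nonneg _).trans (h 0)
  simpa using this

omit [FiniteDimensional ℝ V] [CompleteSpace V] [MeasurableSpace V] [BorelSpace V]
  [CompleteSpace E] in
theorem PolyBdd.mono {C C' : ℝ} {N N' : ℕ} {ψ : V → E} (h : PolyBdd C N ψ) (hC : C ≤ C')
    (hN : N ≤ N') : PolyBdd C' N' ψ := fun v => (h v).trans (by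
  have := h.nonneg.trans hC
  have h1 : (1 + ‖v‖) ^ N ≤ (1 + ‖v‖) ^ N' :=
    pow_le_pow_right₀ (by linarith [norm_nonneg v]) hN
  gcongr)

omit [FiniteDimensional ℝ V] [CompleteSpace V] [MeasurableSpace V] [BorelSpace V]
  [CompleteSpace E] in
theorem PolyC2.mono {C C' : ℝ} {N N' : ℕ} {ψ : V → E} (h : PolyC2 C N ψ) (hC : C ≤ C')
    (hN : N ≤ N') : PolyC2 C' N' ψ :=
  ⟨h.contDiff, h.bdd.mono hC hN, h.bdd_fderiv.mono hC hN, h.bdd_fderiv_fderiv.mono hC hN⟩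

theorem IsNoise.stronglyMeasurable_comp_affPath {e : ι → V} {n : ℝ → Ω → V} (h : IsNoise P e n)
    (A : V →L[ℝ] V) (a : V) {ψ : V → E} (hψ : Continuous ψ) :
    StronglyMeasurable fun p : (ℝ × V) × Ω =>
      ψ (affPath A a p.1.2 (fun s => n s p.2) p.1.1) := by
  have := FiniteDimensional.proper ℝ V
  refine hψ.comp_stronglyMeasurable (Measurable.stronglyMeasurable ?_)
  simp only [fun p : (ℝ × V) × Ω => affPath_eq_add A a p.1.2 (h.continuous p.2) p.1.1]
  have h1 : Continuous fun p : ℝ × V => flow A p.1 p.2 + ∫ s in (0 : ℝ)..p.1, flow A s a := by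
    refine (Continuous.clm_apply ((continuous_flow A).comp continuous_fst) continuous_snd).add ?_
    exact (intervalIntegral.continuous_primitive (fun _ _ => Continuous.intervalIntegrable
      ((continuous_flow A).clm_apply continuous_const) _ _) 0).comp continuous_fst
  refine (h1.measurable.comp measurable_fst).add ?_
  exact (h.measurable_affPath A 0 0).comp
    ((measurable_fst.comp measurable_fst).prodMk measurable_snd)

theorem IsNoise.aestronglyMeasurable_comp_affPath {e : ι → V} {n : ℝ → Ω → V} (h : IsNoise P e n)
    (A : V →L[ℝ] V) (a u : V) (t : ℝ) {ψ : V → E} (hψ : Continuous ψ) :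
    AEStronglyMeasurable (fun ω => ψ (affPath A a u (fun s => n s ω) t)) P :=
  ((h.stronglyMeasurable_comp_affPath A a hψ).comp_measurable
    (measurable_const.prodMk measurable_id : Measurable fun ω : Ω => (((t, u) : ℝ × V), ω))
    ).aestronglyMeasurable

theorem IsNoise.stronglyMeasurable_transOp {e : ι → V} {n : ℝ → Ω → V} (h : IsNoise P e n)
    (A : V →L[ℝ] V) (a : V) {ψ : V → E} (hψ : Continuous ψ) :
    StronglyMeasurable fun p : ℝ × V => transOp P A a n p.1 ψ p.2 :=
  (h.stronglyMeasurable_comp_affPath A a hψ).integral_prod_right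

omit [FiniteDimensional ℝ V] [CompleteSpace E] in
theorem IsNoise.transOp_zero {e : ι → V} {n : ℝ → Ω → V} (h : IsNoise P e n)
    (A : V →L[ℝ] V) (a u : V) (ψ : V → E) [CompleteSpace E] : transOp P A a n 0 ψ u = ψ u := by
  simp [transOp, affPath, h.zero]

omit [FiniteDimensional ℝ V] [CompleteSpace V] [MeasurableSpace V] [BorelSpace V]
  [CompleteSpace E] in
-- The solution is affine in its initial value with linear part `flow A t`; hence each derivative
-- gains one decaying factor.
theorem hasFDerivAt_comp_affPath (A : V →L[ℝ] V) (a : V) (n : ℝ → V) (t : ℝ)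
    {ψ : V → E} (hψ : Differentiable ℝ ψ) (u : V) :
    HasFDerivAt (fun u => ψ (affPath A a u n t))
      ((fderiv ℝ ψ (affPath A a u n t)).comp (flow A t)) u := by
  have h1 : HasFDerivAt (fun u => affPath A a u n t) (flow A t) u := by
    unfold affPath
    exact (((flow A t).hasFDerivAt).const_add _).add_const _
  exact (hψ _).hasFDerivAt.comp u h1

namespace LinFam

variable {A : Θ → V →L[ℝ] V} {a : Θ → V} {e : ι → V} {n : ℝ → Ω → V} {K c : ℝ}

/-- A bound for the moments of order `p` of the solutions. -/
noncomputable def mom (h : LinFam P A a e n K c) (p : ℕ) : ℝ := (h.exists_moment p).choose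

theorem mom_nonneg (h : LinFam P A a e n K c) (p : ℕ) : 0 ≤ h.mom p :=
  (h.exists_moment p).choose_spec.1

theorem exists_dominating (h : LinFam P A a e n K c) (p : ℕ) (θ : Θ) {t : ℝ} (ht : 0 ≤ t) :
    ∃ b : Ω → ℝ, Integrable b P ∧ ∫ ω, b ω ∂P ≤ h.mom p ∧
      ∀ u ω, (1 + ‖affPath (A θ) (a θ) u (fun s => n s ω) t‖) ^ p ≤ b ω * (1 + ‖u‖) ^ p :=
  (h.exists_moment p).choose_spec.2 θ t ht

theorem integrable_comp (h : LinFam P A a e n K c) (θ : Θ) {t : ℝ} (ht : 0 ≤ t) {C : ℝ} {N : ℕ}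
    {ψ : V → E} (hψ : Continuous ψ) (hb : PolyBdd C N ψ) (u : V) :
    Integrable (fun ω => ψ (affPath (A θ) (a θ) u (fun s => n s ω) t)) P := by
  obtain ⟨b, hbi, -, hle⟩ := h.exists_dominating N θ ht
  refine ((hbi.mul_const ((1 + ‖u‖) ^ N)).const_mul C).mono'
    (h.noise.aestronglyMeasurable_comp_affPath _ _ _ _ hψ) (Eventually.of_forall fun ω => ?_)
  exact (hb _).trans (mul_le_mul_of_nonneg_left (hle u ω) hb.nonneg)

omit [CompleteSpace E] in
theorem norm_integral_le (h : LinFam P A a e n K c) (θ : Θ) {t : ℝ} (ht : 0 ≤ t) {C : ℝ} {N : ℕ}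
    (hC : 0 ≤ C) (u : V) {g : Ω → E}
    (hg : ∀ ω, ‖g ω‖ ≤ C * (1 + ‖affPath (A θ) (a θ) u (fun s => n s ω) t‖) ^ N) :
    ‖∫ ω, g ω ∂P‖ ≤ C * h.mom N * (1 + ‖u‖) ^ N := by
  obtain ⟨b, hbi, hbM, hle⟩ := h.exists_dominating N θ ht
  refine (norm_integral_le_of_norm_le ((hbi.mul_const ((1 + ‖u‖) ^ N)).const_mul C)
    (Eventually.of_forall fun ω => ?_)).trans ?_
  · exact (hg ω).trans (mul_le_mul_of_nonneg_left (hle u ω) hC)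
  · rw [integral_const_mul, integral_mul_const, mul_assoc]
    gcongr

omit [CompleteSpace E] in
theorem norm_transOp_le (h : LinFam P A a e n K c) (θ : Θ) {t : ℝ} (ht : 0 ≤ t) {C : ℝ} {N : ℕ}
    {ψ : V → E} (hb : PolyBdd C N ψ) (u : V) :
    ‖transOp P (A θ) (a θ) n t ψ u‖ ≤ C * h.mom N * (1 + ‖u‖) ^ N :=
  h.norm_integral_le θ ht hb.nonneg u fun _ => hb _

/-- The transition operators preserve `C²` functions with polynomial growth, and the derivatives
decay in time. -/
theorem transOp_polyC2 (h : LinFam P A a e n K c) (θ : Θ) {t : ℝ} (ht : 0 ≤ t) {C : ℝ} {N : ℕ}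
    {ψ : V → E} (hψ : PolyC2 C N ψ) :
    ContDiff ℝ 2 (transOp P (A θ) (a θ) n t ψ) ∧
    (∀ u, ‖fderiv ℝ (transOp P (A θ) (a θ) n t ψ) u‖ ≤
      K ^ 2 * C * h.mom N * Real.exp (-c * t) * (1 + ‖u‖) ^ N) ∧
    (∀ u, ‖fderiv ℝ (fderiv ℝ (transOp P (A θ) (a θ) n t ψ)) u‖ ≤
      K ^ 2 * C * h.mom N * Real.exp (-c * t) * (1 + ‖u‖) ^ N) := by
  have hK := h.one_le
  have hC := hψ.bdd.nonneg
  have hexp1 : Real.exp (-c * t) ≤ 1 := by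
    rw [Real.exp_le_one_iff]; nlinarith [h.pos]
  have hexp := Real.exp_pos (-c * t)
  obtain ⟨b, hbi, hbM, hle⟩ := h.exists_dominating N θ ht
  set F : V → Ω → E := fun u ω => ψ (affPath (A θ) (a θ) u (fun s => n s ω) t) with hF
  have hd1 : ∀ ω u, fderiv ℝ (F · ω) u =
      (fderiv ℝ ψ (affPath (A θ) (a θ) u (fun s => n s ω) t)).comp (flow (A θ) t) := fun ω u =>
    (hasFDerivAt_comp_affPath _ _ _ t (hψ.contDiff.differentiable (by norm_num)) u).fderiv
  have hfd : Differentiable ℝ (fderiv ℝ ψ) :=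
    (hψ.contDiff.fderiv_right (m := 1) (by norm_num)).differentiable (by norm_num)
  have b1 : ∀ ω u, ‖fderiv ℝ (F · ω) u‖ ≤
      K ^ 2 * C * Real.exp (-c * t) * (1 + ‖affPath (A θ) (a θ) u (fun s => n s ω) t‖) ^ N := by
    intro ω u
    rw [hd1]
    refine (ContinuousLinearMap.opNorm_comp_le _ _).trans ?_
    calc _ ≤ C * (1 + ‖affPath (A θ) (a θ) u (fun s => n s ω) t‖) ^ N *
          (K * Real.exp (-c * t)) :=
          mul_le_mul (hψ.bdd_fderiv _) (h.decay θ t ht) (norm_nonneg _) (by positivity)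
      _ = K * C * Real.exp (-c * t) *
          (1 + ‖affPath (A θ) (a θ) u (fun s => n s ω) t‖) ^ N := by ring
      _ ≤ _ := by
          gcongr
          nlinarith
  have b2 : ∀ ω u, ‖fderiv ℝ (fderiv ℝ (F · ω)) u‖ ≤
      K ^ 2 * C * Real.exp (-c * t) * (1 + ‖affPath (A θ) (a θ) u (fun s => n s ω) t‖) ^ N := by
    intro ω u
    have he : fderiv ℝ (F · ω) = fun u => (ContinuousLinearMap.compL ℝ V V E).flip (flow (A θ) t)
        (fderiv ℝ ψ (affPath (A θ) (a θ) u (fun s => n s ω) t)) := funext fun u => hd1 ω u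
    have h2 := ((ContinuousLinearMap.compL ℝ V V E).flip (flow (A θ) t)).hasFDerivAt.comp u
      (hasFDerivAt_comp_affPath (A θ) (a θ) (fun s => n s ω) t hfd u)
    rw [he]
    refine (congrArg norm h2.fderiv).trans_le ?_
    refine ContinuousLinearMap.opNorm_le_bound _ (by positivity) fun v => ?_
    simp only [ContinuousLinearMap.comp_apply, ContinuousLinearMap.flip_apply,
      ContinuousLinearMap.compL_apply]
    refine (ContinuousLinearMap.opNorm_comp_le _ _).trans ?_
    calc _ ≤ C * (1 + ‖affPath (A θ) (a θ) u (fun s => n s ω) t‖) ^ N *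
          (K * Real.exp (-c * t) * ‖v‖) * (K * Real.exp (-c * t)) := by
          refine mul_le_mul ((ContinuousLinearMap.le_opNorm _ _).trans ?_) (h.decay θ t ht)
            (norm_nonneg _) (by positivity)
          exact mul_le_mul (hψ.bdd_fderiv_fderiv _) (((flow (A θ) t).le_opNorm v).trans
            (mul_le_mul_of_nonneg_right (h.decay θ t ht) (norm_nonneg _))) (norm_nonneg _)
            (by positivity)
      _ = K ^ 2 * C * Real.exp (-c * t) *
          (1 + ‖affPath (A θ) (a θ) u (fun s => n s ω) t‖) ^ N * ‖v‖ * Real.exp (-c * t) := by ring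
      -- The second derivative carries two decaying factors; one is dropped so that both derivatives
      -- share a bound.
      _ ≤ _ := mul_le_of_le_one_right (by positivity) hexp1
  have b3 : ∀ (X : V → Ω → ℝ), (∀ ω u, X u ω ≤ K ^ 2 * C * Real.exp (-c * t) *
      (1 + ‖affPath (A θ) (a θ) u (fun s => n s ω) t‖) ^ N) → ∀ᵐ ω ∂P, ∀ u,
      X u ω ≤ K ^ 2 * C * Real.exp (-c * t) * b ω * (1 + ‖u‖) ^ N := by
    refine fun X hX => Eventually.of_forall fun ω u => (hX ω u).trans ?_
    rw [mul_assoc _ (b ω)]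
    exact mul_le_mul_of_nonneg_left (hle u ω) (by positivity)
  obtain ⟨r1, r2, r3⟩ := contDiff_two_integral_of_weight (μ := P) (F := F)
    (w := fun u => (1 + ‖u‖) ^ N) (b := fun ω => K ^ 2 * C * Real.exp (-c * t) * b ω) (by fun_prop)
    (hbi.const_mul _) (fun u => h.noise.aestronglyMeasurable_comp_affPath _ _ _ _
      hψ.contDiff.continuous)
    (fun u => h.integrable_comp θ ht hψ.contDiff.continuous hψ.bdd u)
    (Eventually.of_forall fun ω => hψ.contDiff.comp (by
      unfold affPath
      fun_prop)) (b3 _ b1) (b3 _ b2)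
  have hT : transOp P (A θ) (a θ) n t ψ = fun u => ∫ ω, F u ω ∂P := rfl
  rw [hT, r3, r2]
  refine ⟨r1, fun u => ?_, fun u => ?_⟩
  · refine (h.norm_integral_le θ ht (by positivity) u (fun ω => b1 ω u)).trans_eq (by ring)
  · refine (h.norm_integral_le θ ht (by positivity) u (fun ω => b2 ω u)).trans_eq (by ring)

/-- Synchronous coupling: the transition operators contract. -/
theorem norm_transOp_sub_le (h : LinFam P A a e n K c) (θ : Θ) {t : ℝ} (ht : 0 ≤ t) {C : ℝ} {N : ℕ}
    {ψ : V → E} (hψ : PolyC2 C N ψ) (u v : V) :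
    ‖transOp P (A θ) (a θ) n t ψ v - transOp P (A θ) (a θ) n t ψ u‖ ≤
      K ^ 2 * C * h.mom N * Real.exp (-c * t) * ((1 + ‖u‖) ^ (N + 1) * (1 + ‖v‖) ^ (N + 1)) := by
  obtain ⟨r1, r2, -⟩ := h.transOp_polyC2 θ ht hψ
  have hC := hψ.bdd.nonneg
  have hM := h.mom_nonneg N
  have hseg : ∀ x ∈ segment ℝ u v, ‖x‖ ≤ ‖u‖ + ‖v‖ := by
    intro x hx
    have := (convex_closedBall (0 : V) (‖u‖ + ‖v‖)).segment_subset (x := u) (y := v)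
      (by simp) (by simp) hx
    simpa using this
  -- On the segment `1 + ‖x‖ ≤ (1 + ‖u‖) (1 + ‖v‖)`. The product form allows one end point to be
  -- integrated out later.
  have := (convex_segment (𝕜 := ℝ) u v).norm_image_sub_le_of_norm_fderiv_le
    (f := transOp P (A θ) (a θ) n t ψ)
    (C := K ^ 2 * C * h.mom N * Real.exp (-c * t) * ((1 + ‖u‖) ^ N * (1 + ‖v‖) ^ N))
    (fun x _ => (r1.differentiable (by norm_num)) x) (fun x hx => (r2 x).trans ?_)
    (left_mem_segment ℝ u v) (right_mem_segment ℝ u v)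
  · refine this.trans ?_
    have h1 : ‖v - u‖ ≤ (1 + ‖u‖) * (1 + ‖v‖) := by
      nlinarith [norm_sub_le v u, norm_nonneg u, norm_nonneg v,
        mul_nonneg (norm_nonneg u) (norm_nonneg v)]
    rw [mul_assoc (K ^ 2 * C * h.mom N * Real.exp (-c * t))]
    refine mul_le_mul_of_nonneg_left ?_ (by positivity)
    calc _ ≤ (1 + ‖u‖) ^ N * (1 + ‖v‖) ^ N * ((1 + ‖u‖) * (1 + ‖v‖)) := by gcongr
      _ = _ := by ring
  · refine mul_le_mul_of_nonneg_left ?_ (by positivity)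
    rw [← mul_pow]
    have := hseg x hx
    gcongr
    nlinarith [mul_nonneg (norm_nonneg u) (norm_nonneg v)]

/-- Characteristic functions multiply, and the variances add as `∫₀ᵗ + ∫ₜ^{s+t}`, the flow by `t`
shifting the second integral. An independent copy on the product space takes the place of a
filtration. -/
theorem map_noise_add (h : LinFam P A a e n K c) (θ : Θ) {s t : ℝ} (hs : 0 ≤ s) (ht : 0 ≤ t) :
    (P.prod P).map (fun p : Ω × Ω => flow (A θ) t (affPath (A θ) 0 0 (fun r => n r p.1) s) +
      affPath (A θ) 0 0 (fun r => n r p.2) t) =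
    P.map (fun ω => affPath (A θ) 0 0 (fun r => n r ω) (s + t)) := by
  have := FiniteDimensional.proper ℝ V
  set B := A θ
  have hm : ∀ t, Measurable fun ω => affPath B 0 0 (fun r => n r ω) t := fun t =>
    (h.noise.measurable_affPath B 0 0).comp (measurable_const.prodMk measurable_id)
  have hm2 : Measurable fun p : Ω × Ω => flow B t (affPath B 0 0 (fun r => n r p.1) s) +
      affPath B 0 0 (fun r => n r p.2) t :=
    ((flow B t).continuous.measurable.comp ((hm s).comp measurable_fst)).add
      ((hm t).comp measurable_snd)
  have : IsProbabilityMeasure ((P.prod P).map (fun p : Ω × Ω => flow B t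
      (affPath B 0 0 (fun r => n r p.1) s) + affPath B 0 0 (fun r => n r p.2) t)) :=
    Measure.isProbabilityMeasure_map hm2.aemeasurable
  have : IsProbabilityMeasure (P.map (fun ω => affPath B 0 0 (fun r => n r ω) (s + t))) :=
    Measure.isProbabilityMeasure_map (hm _).aemeasurable
  refine Measure.ext_of_charFunDual (funext fun L => ?_)
  have hcont : Continuous fun v : V => Complex.exp ((L v : ℝ) * Complex.I) := by fun_prop
  rw [charFunDual_apply, charFunDual_apply,
    integral_map hm2.aemeasurable hcont.aestronglyMeasurable,
    integral_map (hm _).aemeasurable hcont.aestronglyMeasurable,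
    h.noise.integral_exp_affPath B (by positivity) L]
  have hsplit : ∀ p : Ω × Ω, Complex.exp ((L (flow B t (affPath B 0 0 (fun r => n r p.1) s) +
      affPath B 0 0 (fun r => n r p.2) t) : ℝ) * Complex.I) =
      Complex.exp (((L.comp (flow B t)) (affPath B 0 0 (fun r => n r p.1) s) : ℝ) * Complex.I) *
      Complex.exp ((L (affPath B 0 0 (fun r => n r p.2) t) : ℝ) * Complex.I) := by
    intro p
    rw [← Complex.exp_add, map_add, Complex.ofReal_add, add_mul]
    rfl
  simp only [hsplit]
  rw [integral_prod_mul (fun ω => Complex.exp (((L.comp (flow B t))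
    (affPath B 0 0 (fun r => n r ω) s) : ℝ) * Complex.I))
    (fun ω => Complex.exp ((L (affPath B 0 0 (fun r => n r ω) t) : ℝ) * Complex.I)),
    h.noise.integral_exp_affPath B hs, h.noise.integral_exp_affPath B ht, ← Complex.exp_add]
  congr 1
  have hc : Continuous fun r => ∑ i, (L (flow B r (e i))) ^ 2 :=
    continuous_finsetSum _ fun i _ => (L.continuous.comp
      ((continuous_flow B).clm_apply continuous_const)).pow 2
  have h1 : ∫ r in (0 : ℝ)..s, ∑ i, ((L.comp (flow B t)) (flow B r (e i))) ^ 2 =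
      ∫ r in t..s + t, ∑ i, (L (flow B r (e i))) ^ 2 := by
    have := intervalIntegral.integral_comp_add_left (a := 0) (b := s)
      (fun r => ∑ i, (L (flow B r (e i))) ^ 2) t
    rw [add_zero, add_comm t s] at this
    rw [← this]
    simp only [ContinuousLinearMap.comp_apply, flow_add_apply]
  rw [h1, ← intervalIntegral.integral_add_adjacent_intervals (hc.intervalIntegrable 0 t)
    (hc.intervalIntegrable t (s + t))]
  push_cast
  ring

/-- The Markov property. -/
theorem transOp_transOp (h : LinFam P A a e n K c) (θ : Θ) {s t : ℝ} (hs : 0 ≤ s) (ht : 0 ≤ t)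
    {C : ℝ} {N : ℕ} {ψ : V → E} (hψ : Continuous ψ) (hb : PolyBdd C N ψ) (u : V) :
    transOp P (A θ) (a θ) n s (transOp P (A θ) (a θ) n t ψ) u =
      transOp P (A θ) (a θ) n (s + t) ψ u := by
  have := FiniteDimensional.proper ℝ V
  set B := A θ
  set D : ℝ → V := fun t => ∫ r in (0 : ℝ)..t, flow B r (a θ) with hD
  have hm : ∀ t, Measurable fun ω => affPath B 0 0 (fun r => n r ω) t := fun t =>
    (h.noise.measurable_affPath B 0 0).comp (measurable_const.prodMk measurable_id)
  have hm2 : Measurable fun p : Ω × Ω => flow B t (affPath B 0 0 (fun r => n r p.1) s) +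
      affPath B 0 0 (fun r => n r p.2) t :=
    ((flow B t).continuous.measurable.comp ((hm s).comp measurable_fst)).add
      ((hm t).comp measurable_snd)
  -- The deterministic drift obeys the same composition rule as the noise part.
  have hDadd : flow B t (D s) + D t = D (s + t) := by
    have hc : Continuous fun r => flow B r (a θ) :=
      (continuous_flow B).clm_apply continuous_const
    have h1 : flow B t (D s) = ∫ r in t..s + t, flow B r (a θ) := by
      rw [hD, ← ContinuousLinearMap.intervalIntegral_comp_comm _ (hc.intervalIntegrable _ _)]
      have := intervalIntegral.integral_comp_add_left (a := 0) (b := s)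
        (fun r => flow B r (a θ)) t
      rw [add_zero, add_comm t s] at this
      rw [← this]
      simp only [flow_add_apply]
    rw [h1, add_comm, hD, intervalIntegral.integral_add_adjacent_intervals
      (hc.intervalIntegrable 0 t) (hc.intervalIntegrable t (s + t))]
  set φ : V → E := fun x => ψ (flow B (s + t) u + D (s + t) + x) with hφ
  have hφc : Continuous φ := by fun_prop
  have hsum : ∀ ω ω', affPath B (a θ) (affPath B (a θ) u (fun r => n r ω) s) (fun r => n r ω') t =
      flow B (s + t) u + D (s + t) + (flow B t (affPath B 0 0 (fun r => n r ω) s) +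
        affPath B 0 0 (fun r => n r ω') t) := by
    intro ω ω'
    rw [affPath_eq_add B _ _ (h.noise.continuous ω'), affPath_eq_add B _ _ (h.noise.continuous ω),
      ← hDadd, add_comm s t, flow_add_apply]
    simp only [map_add, hD]
    abel
  -- Integrability on the product space is transferred from time `s + t` through the equality of
  -- laws.
  have hI : Integrable (fun p : Ω × Ω => φ (flow B t (affPath B 0 0 (fun r => n r p.1) s) +
      affPath B 0 0 (fun r => n r p.2) t)) (P.prod P) := by
    have h1 : Integrable φ (P.map (fun ω => affPath B 0 0 (fun r => n r ω) (s + t))) := by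
      rw [integrable_map_measure hφc.aestronglyMeasurable (hm _).aemeasurable]
      refine (h.integrable_comp θ (add_nonneg hs ht) hψ hb u).congr
        (Eventually.of_forall fun ω => ?_)
      simp only [Function.comp_apply, hφ]
      rw [affPath_eq_add _ _ _ (h.noise.continuous ω)]
    rw [← h.map_noise_add θ hs ht] at h1
    exact (integrable_map_measure hφc.aestronglyMeasurable hm2.aemeasurable).1 h1
  calc transOp P B (a θ) n s (transOp P B (a θ) n t ψ) u
      = ∫ ω, ∫ ω', φ (flow B t (affPath B 0 0 (fun r => n r ω) s) +
          affPath B 0 0 (fun r => n r ω') t) ∂P ∂P := by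
        simp only [transOp, hsum, hφ]
    _ = ∫ p, φ (flow B t (affPath B 0 0 (fun r => n r p.1) s) +
          affPath B 0 0 (fun r => n r p.2) t) ∂(P.prod P) := (integral_prod _ hI).symm
    _ = ∫ ω, φ (affPath B 0 0 (fun r => n r ω) (s + t)) ∂P := by
        rw [← integral_map hm2.aemeasurable hφc.aestronglyMeasurable, h.map_noise_add θ hs ht,
          integral_map (hm _).aemeasurable hφc.aestronglyMeasurable]
    _ = _ := by
        simp only [transOp, hφ]
        refine integral_congr_ae (Eventually.of_forall fun ω => ?_)
        dsimp only
        rw [affPath_eq_add B _ u (h.noise.continuous ω)]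

/-- The transition operators converge exponentially fast. -/
theorem norm_transOp_add_sub_le (h : LinFam P A a e n K c) (θ : Θ) {s t : ℝ} (hs : 0 ≤ s)
    (ht : 0 ≤ t) {C : ℝ} {N : ℕ} {ψ : V → E} (hψ : PolyC2 C N ψ) (u : V) :
    ‖transOp P (A θ) (a θ) n (s + t) ψ u - transOp P (A θ) (a θ) n t ψ u‖ ≤
      K ^ 2 * C * h.mom N * h.mom (N + 1) * Real.exp (-c * t) * (1 + ‖u‖) ^ (2 * (N + 1)) := by
  have hC := hψ.bdd.nonneg
  have hM := h.mom_nonneg N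
  have hTc : Continuous (transOp P (A θ) (a θ) n t ψ) := (h.transOp_polyC2 θ ht hψ).1.continuous
  have hTb : PolyBdd (C * h.mom N) N (transOp P (A θ) (a θ) n t ψ) :=
    fun v => h.norm_transOp_le θ ht hψ.bdd v
  have h1 : transOp P (A θ) (a θ) n (s + t) ψ u - transOp P (A θ) (a θ) n t ψ u =
      ∫ ω, (transOp P (A θ) (a θ) n t ψ (affPath (A θ) (a θ) u (fun r => n r ω) s) -
        transOp P (A θ) (a θ) n t ψ u) ∂P := by
    rw [integral_sub (h.integrable_comp θ hs hTc hTb u) (integrable_const _),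
      ← h.transOp_transOp θ hs ht hψ.contDiff.continuous hψ.bdd]
    simp [transOp]
  rw [h1]
  refine (h.norm_integral_le θ hs (C := K ^ 2 * C * h.mom N * Real.exp (-c * t) *
    (1 + ‖u‖) ^ (N + 1)) (N := N + 1) (by positivity) u fun ω => ?_).trans_eq (by ring)
  refine (h.norm_transOp_sub_le θ ht hψ u _).trans_eq (by ring)

end LinFam

end Semigroup

/-! ### Second order Taylor remainder. -/

section Taylor

variable {V E : Type*} [NormedAddCommGroup V] [NormedSpace ℝ V]
  [NormedAddCommGroup E] [NormedSpace ℝ E]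

/-- The remainder of the Taylor expansion of order two. -/
noncomputable def taylorRem (φ : V → E) (u δ : V) : E :=
  φ (u + δ) - φ u - fderiv ℝ φ u δ - (1 / 2 : ℝ) • fderiv ℝ (fderiv ℝ φ) u δ δ

/-- The mean value inequality is applied twice on the ball, to `fderiv ℝ φ` minus its linearisation
and then to `φ` minus its quadratic part. Symmetry of the second derivative identifies the gradient
of the quadratic part. -/
theorem norm_taylorRem_le {φ : V → E} (hφ : ContDiff ℝ 2 φ) (u δ : V) {η : ℝ}
    (hη : ∀ x ∈ Metric.closedBall u ‖δ‖,
      ‖fderiv ℝ (fderiv ℝ φ) x - fderiv ℝ (fderiv ℝ φ) u‖ ≤ η) :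
    ‖taylorRem φ u δ‖ ≤ η * ‖δ‖ ^ 2 := by
  set B := fderiv ℝ (fderiv ℝ φ) u with hB
  have hsymm : ∀ v w, B v w = B w v := fun v w =>
    (hφ.contDiffAt (x := u)).isSymmSndFDerivAt (by simp) v w
  have hη0 : 0 ≤ η := (norm_nonneg (fderiv ℝ (fderiv ℝ φ) u - B)).trans (hη u (by simp))
  have hd1 : Differentiable ℝ (fderiv ℝ φ) :=
    (hφ.fderiv_right (m := 1) (by norm_num)).differentiable (by norm_num)
  have hu : u ∈ Metric.closedBall u ‖δ‖ := by simp
  have huδ : u + δ ∈ Metric.closedBall u ‖δ‖ := by simp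
  have s1 : ∀ x ∈ Metric.closedBall u ‖δ‖, ‖fderiv ℝ φ x - fderiv ℝ φ u - B (x - u)‖ ≤
      η * ‖δ‖ := by
    intro x hx
    have := (convex_closedBall u ‖δ‖).norm_image_sub_le_of_norm_hasFDerivWithin_le
      (f := fun x => fderiv ℝ φ x - B x) (f' := fun x => fderiv ℝ (fderiv ℝ φ) x - B)
      (fun y _ => ((hd1 y).hasFDerivAt.sub B.hasFDerivAt).hasFDerivWithinAt) hη hu hx
    have h2 : fderiv ℝ φ x - fderiv ℝ φ u - B (x - u) =
        fderiv ℝ φ x - B x - (fderiv ℝ φ u - B u) := by rw [map_sub]; abel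
    rw [h2]
    refine this.trans (mul_le_mul_of_nonneg_left ?_ hη0)
    simpa [dist_eq_norm] using hx
  have hg : ∀ x, HasFDerivAt (fun x => φ x - fderiv ℝ φ u x - (1 / 2 : ℝ) • B (x - u) (x - u))
      (fderiv ℝ φ x - fderiv ℝ φ u - B (x - u)) x := by
    intro x
    have h1 : HasFDerivAt (fun x : V => x - u) (ContinuousLinearMap.id ℝ V) x :=
      (hasFDerivAt_id x).sub_const u
    have h2 := (((B.hasFDerivAt.comp x h1).clm_apply h1).const_smul (1 / 2 : ℝ))
    have h3 := ((hφ.differentiable (by norm_num) x).hasFDerivAt.sub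
      (fderiv ℝ φ u).hasFDerivAt).sub h2
    refine HasFDerivAt.congr_fderiv h3 ?_
    congr 1
    ext v
    simp only [Function.comp_apply, smul_apply, add_apply, ContinuousLinearMap.comp_apply,
      ContinuousLinearMap.flip_apply, ContinuousLinearMap.id_apply]
    rw [hsymm v (x - u), ← two_smul ℝ, smul_smul]
    norm_num
  have := (convex_closedBall u ‖δ‖).norm_image_sub_le_of_norm_hasFDerivWithin_le
    (fun y _ => (hg y).hasFDerivWithinAt) s1 hu huδ
  have he : taylorRem φ u δ = (φ (u + δ) - fderiv ℝ φ u (u + δ) -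
      (1 / 2 : ℝ) • B (u + δ - u) (u + δ - u)) -
      (φ u - fderiv ℝ φ u u - (1 / 2 : ℝ) • B (u - u) (u - u)) := by
    simp only [taylorRem, add_sub_cancel_left, sub_self, map_zero, map_add, smul_zero]
    simp only [← hB]
    abel
  rw [he]
  refine this.trans_eq ?_
  rw [add_sub_cancel_left]
  ring

end Taylor

/-! ### The generator by short-time expansion. -/

section Generator

variable {Ω : Type*} [MeasurableSpace Ω] {P : Measure Ω} [IsProbabilityMeasure P]
  {ι : Type*} [Fintype ι] {Θ : Type*}
  {V : Type*} [NormedAddCommGroup V] [NormedSpace ℝ V] [FiniteDimensional ℝ V] [CompleteSpace V]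
  [MeasurableSpace V] [BorelSpace V]
  {E : Type*} [NormedAddCommGroup E] [NormedSpace ℝ E] [CompleteSpace E]

/-- Near `u`, continuity of the second derivative gives `ε ‖δ‖ ^ 2`. Away from `u`, `‖δ‖ / r ≥ 1`
trades the growth bound for a third power, whose expectation is of order `s ^ (3/2)`. -/
theorem PolyC2.exists_taylorRem_le {C : ℝ} {N : ℕ} {φ : V → E} (hφ : PolyC2 C N φ) (u : V) {ε : ℝ}
    (hε : 0 < ε) : ∃ D : ℝ, 0 ≤ D ∧ ∀ δ, ‖taylorRem φ u δ‖ ≤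
      ε * ‖δ‖ ^ 2 + D * (‖δ‖ ^ 3 + ‖δ‖ ^ (3 + N)) := by
  have hC := hφ.bdd.nonneg
  have hcont : Continuous (fderiv ℝ (fderiv ℝ φ)) :=
    (hφ.contDiff.fderiv_right (m := 1) (by norm_num)).continuous_fderiv (by norm_num)
  obtain ⟨r, hr, hball⟩ := Metric.continuous_iff (β := V →L[ℝ] V →L[ℝ] E) |>.1 hcont u ε hε
  refine ⟨2 * C * (1 + ‖u‖) ^ N * 2 ^ (N - 1) / r, by positivity, fun δ => ?_⟩
  by_cases hδ : ‖δ‖ < r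
  · refine (norm_taylorRem_le hφ.contDiff u δ (η := ε) fun x hx => ?_).trans
      (le_add_of_nonneg_right (by positivity))
    have := hball x (lt_of_le_of_lt hx hδ)
    exact (dist_eq_norm (fderiv ℝ (fderiv ℝ φ) x) (fderiv ℝ (fderiv ℝ φ) u)).symm.le.trans this.le
  · push Not at hδ
    refine (norm_taylorRem_le hφ.contDiff u δ
      (η := 2 * C * (1 + ‖u‖) ^ N * (1 + ‖δ‖) ^ N) fun x hx => ?_).trans ?_
    · have hx' : ‖x‖ ≤ ‖u‖ + ‖δ‖ := by
        have := norm_add_le u (x - u)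
        rw [add_sub_cancel] at this
        have h2 : ‖x - u‖ ≤ ‖δ‖ := by simpa [dist_eq_norm] using hx
        linarith
      have h1 : (1 + ‖x‖) ^ N ≤ (1 + ‖u‖) ^ N * (1 + ‖δ‖) ^ N := by
        rw [← mul_pow]
        gcongr
        nlinarith [mul_nonneg (norm_nonneg u) (norm_nonneg δ)]
      have h2 : (1 + ‖u‖) ^ N ≤ (1 + ‖u‖) ^ N * (1 + ‖δ‖) ^ N :=
        le_mul_of_one_le_right (by positivity) (one_le_pow₀ (by linarith [norm_nonneg δ]))
      calc ‖fderiv ℝ (fderiv ℝ φ) x - fderiv ℝ (fderiv ℝ φ) u‖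
          ≤ C * (1 + ‖x‖) ^ N + C * (1 + ‖u‖) ^ N :=
            (norm_sub_le (fderiv ℝ (fderiv ℝ φ) x) (fderiv ℝ (fderiv ℝ φ) u)).trans (add_le_add (hφ.bdd_fderiv_fderiv x) (hφ.bdd_fderiv_fderiv u))
        _ ≤ C * ((1 + ‖u‖) ^ N * (1 + ‖δ‖) ^ N) + C * ((1 + ‖u‖) ^ N * (1 + ‖δ‖) ^ N) := by gcongr
        _ = _ := by ring
    · refine le_trans ?_ (le_add_of_nonneg_left (by positivity))
      have h1 : (1 + ‖δ‖) ^ N ≤ 2 ^ (N - 1) * (1 + ‖δ‖ ^ N) := by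
        simpa using add_pow_le zero_le_one (norm_nonneg δ) N
      have h2 : ‖δ‖ ^ 2 ≤ ‖δ‖ ^ 3 / r := by
        rw [le_div_iff₀ hr, pow_succ ‖δ‖ 2]
        gcongr
      calc _ ≤ 2 * C * (1 + ‖u‖) ^ N * (2 ^ (N - 1) * (1 + ‖δ‖ ^ N)) * (‖δ‖ ^ 3 / r) := by gcongr
        _ = _ := by ring

/-- Expansion in a basis reduces the bilinear form to scalar covariances, known by polarisation. -/
theorem IsCenteredGaussian.integral_bilin {N : Ω → V} {t : ℝ} {x : ι → ℝ → V}
    (h : IsCenteredGaussian P N (fun L => ∫ r in (0 : ℝ)..t, ∑ i, (L (x i r)) ^ 2))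
    (hx : ∀ i, Continuous (x i)) (B : V →L[ℝ] V →L[ℝ] E) :
    Integrable (fun ω => B (N ω) (N ω)) P ∧
    ∫ ω, B (N ω) (N ω) ∂P = ∫ r in (0 : ℝ)..t, ∑ i, B (x i r) (x i r) := by
  let b := Module.finBasis ℝ V
  let ℓ : Fin (Module.finrank ℝ V) → StrongDual ℝ V :=
    fun i => LinearMap.toContinuousLinearMap (b.coord i)
  have hrep : ∀ v w, B v w = ∑ j, ∑ k, (ℓ j v * ℓ k w) • B (b j) (b k) := by
    intro v w
    conv_lhs => rw [← b.sum_repr v, ← b.sum_repr w]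
    simp only [map_sum, map_smul, sum_apply, smul_apply]
    rw [Finset.sum_comm]
    refine Finset.sum_congr rfl fun j _ => ?_
    rw [Finset.smul_sum]
    refine Finset.sum_congr rfl fun k _ => ?_
    rw [smul_smul, mul_comm]
    rfl
  have hcov : ∀ j k, ∫ ω, ℓ j (N ω) * ℓ k (N ω) ∂P =
      ∫ r in (0 : ℝ)..t, ∑ i, ℓ j (x i r) * ℓ k (x i r) := by
    intro j k
    rw [(h.integral_dual_mul (ℓ j) (ℓ k)).2]
    have hc : ∀ L : StrongDual ℝ V, IntervalIntegrable (fun r => ∑ i, (L (x i r)) ^ 2) volume 0 t :=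
      fun L => (continuous_finsetSum _ fun i _ => (L.continuous.comp
        (hx i)).pow 2).intervalIntegrable _ _
    rw [← intervalIntegral.integral_sub (hc _) (hc _),
      ← intervalIntegral.integral_sub ((hc _).sub (hc _)) (hc _), ← intervalIntegral.integral_div]
    congr 1
    funext r
    rw [← Finset.sum_sub_distrib, ← Finset.sum_sub_distrib, Finset.sum_div]
    refine Finset.sum_congr rfl fun i _ => ?_
    simp only [add_apply]
    ring
  have hI : ∀ j k, Integrable (fun ω => (ℓ j (N ω) * ℓ k (N ω)) • B (b j) (b k)) P :=
    fun j k => (h.integral_dual_mul (ℓ j) (ℓ k)).1.smul_const _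
  have hc2 : ∀ j k, Continuous fun r => ∑ i, ℓ j (x i r) * ℓ k (x i r) := fun j k =>
    continuous_finsetSum _ fun i _ => ((ℓ j).continuous.comp (hx i)).mul
      ((ℓ k).continuous.comp (hx i))
  have hr : ∀ r, ∑ i, B (x i r) (x i r) =
      ∑ j, ∑ k, (∑ i, ℓ j (x i r) * ℓ k (x i r)) • B (b j) (b k) := by
    intro r
    rw [Finset.sum_congr rfl fun i _ => hrep (x i r) (x i r), Finset.sum_comm]
    refine Finset.sum_congr rfl fun j _ => ?_
    rw [Finset.sum_comm]
    refine Finset.sum_congr rfl fun k _ => ?_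
    rw [Finset.sum_smul]
  constructor
  · simp only [fun ω => hrep (N ω) (N ω)]
    exact integrable_finsetSum _ fun j _ => integrable_finsetSum _ fun k _ => hI j k
  · simp only [fun ω => hrep (N ω) (N ω), hr]
    have hk : ∀ j k, Continuous fun r => (∑ i, ℓ j (x i r) * ℓ k (x i r)) • B (b j) (b k) :=
      fun j k => (hc2 j k).smul continuous_const
    have hj : ∀ j, Continuous fun r =>
        ∑ k, (∑ i, ℓ j (x i r) * ℓ k (x i r)) • B (b j) (b k) :=
      fun j => continuous_finsetSum _ fun k _ => hk j k
    rw [integral_finsetSum _ fun j _ => integrable_finsetSum _ fun k _ => hI j k,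
      intervalIntegral.integral_finsetSum fun j _ => (hj j).intervalIntegrable _ _]
    refine Finset.sum_congr rfl fun j _ => ?_
    rw [integral_finsetSum _ fun k _ => hI j k,
      intervalIntegral.integral_finsetSum fun k _ => (hk j k).intervalIntegrable _ _]
    refine Finset.sum_congr rfl fun k _ => ?_
    rw [integral_smul_const, hcov, intervalIntegral.integral_smul_const]

namespace LinFam

variable {A : Θ → V →L[ℝ] V} {a : Θ → V} {e : ι → V} {n : ℝ → Ω → V} {K c : ℝ}

/-- For `s < 1` the deterministic displacement, of order `s`, is dominated by the Gaussian scale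
`√s`. -/
theorem exists_increment_moment (h : LinFam P A a e n K c) (θ : Θ) {m : ℝ → V} {C : ℝ}
    (hm : ∀ᶠ s in 𝓝[>] (0 : ℝ), ‖m s‖ ≤ C * s) (k : ℕ) : ∃ D : ℝ, 0 ≤ D ∧
    ∀ᶠ s in 𝓝[>] (0 : ℝ),
      Integrable (fun ω => ‖m s + affPath (A θ) 0 0 (fun r => n r ω) s‖ ^ k) P ∧
      ∫ ω, ‖m s + affPath (A θ) 0 0 (fun r => n r ω) s‖ ^ k ∂P ≤ D * √s ^ k := by
  have := FiniteDimensional.proper ℝ V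
  obtain ⟨M, hM, hb⟩ := h.exists_noise_moment k
  refine ⟨2 ^ (k - 1) * (|C| ^ k + M), by positivity, ?_⟩
  filter_upwards [hm, Ioo_mem_nhdsGT (zero_lt_one' ℝ)] with s hs hs1
  obtain ⟨h1, -, h3⟩ := hb θ s hs1.1.le
  have hms : ‖m s‖ ≤ |C| * √s := by
    refine hs.trans (mul_le_mul (le_abs_self C) ?_ hs1.1.le (abs_nonneg C))
    rw [Real.le_sqrt hs1.1.le hs1.1.le]
    nlinarith [hs1.1, hs1.2]
  have hle : ∀ ω, ‖m s + affPath (A θ) 0 0 (fun r => n r ω) s‖ ^ k ≤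
      2 ^ (k - 1) * ((|C| * √s) ^ k + ‖affPath (A θ) 0 0 (fun r => n r ω) s‖ ^ k) := by
    intro ω
    refine (pow_le_pow_left₀ (norm_nonneg _) ((norm_add_le _ _).trans
      (add_le_add_left hms _)) k).trans (add_pow_le (by positivity) (norm_nonneg _) k)
  have hi : Integrable (fun ω => 2 ^ (k - 1) * ((|C| * √s) ^ k +
      ‖affPath (A θ) 0 0 (fun r => n r ω) s‖ ^ k)) P := ((integrable_const _).add h1).const_mul _
  have hI : Integrable (fun ω => ‖m s + affPath (A θ) 0 0 (fun r => n r ω) s‖ ^ k) P := by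
    refine hi.mono' ?_ (Eventually.of_forall fun ω => ?_)
    · exact h.noise.aestronglyMeasurable_comp_affPath (A θ) 0 0 s
        (ψ := fun v => ‖m s + v‖ ^ k) (by fun_prop)
    · rw [Real.norm_of_nonneg (by positivity)]; exact hle ω
  refine ⟨hI, (integral_mono hI hi hle).trans ?_⟩
  rw [integral_const_mul, integral_add (integrable_const _) h1]
  simp only [integral_const, probReal_univ, one_smul]
  calc _ ≤ 2 ^ (k - 1) * ((|C| * √s) ^ k + M * √s ^ k) := by gcongr
    _ = _ := by rw [mul_pow]; ring

/-- The generator of the solutions, on `C²` functions with polynomial growth. -/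
theorem tendsto_generator (h : LinFam P A a e n K c) (θ : Θ) {C : ℝ} {N : ℕ} {φ : V → E}
    (hφ : PolyC2 C N φ) (u : V) :
    Tendsto (fun s : ℝ => s⁻¹ • (transOp P (A θ) (a θ) n s φ u - φ u)) (𝓝[>] 0)
      (𝓝 (fderiv ℝ φ u (a θ - A θ u) +
        (1 / 2 : ℝ) • ∑ i, fderiv ℝ (fderiv ℝ φ) u (e i) (e i))) := by
  have := FiniteDimensional.proper ℝ V
  set B := fderiv ℝ (fderiv ℝ φ) u with hB
  set Z : ℝ → Ω → V := fun s ω => affPath (A θ) 0 0 (fun r => n r ω) s with hZ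
  set m : ℝ → V := fun s => flow (A θ) s u + (∫ r in (0 : ℝ)..s, flow (A θ) r (a θ)) - u with hmdef
  have hU : ∀ s ω, affPath (A θ) (a θ) u (fun r => n r ω) s = u + (m s + Z s ω) := by
    intro s ω
    rw [affPath_eq_add _ _ _ (h.noise.continuous ω)]
    simp only [hmdef, hZ]
    abel
  have hmd : HasDerivAt m (a θ - A θ u) 0 := by
    have h1 := (hasDerivAt_duhamel (A θ) u (p := fun _ => a θ) continuous_const 0).sub_const u
    have h2 : m = fun t => flow (A θ) t u + (∫ s in (0 : ℝ)..t, flow (A θ) (t - s) (a θ)) - u := by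
      funext t
      simp only [hmdef]
      rw [intervalIntegral.integral_comp_sub_left (fun s => flow (A θ) s (a θ)) t, sub_self,
        sub_zero]
    rw [h2]
    simpa using! h1
  have hm0 : m 0 = 0 := by simp [hmdef]
  have hmlim : Tendsto (fun s : ℝ => s⁻¹ • m s) (𝓝[>] 0) (𝓝 (a θ - A θ u)) := by
    simpa [hm0] using HasDerivAt.tendsto_slope_zero_right hmd
  have hms : ∀ᶠ s in 𝓝[>] (0 : ℝ), ‖m s‖ ≤ (‖a θ - A θ u‖ + 1) * s := by
    filter_upwards [hmlim.norm.eventually (gt_mem_nhds (lt_add_one _)), self_mem_nhdsWithin]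
      with s hs (hs0 : 0 < s)
    rw [norm_smul, norm_inv, Real.norm_of_nonneg hs0.le, inv_mul_lt_iff₀ hs0] at hs
    linarith
  have hG := fun s (hs : 0 < s) => h.noise.isCenteredGaussian_affPath (A θ) hs.le
  have hBil := fun s (hs : 0 < s) => (hG s hs).integral_bilin (x := fun i r => flow (A θ) r (e i))
    (fun i => (continuous_flow (A θ)).clm_apply continuous_const) B
  -- the quadratic term
  have hquad : Tendsto (fun s : ℝ => s⁻¹ • ∫ ω, B (Z s ω) (Z s ω) ∂P) (𝓝[>] 0)
      (𝓝 (∑ i, B (e i) (e i))) := by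
    have hc : Continuous fun r => ∑ i, B (flow (A θ) r (e i)) (flow (A θ) r (e i)) := by
      refine continuous_finsetSum _ fun i _ => ?_
      have : Continuous fun r => flow (A θ) r (e i) :=
        (continuous_flow (A θ)).clm_apply continuous_const
      fun_prop
    have hd := (hc.integral_hasStrictDerivAt 0 0).hasDerivAt
    simp only [flow_zero, one_apply_eq_self] at hd
    have h1 := hd.tendsto_slope_zero_right
    simp only [zero_add, intervalIntegral.integral_same, sub_zero] at h1
    refine h1.congr' ?_
    filter_upwards [self_mem_nhdsWithin] with s hs
    rw [(hBil s hs).2]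
  -- the remainder
  have hrem : Tendsto (fun s : ℝ => s⁻¹ • ∫ ω, taylorRem φ u (m s + Z s ω) ∂P) (𝓝[>] 0)
      (𝓝 0) := by
    obtain ⟨D2, hD2, h2⟩ := h.exists_increment_moment θ hms 2
    obtain ⟨D3, hD3, h3⟩ := h.exists_increment_moment θ hms 3
    obtain ⟨D4, hD4, h4⟩ := h.exists_increment_moment θ hms (3 + N)
    rw [Metric.tendsto_nhds]
    intro ε hε
    -- The second moment of the increment is at most `D2 * s`, so this choice makes the quadratic
    -- error at most `s * (ε / 2)`.
    obtain ⟨D, hD, hT⟩ := hφ.exists_taylorRem_le u (ε := ε / (2 * (D2 + 1))) (by positivity)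
    have hsq : ∀ᶠ s in 𝓝[>] (0 : ℝ), D * (D3 + D4) * √s < ε / 2 := by
      have : Tendsto (fun s : ℝ => D * (D3 + D4) * √s) (𝓝[>] 0) (𝓝 0) := by
        have : Tendsto (fun s : ℝ => D * (D3 + D4) * √s) (𝓝 0) (𝓝 (D * (D3 + D4) * √0)) :=
          Continuous.tendsto (by fun_prop) 0
        simpa using this.mono_left nhdsWithin_le_nhds
      exact this.eventually (gt_mem_nhds (by positivity))
    filter_upwards [h2, h3, h4, hsq, Ioo_mem_nhdsGT (zero_lt_one' ℝ)] with s h2 h3 h4 hsq hs1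
    rw [dist_zero_right, norm_smul, norm_inv, Real.norm_of_nonneg hs1.1.le, inv_mul_lt_iff₀ hs1.1]
    have hs0 := Real.sqrt_nonneg s
    have hs2 : √s ^ 2 = s := Real.sq_sqrt hs1.1.le
    have hs3 : √s ≤ 1 := Real.sqrt_le_one.2 hs1.2.le
    have k1 : Integrable (fun ω => ε / (2 * (D2 + 1)) * ‖m s + Z s ω‖ ^ 2) P := h2.1.const_mul _
    have k2 : Integrable (fun ω => D * (‖m s + Z s ω‖ ^ 3 + ‖m s + Z s ω‖ ^ (3 + N))) P :=
      (h3.1.add h4.1).const_mul D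
    have hb := norm_integral_le_of_norm_le (μ := P)
      (g := fun ω => ε / (2 * (D2 + 1)) * ‖m s + Z s ω‖ ^ 2 +
        D * (‖m s + Z s ω‖ ^ 3 + ‖m s + Z s ω‖ ^ (3 + N))) (k1.add k2)
      (Eventually.of_forall fun ω => hT (m s + Z s ω))
    refine hb.trans_lt ?_
    rw [integral_add k1 k2, integral_const_mul, integral_const_mul, integral_add h3.1 h4.1]
    have e1 : ε / (2 * (D2 + 1)) * ∫ ω, ‖m s + affPath (A θ) 0 0 (fun r => n r ω) s‖ ^ 2 ∂P ≤
        s * (ε / 2) := by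
      calc _ ≤ ε / (2 * (D2 + 1)) * (D2 * √s ^ 2) := by gcongr; exact h2.2
        _ = s * (ε / 2) * (D2 / (D2 + 1)) := by rw [hs2]; field_simp
        _ ≤ _ := mul_le_of_le_one_right (by have := hs1.1; positivity)
            (by rw [div_le_one (by positivity)]; linarith)
    have e4 : √s ^ (3 + N) ≤ √s ^ 3 := pow_le_pow_of_le_one hs0 hs3 (by omega)
    have e2 : D * ((∫ ω, ‖m s + affPath (A θ) 0 0 (fun r => n r ω) s‖ ^ 3 ∂P) +
        ∫ ω, ‖m s + affPath (A θ) 0 0 (fun r => n r ω) s‖ ^ (3 + N) ∂P) ≤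
        s * (D * (D3 + D4) * √s) := by
      calc _ ≤ D * (D3 * √s ^ 3 + D4 * √s ^ 3) := by
            gcongr
            · exact h3.2
            · exact h4.2.trans (by gcongr)
        _ = √s ^ 2 * (D * (D3 + D4) * √s) := by ring
        _ = _ := by rw [hs2]
    have e3 := mul_lt_mul_of_pos_left hsq hs1.1
    calc _ ≤ s * (ε / 2) + s * (D * (D3 + D4) * √s) := add_le_add e1 e2
      _ < s * (ε / 2) + s * (ε / 2) := by linarith
      _ = _ := by ring
  -- The displacement is of order `s`, so its square disappears after division by `s`.
  have hmm : Tendsto (fun s : ℝ => s⁻¹ • B (m s) (m s)) (𝓝[>] 0) (𝓝 0) := by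
    have h1 : Tendsto m (𝓝[>] 0) (𝓝 0) := by
      have := hmd.continuousAt.tendsto.mono_left (nhdsWithin_le_nhds (s := Ioi 0))
      rwa [hm0] at this
    have h2 : Tendsto (fun s : ℝ => B (s⁻¹ • m s) (m s)) (𝓝[>] 0) (𝓝 (B (a θ - A θ u) 0)) := by
      have hc : Continuous fun p : V × V => B p.1 p.2 := by fun_prop
      exact (hc.tendsto (a θ - A θ u, 0)).comp (hmlim.prodMk_nhds h1)
    simpa using h2
  have hmain := (((fderiv ℝ φ u).continuous.tendsto _).comp hmlim).add
    (((hmm.add hquad).const_smul (1 / 2 : ℝ)).add hrem)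
  simp only [zero_add, add_zero] at hmain
  refine hmain.congr' ?_
  filter_upwards [self_mem_nhdsWithin] with s (hs : 0 < s)
  have i0 : Integrable (fun ω => φ (u + (m s + Z s ω))) P := by
    simpa only [hU] using h.integrable_comp θ hs.le hφ.contDiff.continuous hφ.bdd u
  have i1 := (hG s hs).integral_clm (fderiv ℝ φ u)
  have i2 := (hG s hs).integral_clm (B (m s))
  have i3 := (hG s hs).integral_clm (B.flip (m s))
  have i4 := hBil s hs
  change Integrable (fun ω => fderiv ℝ φ u (Z s ω)) P ∧ ∫ ω, fderiv ℝ φ u (Z s ω) ∂P = 0 at i1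
  change Integrable (fun ω => B (m s) (Z s ω)) P ∧ ∫ ω, B (m s) (Z s ω) ∂P = 0 at i2
  change Integrable (fun ω => B (Z s ω) (m s)) P ∧ ∫ ω, B (Z s ω) (m s) ∂P = 0 at i3
  have i4' : Integrable (fun ω => B (Z s ω) (Z s ω)) P := i4.1
  -- The terms linear in the noise have mean zero. What survives is the displacement, the covariance
  -- of the noise and the remainder.
  have hexp : ∀ ω, φ (u + (m s + Z s ω)) - φ u = fderiv ℝ φ u (m s) + fderiv ℝ φ u (Z s ω) +
      (1 / 2 : ℝ) • (B (m s) (m s) + B (m s) (Z s ω) + B (Z s ω) (m s) + B (Z s ω) (Z s ω)) +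
      taylorRem φ u (m s + Z s ω) := by
    intro ω
    simp only [taylorRem, ← hB, map_add, add_apply]
    rw [show B (m s) (m s) + B (m s) (Z s ω) + B (Z s ω) (m s) + B (Z s ω) (Z s ω) =
      B (m s) (m s) + B (Z s ω) (m s) + (B (m s) (Z s ω) + B (Z s ω) (Z s ω)) by abel]
    abel
  have j1 : Integrable (fun ω => fderiv ℝ φ u (m s) + fderiv ℝ φ u (Z s ω)) P :=
    (integrable_const _).add i1.1
  have j2 : Integrable (fun ω => B (m s) (m s) + B (m s) (Z s ω)) P :=
    (integrable_const _).add i2.1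
  have j3 : Integrable (fun ω => B (m s) (m s) + B (m s) (Z s ω) + B (Z s ω) (m s)) P :=
    j2.add i3.1
  have j4 : Integrable (fun ω => B (m s) (m s) + B (m s) (Z s ω) + B (Z s ω) (m s) +
    B (Z s ω) (Z s ω)) P := j3.add i4'
  have j5 : Integrable (fun ω => fderiv ℝ φ u (m s) + fderiv ℝ φ u (Z s ω) +
      (1 / 2 : ℝ) • (B (m s) (m s) + B (m s) (Z s ω) + B (Z s ω) (m s) + B (Z s ω) (Z s ω))) P :=
    j1.add (j4.smul _)
  have j4' : Integrable (fun ω => (1 / 2 : ℝ) • (B (m s) (m s) + B (m s) (Z s ω) + B (Z s ω) (m s) +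
    B (Z s ω) (Z s ω))) P := j4.smul _
  have j6 : Integrable (fun ω => taylorRem φ u (m s + Z s ω)) P := by
    have : (fun ω => taylorRem φ u (m s + Z s ω)) = fun ω => (φ (u + (m s + Z s ω)) - φ u) -
      (fderiv ℝ φ u (m s) + fderiv ℝ φ u (Z s ω) + (1 / 2 : ℝ) •
        (B (m s) (m s) + B (m s) (Z s ω) + B (Z s ω) (m s) + B (Z s ω) (Z s ω))) := by
      funext ω; rw [hexp]; abel
    rw [this]
    exact (i0.sub (integrable_const _)).sub j5
  have htot : transOp P (A θ) (a θ) n s φ u - φ u = fderiv ℝ φ u (m s) +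
      (1 / 2 : ℝ) • (B (m s) (m s) + ∫ ω, B (Z s ω) (Z s ω) ∂P) +
      ∫ ω, taylorRem φ u (m s + Z s ω) ∂P := by
    have : transOp P (A θ) (a θ) n s φ u - φ u = ∫ ω, (φ (u + (m s + Z s ω)) - φ u) ∂P := by
      rw [integral_sub i0 (integrable_const _)]
      simp [transOp, hU]
    rw [this, integral_congr_ae (Eventually.of_forall hexp), integral_add j5 j6,
      integral_add j1 j4', integral_add (integrable_const _) i1.1, integral_smul,
      integral_add j3 i4', integral_add j2 i3.1, integral_add (integrable_const _) i2.1,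
      i1.2, i2.2, i3.2]
    simp
  rw [htot]
  simp only [Function.comp_apply, map_smul, smul_add]
  rw [smul_comm (1 / 2 : ℝ) s⁻¹, smul_comm (1 / 2 : ℝ) s⁻¹]
  abel

end LinFam

end Generator

/-! ### The potential of a decaying function and its Poisson equation. -/

section Poisson

variable {Ω : Type*} [MeasurableSpace Ω] {P : Measure Ω} [IsProbabilityMeasure P]
  {ι : Type*} [Fintype ι] {Θ : Type*}
  {V : Type*} [NormedAddCommGroup V] [NormedSpace ℝ V] [FiniteDimensional ℝ V] [CompleteSpace V]
  [MeasurableSpace V] [BorelSpace V]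
  {E : Type*} [NormedAddCommGroup E] [NormedSpace ℝ E] [CompleteSpace E]

theorem integrableOn_exp_neg {c : ℝ} (hc : 0 < c) :
    IntegrableOn (fun t => Real.exp (-c * t)) (Ioi 0) := exp_neg_integrableOn_Ioi 0 hc

theorem integral_Ioi_exp_neg {c : ℝ} (hc : 0 < c) :
    ∫ t in Ioi (0 : ℝ), Real.exp (-c * t) = 1 / c := by
  rw [integral_exp_mul_Ioi (by linarith)]
  simp

theorem integral_Ioi_comp_add {f : ℝ → E} (s : ℝ) :
    ∫ t in Ioi (0 : ℝ), f (s + t) = ∫ t in Ioi s, f t := by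
  have := (measurePreserving_add_left volume s).setIntegral_preimage_emb
    (MeasurableEquiv.addLeft s).measurableEmbedding f (Ioi s)
  rw [← this]
  simp

namespace LinFam

variable {A : Θ → V →L[ℝ] V} {a : Θ → V} {e : ι → V} {n : ℝ → Ω → V} {K c : ℝ}

theorem measurable_transOp (h : LinFam P A a e n K c) (θ : Θ) {ψ : V → E} (hψ : Continuous ψ)
    (u : V) : StronglyMeasurable fun t => transOp P (A θ) (a θ) n t ψ u :=
  (h.noise.stronglyMeasurable_transOp (A θ) (a θ) hψ).comp_measurable
    (measurable_id.prodMk measurable_const : Measurable fun t : ℝ => (t, u))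

theorem integrableOn_transOp (h : LinFam P A a e n K c) (θ : Θ) {G : V → E} (hG : Continuous G)
    {C₁ : ℝ} {N₁ : ℕ} (hdec : ∀ t, 0 ≤ t → ∀ u,
      ‖transOp P (A θ) (a θ) n t G u‖ ≤ C₁ * Real.exp (-c * t) * (1 + ‖u‖) ^ N₁) (u : V) :
    IntegrableOn (fun t => transOp P (A θ) (a θ) n t G u) (Ioi 0) := by
  refine (((integrableOn_exp_neg h.pos).const_mul C₁).mul_const ((1 + ‖u‖) ^ N₁)).mono'
    (h.measurable_transOp θ hG u).aestronglyMeasurable ?_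
  exact (ae_restrict_mem measurableSet_Ioi).mono fun t ht => hdec t (le_of_lt ht) u

theorem integral_bound (h : LinFam P A a e n K c) {f : ℝ → E} {D : ℝ}
    (hf : ∀ t, 0 ≤ t → ‖f t‖ ≤ D * Real.exp (-c * t)) : ‖∫ t in Ioi (0 : ℝ), f t‖ ≤ D / c := by
  refine (norm_integral_le_of_norm_le ((integrableOn_exp_neg h.pos).const_mul D)
    ((ae_restrict_mem measurableSet_Ioi).mono fun t ht => hf t (le_of_lt ht))).trans_eq ?_
  rw [integral_const_mul, integral_Ioi_exp_neg h.pos]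
  ring

/-- Smoothness and growth of the potential `∫₀^∞ T_t G dt`. -/
theorem potential_polyC2 (h : LinFam P A a e n K c) (θ : Θ) {C C₁ : ℝ} {N N₁ : ℕ} {G : V → E}
    (hG : PolyC2 C N G) (hdec : ∀ t, 0 ≤ t → ∀ u,
      ‖transOp P (A θ) (a θ) n t G u‖ ≤ C₁ * Real.exp (-c * t) * (1 + ‖u‖) ^ N₁) :
    PolyC2 (max (C₁ / c) (K ^ 2 * C * h.mom N / c)) (max N N₁)
      (fun u => ∫ t in Ioi (0 : ℝ), transOp P (A θ) (a θ) n t G u) := by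
  have hC2 := fun t (ht : 0 ≤ t) => h.transOp_polyC2 θ ht hG
  have hmem : ∀ᵐ t ∂volume.restrict (Ioi (0 : ℝ)), 0 ≤ t :=
    (ae_restrict_mem measurableSet_Ioi).mono fun t ht => le_of_lt ht
  obtain ⟨r1, r2, r3⟩ := contDiff_two_integral_of_weight (μ := volume.restrict (Ioi (0 : ℝ)))
    (F := fun u t => transOp P (A θ) (a θ) n t G u) (w := fun u => (1 + ‖u‖) ^ N)
    (b := fun t => K ^ 2 * C * h.mom N * Real.exp (-c * t)) (by fun_prop)
    ((integrableOn_exp_neg h.pos).const_mul _)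
    (fun u => (h.measurable_transOp θ hG.contDiff.continuous u).aestronglyMeasurable)
    (fun u => h.integrableOn_transOp θ hG.contDiff.continuous hdec u)
    (hmem.mono fun t ht => (hC2 t ht).1) (hmem.mono fun t ht => (hC2 t ht).2.1)
    (hmem.mono fun t ht => (hC2 t ht).2.2)
  have b0 : PolyBdd (C₁ / c) N₁ (fun u => ∫ t in Ioi (0 : ℝ), transOp P (A θ) (a θ) n t G u) := by
    intro u
    refine (h.integral_bound (D := C₁ * (1 + ‖u‖) ^ N₁) fun t ht => ?_).trans_eq (by ring)
    exact (hdec t ht u).trans_eq (by ring)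
  have b1 : PolyBdd (K ^ 2 * C * h.mom N / c) N
      (fderiv ℝ (fun u => ∫ t in Ioi (0 : ℝ), transOp P (A θ) (a θ) n t G u)) := by
    intro u
    rw [r2]
    refine (h.integral_bound (D := K ^ 2 * C * h.mom N * (1 + ‖u‖) ^ N) fun t ht => ?_).trans_eq
      (by ring)
    exact ((hC2 t ht).2.1 u).trans_eq (by ring)
  have b2 : PolyBdd (K ^ 2 * C * h.mom N / c) N
      (fderiv ℝ (fderiv ℝ (fun u => ∫ t in Ioi (0 : ℝ), transOp P (A θ) (a θ) n t G u))) := by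
    intro u
    rw [r3]
    refine (h.integral_bound (D := K ^ 2 * C * h.mom N * (1 + ‖u‖) ^ N) fun t ht => ?_).trans_eq
      (by ring)
    exact ((hC2 t ht).2.2 u).trans_eq (by ring)
  exact ⟨r1, b0.mono (le_max_left _ _) (le_max_right _ _),
    b1.mono (le_max_right _ _) (le_max_left _ _), b2.mono (le_max_right _ _) (le_max_left _ _)⟩

/-- The semigroup applied to the potential. -/
theorem transOp_potential (h : LinFam P A a e n K c) (θ : Θ) {C C₁ : ℝ} {N N₁ : ℕ} {G : V → E}
    (hG : Continuous G) (hGb : PolyBdd C N G) (hdec : ∀ t, 0 ≤ t → ∀ u,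
      ‖transOp P (A θ) (a θ) n t G u‖ ≤ C₁ * Real.exp (-c * t) * (1 + ‖u‖) ^ N₁)
    {s : ℝ} (hs : 0 ≤ s) (u : V) :
    transOp P (A θ) (a θ) n s (fun u => ∫ t in Ioi (0 : ℝ), transOp P (A θ) (a θ) n t G u) u =
      ∫ t in Ioi s, transOp P (A θ) (a θ) n t G u := by
  have hC₁ : 0 ≤ C₁ := by
    have := (norm_nonneg _).trans (hdec 0 le_rfl 0)
    simpa using this
  obtain ⟨b, hbi, -, hle⟩ := h.exists_dominating N₁ θ hs
  have hmeas : StronglyMeasurable fun p : Ω × ℝ =>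
      transOp P (A θ) (a θ) n p.2 G (affPath (A θ) (a θ) u (fun r => n r p.1) s) := by
    refine (h.noise.stronglyMeasurable_transOp (A θ) (a θ) hG).comp_measurable
      (g := fun p : Ω × ℝ => (p.2, affPath (A θ) (a θ) u (fun r => n r p.1) s)) ?_
    exact measurable_snd.prodMk ((h.noise.measurable_affPath (A θ) (a θ) u).comp
      (measurable_const.prodMk measurable_fst))
  have hint : Integrable (Function.uncurry fun (ω : Ω) (t : ℝ) =>
      transOp P (A θ) (a θ) n t G (affPath (A θ) (a θ) u (fun r => n r ω) s))
      (P.prod (volume.restrict (Ioi (0 : ℝ)))) := by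
    have hb : Integrable (fun p : Ω × ℝ => b p.1 * (C₁ * (1 + ‖u‖) ^ N₁ * Real.exp (-c * p.2)))
        (P.prod (volume.restrict (Ioi (0 : ℝ)))) :=
      hbi.mul_prod ((integrableOn_exp_neg h.pos).const_mul _)
    refine hb.mono' hmeas.aestronglyMeasurable ?_
    have hae : ∀ᵐ p ∂(P.prod (volume.restrict (Ioi (0 : ℝ)))), p.2 ∈ Ioi (0 : ℝ) :=
      Measure.quasiMeasurePreserving_snd.ae
        (ae_restrict_mem (μ := volume) (measurableSet_Ioi (a := (0 : ℝ))))
    filter_upwards [hae] with p hp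
    refine (hdec p.2 (le_of_lt hp) _).trans ?_
    calc _ ≤ C₁ * Real.exp (-c * p.2) * (b p.1 * (1 + ‖u‖) ^ N₁) := by
          have := hle u p.1
          have := Real.exp_pos (-c * p.2)
          gcongr
      _ = _ := by ring
  calc transOp P (A θ) (a θ) n s (fun u => ∫ t in Ioi (0 : ℝ), transOp P (A θ) (a θ) n t G u) u
      = ∫ t in Ioi (0 : ℝ), transOp P (A θ) (a θ) n s (transOp P (A θ) (a θ) n t G) u :=
        integral_integral_swap hint
    _ = ∫ t in Ioi (0 : ℝ), transOp P (A θ) (a θ) n (s + t) G u :=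
        setIntegral_congr_fun measurableSet_Ioi fun t ht =>
          h.transOp_transOp θ hs (le_of_lt ht) hG hGb u
    _ = _ := integral_Ioi_comp_add (f := fun t => transOp P (A θ) (a θ) n t G u) s

/-- The Poisson equation for the potential. -/
theorem poisson_equation (h : LinFam P A a e n K c) (θ : Θ) {C C₁ : ℝ} {N N₁ : ℕ} {G : V → E}
    (hG : PolyC2 C N G) (hdec : ∀ t, 0 ≤ t → ∀ u,
      ‖transOp P (A θ) (a θ) n t G u‖ ≤ C₁ * Real.exp (-c * t) * (1 + ‖u‖) ^ N₁) (u : V) :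
    fderiv ℝ (fun u => ∫ t in Ioi (0 : ℝ), transOp P (A θ) (a θ) n t G u) u (a θ - A θ u) +
      (1 / 2 : ℝ) • ∑ i, fderiv ℝ (fderiv ℝ
        (fun u => ∫ t in Ioi (0 : ℝ), transOp P (A θ) (a θ) n t G u)) u (e i) (e i) = -G u := by
  have hF := h.potential_polyC2 θ hG hdec
  have h1 := h.tendsto_generator θ hF u
  have hint := h.integrableOn_transOp θ hG.contDiff.continuous hdec u
  -- Right continuity at time `0` follows from the existence of the generator limit for `G` itself.
  have hcont0 : Tendsto (fun s => transOp P (A θ) (a θ) n s G u) (𝓝[>] 0) (𝓝 (G u)) := by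
    have h2 := h.tendsto_generator θ hG u
    have h3 : Tendsto (fun s : ℝ => s) (𝓝[>] 0) (𝓝 0) := nhdsWithin_le_nhds
    have h4 := (h3.smul h2).add_const (G u)
    rw [zero_smul, zero_add] at h4
    refine h4.congr' ?_
    filter_upwards [self_mem_nhdsWithin] with s (hs : 0 < s)
    rw [smul_smul, mul_inv_cancel₀ hs.ne', one_smul, sub_add_cancel]
  have hcw : ContinuousWithinAt (fun s => transOp P (A θ) (a θ) n s G u) (Ioi 0) 0 := by
    rw [ContinuousWithinAt, h.noise.transOp_zero]
    exact hcont0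
  have hd : HasDerivWithinAt (fun s => ∫ t in (0 : ℝ)..s, transOp P (A θ) (a θ) n t G u)
      (transOp P (A θ) (a θ) n 0 G u) (Ici 0) 0 :=
    intervalIntegral.integral_hasDerivWithinAt_right (s := Ici 0) (t := Ioi 0)
      (by simp) ((h.measurable_transOp θ hG.contDiff.continuous u).stronglyMeasurableAtFilter) hcw
  rw [h.noise.transOp_zero] at hd
  have h5 : Tendsto (fun s : ℝ => s⁻¹ • ∫ t in (0 : ℝ)..s, transOp P (A θ) (a θ) n t G u) (𝓝[>] 0)
      (𝓝 (G u)) := by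
    have := (hasDerivWithinAt_iff_tendsto_slope' (by simp)).1 (hd.mono Ioi_subset_Ici_self)
    refine this.congr fun s => ?_
    simp [slope_def_module]
  -- The same quotient has two limits: the generator of the potential by Taylor expansion, and `-G
  -- u` because the semigroup merely cuts the time integral off at `s`.
  refine tendsto_nhds_unique h1 (h5.neg.congr' ?_)
  filter_upwards [self_mem_nhdsWithin] with s (hs : 0 < s)
  rw [h.transOp_potential θ hG.contDiff.continuous hG.bdd hdec hs.le,
    ← intervalIntegral.integral_Ioi_sub_Ioi hint hs.le, ← smul_neg, neg_sub]

end LinFam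

end Poisson

/-! ### Linear images of noise. -/

section NoiseMap

variable {Ω : Type*} [MeasurableSpace Ω] {P : Measure Ω} {ι : Type*} [Fintype ι]
  {V : Type*} [NormedAddCommGroup V] [NormedSpace ℝ V] [MeasurableSpace V] [BorelSpace V]
  {V' : Type*} [NormedAddCommGroup V'] [NormedSpace ℝ V'] [MeasurableSpace V'] [BorelSpace V']

theorem IsNoise.map {e : ι → V} {n : ℝ → Ω → V} (h : IsNoise P e n) (T : V →L[ℝ] V') :
    IsNoise P (fun i => T (e i)) (fun t ω => T (n t ω)) where
  measurable t := T.continuous.measurable.comp (h.measurable t)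
  continuous ω := T.continuous.comp (h.continuous ω)
  zero ω := by rw [h.zero, map_zero]
  charFun m s hs hm L := by
    have := h.charFun m s hs hm (fun j => (L j).comp T)
    simpa [map_sub] using this

end NoiseMap

/-! ### Domination of paths uniformly in the parameter. -/

section PathWeight

variable {Ω : Type*} [MeasurableSpace Ω] {P : Measure Ω} [IsProbabilityMeasure P]
  {ι : Type*} [Fintype ι] {Θ : Type*}
  {V : Type*} [NormedAddCommGroup V] [NormedSpace ℝ V] [FiniteDimensional ℝ V] [CompleteSpace V]
  [MeasurableSpace V] [BorelSpace V]

/-- A functional of a path which dominates the solutions of all linear equations driven by it. -/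
noncomputable def pathWeight (m : ℝ → V) (t : ℝ) : ℝ := 1 + ‖m t‖ + ∫ s in (0 : ℝ)..t, ‖m s‖

theorem one_le_pathWeight (m : ℝ → V) {t : ℝ} (ht : 0 ≤ t) : 1 ≤ pathWeight m t := by
  have : 0 ≤ ∫ s in (0 : ℝ)..t, ‖m s‖ := intervalIntegral.integral_nonneg ht fun _ _ => norm_nonneg _
  have := norm_nonneg (m t)
  unfold pathWeight
  linarith

/-- Jensen's inequality for the average over `(0, t]`. -/
theorem intervalIntegral_pow_le {f : ℝ → ℝ} (hf : Continuous f) (h0 : ∀ s, 0 ≤ f s) {t : ℝ}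
    (ht : 0 < t) (p : ℕ) :
    (∫ s in (0 : ℝ)..t, f s) ^ p ≤ t ^ p * t⁻¹ * ∫ s in (0 : ℝ)..t, f s ^ p := by
  have hfin : volume (Ioc 0 t) ≠ ⊤ := by simp
  have hi : ∀ g : ℝ → ℝ, Continuous g → IntegrableOn g (Ioc 0 t) := fun g hg =>
    (hg.integrableOn_Icc (a := 0) (b := t)).mono_set Ioc_subset_Icc_self
  have := (convexOn_pow p).map_set_average_le (μ := volume) (t := Ioc 0 t) (f := f)
    (continuous_pow p).continuousOn isClosed_Ici (by simpa using ht) hfin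
    (Eventually.of_forall fun s => h0 s) (hi f hf) (hi _ ((continuous_pow p).comp hf))
  rw [setAverage_eq, setAverage_eq] at this
  simp only [measureReal_def, Real.volume_Ioc, sub_zero, ENNReal.toReal_ofReal ht.le, smul_eq_mul,
    mul_pow, ← intervalIntegral.integral_of_le ht.le] at this
  have h2 := mul_le_mul_of_nonneg_left this (pow_nonneg ht.le p)
  rw [← mul_assoc, ← mul_pow, mul_inv_cancel₀ ht.ne', one_pow, one_mul] at h2
  linarith

/-- Differentiating an expectation in `θ` needs one integrable bound for all parameters at once; a
functional of the noise path alone provides it. -/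
theorem IsNoise.integrable_pathWeight_pow {e : ι → V} {n : ℝ → Ω → V} (h : IsNoise P e n) (p : ℕ)
    {t : ℝ} (ht : 0 ≤ t) : Integrable (fun ω => pathWeight (fun s => n s ω) t ^ p) P := by
  obtain ⟨M, hM, hb⟩ := IsCenteredGaussian.exists_moment_bound V P p
  set κ := √(∑ i, ‖e i‖ ^ 2) with hκ
  have hmom : ∀ s, 0 ≤ s → Integrable (fun ω => ‖n s ω‖ ^ p) P ∧
      ∫ ω, ‖n s ω‖ ^ p ∂P ≤ M * (√s * κ) ^ p := fun s hs => by
    refine hb _ _ _ (h.isCenteredGaussian hs) (by positivity) fun L => ?_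
    rw [mul_pow, Real.sq_sqrt hs, Real.sq_sqrt (by positivity), mul_assoc, Finset.sum_mul]
    refine mul_le_mul_of_nonneg_left (Finset.sum_le_sum fun i _ => ?_) hs
    rw [← sq_abs, ← Real.norm_eq_abs, ← mul_pow, mul_comm]
    exact pow_le_pow_left₀ (norm_nonneg _) (L.le_opNorm _) 2
  have hint : Integrable (fun ω => ∫ s in (0 : ℝ)..t, ‖n s ω‖ ^ p) P := by
    simp only [intervalIntegral.integral_of_le ht]
    have hm : AEStronglyMeasurable (fun q : Ω × ℝ => ‖n q.2 q.1‖ ^ p)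
        (P.prod (volume.restrict (Ioc 0 t))) :=
      ((h.measurable_uncurry.comp measurable_swap).norm.pow_const p).aestronglyMeasurable
    refine Integrable.integral_prod_left ((integrable_prod_iff' hm).2 ⟨?_, ?_⟩)
    · filter_upwards [ae_restrict_mem measurableSet_Ioc] with s hs using (hmom s hs.1.le).1
    · refine Integrable.mono' (g := fun s => M * (√s * κ) ^ p) ?_ ?_ ?_
      · exact ((by fun_prop : Continuous fun s : ℝ => M * (√s * κ) ^ p).integrableOn_Icc
          (a := 0) (b := t)).mono_set Ioc_subset_Icc_self
      · exact (hm.norm.prod_swap.integral_prod_right' (E := ℝ))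
      · filter_upwards [ae_restrict_mem measurableSet_Ioc] with s hs
        rw [Real.norm_of_nonneg (by positivity)]
        simpa using (hmom s hs.1.le).2
  have hcn : ∀ ω, Continuous fun s => ‖n s ω‖ := fun ω => (h.continuous ω).norm
  refine Integrable.mono' (g := fun ω => 3 ^ p * (1 + ‖n t ω‖ ^ p +
    t ^ p * t⁻¹ * ∫ s in (0 : ℝ)..t, ‖n s ω‖ ^ p)) ?_ ?_ (Eventually.of_forall fun ω => ?_)
  · exact (((integrable_const _).add (hmom t ht).1).add (hint.const_mul _)).const_mul _
  · refine (Measurable.pow_const ?_ p).aestronglyMeasurable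
    refine ((h.measurable t).norm.const_add 1).add ?_
    simp only [intervalIntegral.integral_of_le ht]
    exact ((h.measurable_uncurry.comp measurable_swap).norm.stronglyMeasurable.integral_prod_right
      (ν := volume.restrict (Ioc 0 t))).measurable
  · have h1 := one_le_pathWeight (fun s => n s ω) ht
    rw [Real.norm_of_nonneg (by positivity)]
    have hI : 0 ≤ ∫ s in (0 : ℝ)..t, ‖n s ω‖ :=
      intervalIntegral.integral_nonneg ht fun _ _ => norm_nonneg _
    -- The extra term covers `t = 0` with `p = 0`, where the left side is `1` and the last term
    -- vanishes.
    have hI' : (∫ s in (0 : ℝ)..t, ‖n s ω‖) ^ p ≤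
        (if p = 0 then 1 else 0) + t ^ p * t⁻¹ * ∫ s in (0 : ℝ)..t, ‖n s ω‖ ^ p := by
      rcases ht.eq_or_lt with rfl | ht'
      · rcases Nat.eq_zero_or_pos p with rfl | hp
        · simp
        · simp [hp.ne']
      · refine (intervalIntegral_pow_le (hcn ω) (fun _ => norm_nonneg _) ht' p).trans ?_
        split_ifs <;> simp
    have hmax : pathWeight (fun s => n s ω) t ≤
        3 * max (max 1 ‖n t ω‖) (∫ s in (0 : ℝ)..t, ‖n s ω‖) := by
      have a1 := le_max_left (max 1 ‖n t ω‖) (∫ s in (0 : ℝ)..t, ‖n s ω‖)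
      have a2 := le_max_right (max 1 ‖n t ω‖) (∫ s in (0 : ℝ)..t, ‖n s ω‖)
      have a3 := le_max_left 1 ‖n t ω‖
      have a4 := le_max_right 1 ‖n t ω‖
      unfold pathWeight
      linarith
    refine (pow_le_pow_left₀ (by linarith) hmax p).trans ?_
    rw [mul_pow]
    refine mul_le_mul_of_nonneg_left ?_ (by positivity)
    have hI0 : 0 ≤ t ^ p * t⁻¹ * ∫ s in (0 : ℝ)..t, ‖n s ω‖ ^ p := by
      have : 0 ≤ ∫ s in (0 : ℝ)..t, ‖n s ω‖ ^ p :=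
        intervalIntegral.integral_nonneg ht fun _ _ => by positivity
      positivity
    have hn0 : 0 ≤ ‖n t ω‖ ^ p := by positivity
    rcases max_choice (max 1 ‖n t ω‖) (∫ s in (0 : ℝ)..t, ‖n s ω‖) with e1 | e1
    · rw [e1]
      rcases max_choice 1 ‖n t ω‖ with e2 | e2 <;> rw [e2]
      · rw [one_pow]; linarith
      · linarith
    · rw [e1]
      split_ifs at hI' <;> linarith

/-- The bound holds path by path with a random factor free of `θ`, unlike the dominating functions
behind `LinFam.mom`. The price is growth in `t`, harmless since it is used at a fixed time. -/
theorem LinFam.norm_affPath_le {A : Θ → V →L[ℝ] V} {a : Θ → V} {e : ι → V} {n : ℝ → Ω → V}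
    {K c : ℝ} (h : LinFam P A a e n K c) (θ : Θ) (u : V) {m : ℝ → V} (hm : Continuous m) {t : ℝ}
    (ht : 0 ≤ t) :
    1 + ‖affPath (A θ) (a θ) u m t‖ ≤ 3 * K ^ 2 * (1 + t) * (1 + ‖u‖) * pathWeight m t := by
  have hK := h.one_le
  have hw := one_le_pathWeight m ht
  have h1 : ‖∫ s in (0 : ℝ)..t, flow (A θ) (t - s) (a θ - A θ (m s))‖ ≤
      ∫ s in (0 : ℝ)..t, (K ^ 2 + K ^ 2 * ‖m s‖) := by
    refine intervalIntegral.norm_integral_le_of_norm_le ht (Eventually.of_forall fun s hs => ?_)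
      (Continuous.intervalIntegrable (by fun_prop) _ _)
    refine (ContinuousLinearMap.le_opNorm _ _).trans ?_
    have h2 : ‖a θ - A θ (m s)‖ ≤ K + K * ‖m s‖ :=
      (norm_sub_le _ _).trans (add_le_add (h.norm_a θ) ((ContinuousLinearMap.le_opNorm _ _).trans
        (mul_le_mul_of_nonneg_right (h.norm_A θ) (norm_nonneg _))))
    calc _ ≤ K * (K + K * ‖m s‖) := mul_le_mul (h.norm_flow_le θ (by linarith [hs.2])) h2
          (norm_nonneg _) (by linarith)
      _ = _ := by ring
  rw [intervalIntegral.integral_add (by simp)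
    (Continuous.intervalIntegrable (by fun_prop) _ _), intervalIntegral.integral_const_mul] at h1
  simp only [intervalIntegral.integral_const, sub_zero, smul_eq_mul] at h1
  have h3 : ‖flow (A θ) t u‖ ≤ K * ‖u‖ := (ContinuousLinearMap.le_opNorm _ _).trans
    (mul_le_mul_of_nonneg_right (h.norm_flow_le θ ht) (norm_nonneg _))
  have h4 : ‖affPath (A θ) (a θ) u m t‖ ≤
      ‖m t‖ + K * ‖u‖ + (t * K ^ 2 + K ^ 2 * ∫ s in (0 : ℝ)..t, ‖m s‖) :=
    (norm_add_le _ _).trans (add_le_add ((norm_add_le _ _).trans (add_le_add le_rfl h3)) h1)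
  have hI : 0 ≤ ∫ s in (0 : ℝ)..t, ‖m s‖ := intervalIntegral.integral_nonneg ht fun _ _ => norm_nonneg _
  have hK2 : K ≤ K ^ 2 := by nlinarith
  have hu := norm_nonneg u
  have hmt := norm_nonneg (m t)
  have key : 1 + ‖m t‖ + K * ‖u‖ + (t * K ^ 2 + K ^ 2 * ∫ s in (0 : ℝ)..t, ‖m s‖) ≤
      K ^ 2 * (pathWeight m t + ‖u‖ + t) := by
    have : 0 ≤ (K ^ 2 - 1) * (1 + ‖m t‖) := mul_nonneg (by nlinarith) (by linarith)
    have := mul_le_mul_of_nonneg_right hK2 hu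
    unfold pathWeight
    nlinarith
  have e1 : pathWeight m t ≤ (1 + t) * (1 + ‖u‖) * pathWeight m t :=
    le_mul_of_one_le_left (by linarith) (by nlinarith [mul_nonneg ht hu])
  have e2 : ‖u‖ ≤ (1 + t) * (1 + ‖u‖) * pathWeight m t := by
    nlinarith [mul_nonneg ht hu, mul_nonneg (mul_nonneg (by linarith : 0 ≤ 1 + t)
      (by linarith : 0 ≤ 1 + ‖u‖)) (by linarith : 0 ≤ pathWeight m t - 1)]
  have e3 : t ≤ (1 + t) * (1 + ‖u‖) * pathWeight m t := by
    nlinarith [mul_nonneg ht hu, mul_nonneg (mul_nonneg (by linarith : 0 ≤ 1 + t)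
      (by linarith : 0 ≤ 1 + ‖u‖)) (by linarith : 0 ≤ pathWeight m t - 1)]
  calc 1 + ‖affPath (A θ) (a θ) u m t‖ ≤ K ^ 2 * (pathWeight m t + ‖u‖ + t) := by linarith
    _ ≤ K ^ 2 * (3 * ((1 + t) * (1 + ‖u‖) * pathWeight m t)) :=
        mul_le_mul_of_nonneg_left (by linarith) (by positivity)
    _ = _ := by ring

end PathWeight

/-! ### Block triangular systems. -/

section Triangular

variable {V : Type*} [NormedAddCommGroup V] [NormedSpace ℝ V] [CompleteSpace V]
  {W : Type*} [NormedAddCommGroup W] [NormedSpace ℝ W] [CompleteSpace W]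

/-- Block triangular operators, as a linear function of the blocks. -/
noncomputable def triL (V W : Type*) [NormedAddCommGroup V] [NormedSpace ℝ V]
    [NormedAddCommGroup W] [NormedSpace ℝ W] :
    ((V →L[ℝ] V) × (V →L[ℝ] W) × (W →L[ℝ] W)) →L[ℝ] (V × W →L[ℝ] V × W) :=
  LinearMap.mkContinuous
    { toFun := fun q => (q.1.comp (.fst ℝ V W)).prod (q.2.1.comp (.fst ℝ V W) +
        q.2.2.comp (.snd ℝ V W))
      map_add' := fun p q => by
        ext v <;> simp
      map_smul' := fun r q => by ext v <;> simp } 2 (fun q => by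
    refine ContinuousLinearMap.opNorm_le_bound _ (by positivity) fun v => ?_
    have h1 : ‖q.1 v.1‖ ≤ ‖q‖ * ‖v‖ := (q.1.le_opNorm _).trans
      (mul_le_mul (norm_fst_le q) (norm_fst_le v) (norm_nonneg _) (norm_nonneg _))
    have h2 : ‖q.2.1 v.1‖ ≤ ‖q‖ * ‖v‖ := (q.2.1.le_opNorm _).trans
      (mul_le_mul ((norm_fst_le q.2).trans (norm_snd_le q)) (norm_fst_le v) (norm_nonneg _)
        (norm_nonneg _))
    have h3 : ‖q.2.2 v.2‖ ≤ ‖q‖ * ‖v‖ := (q.2.2.le_opNorm _).trans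
      (mul_le_mul ((norm_snd_le q.2).trans (norm_snd_le q)) (norm_snd_le v) (norm_nonneg _)
        (norm_nonneg _))
    have h0 : 0 ≤ ‖q‖ * ‖v‖ := by positivity
    refine max_le ?_ ?_
    · simpa using h1.trans (by linarith)
    · simpa using (norm_add_le _ _).trans (by linarith : _ ≤ 2 * ‖q‖ * ‖v‖))

/-- The block triangular operator `(v, w) ↦ (A v, D v + B w)`. -/
noncomputable def tri (A : V →L[ℝ] V) (D : V →L[ℝ] W) (B : W →L[ℝ] W) : V × W →L[ℝ] V × W :=
  triL V W (A, D, B)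

omit [CompleteSpace V] [CompleteSpace W] in
@[simp] theorem tri_apply (A : V →L[ℝ] V) (D : V →L[ℝ] W) (B : W →L[ℝ] W) (v : V × W) :
    tri A D B v = (A v.1, D v.1 + B v.2) := rfl

omit [CompleteSpace V] [CompleteSpace W] in
theorem norm_tri_le {A : V →L[ℝ] V} {D : V →L[ℝ] W} {B : W →L[ℝ] W} {K : ℝ} (hA : ‖A‖ ≤ K)
    (hD : ‖D‖ ≤ K) (hB : ‖B‖ ≤ K) : ‖tri A D B‖ ≤ 2 * K := by
  refine ((triL V W).le_opNorm _).trans ?_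
  have hK := (norm_nonneg A).trans hA
  refine mul_le_mul (LinearMap.mkContinuous_norm_le _ (by norm_num) _)
    (norm_prod_le_iff.2 ⟨hA, norm_prod_le_iff.2 ⟨hD, hB⟩⟩) (norm_nonneg _) (by norm_num)

theorem flow_tri_fst (A : V →L[ℝ] V) (D : V →L[ℝ] W) (B : W →L[ℝ] W) (t : ℝ) (v : V × W) :
    (flow (tri A D B) t v).1 = flow A t v.1 :=
  flow_intertwine (T := .fst ℝ V W) (fun _ => rfl) t v

/-- The second component solves its own linear equation, forced by the first. -/
theorem flow_tri_snd (A : V →L[ℝ] V) (D : V →L[ℝ] W) (B : W →L[ℝ] W) {t : ℝ} (ht : 0 ≤ t)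
    (v : V × W) : (flow (tri A D B) t v).2 =
      flow B t v.2 + ∫ s in (0 : ℝ)..t, flow B (t - s) (-(D (flow A s v.1))) := by
  have hT : Continuous fun s => flow (tri A D B) s v := (continuous_flow _).clm_apply continuous_const
  have hcA : Continuous fun s => flow A s v.1 := (continuous_flow _).clm_apply continuous_const
  refine eq_duhamel B (y := fun s => (flow (tri A D B) s v).2) (by fun_prop) (by fun_prop)
    (fun r _ => ?_) ht
  have hd : ∀ s, HasDerivAt (fun s => (flow (tri A D B) s v).2)
      (-(D (flow A s v.1)) - B (flow (tri A D B) s v).2) s := fun s => by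
    have h1 := (ContinuousLinearMap.snd ℝ V W).hasFDerivAt.comp_hasDerivAt s
      ((hasDerivAt_flow (tri A D B) s).clm_apply (hasDerivAt_const s v))
    refine HasDerivAt.congr_deriv (f := fun s => (flow (tri A D B) s v).2) h1 ?_
    simp [flow_tri_fst]
    abel
  rw [intervalIntegral.integral_eq_sub_of_hasDerivAt (fun s _ => hd s)
    (Continuous.intervalIntegrable (by fun_prop) _ _)]
  simp

/-- With equal rates on the diagonal the coupling term is resonant, of size `t * exp (-c t)`. Half
of the rate absorbs the factor `t`, through `t * exp (-c t) ≤ (2 / c) * exp (-(c / 2) t)`. -/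
theorem norm_flow_tri_le {A : V →L[ℝ] V} {D : V →L[ℝ] W} {B : W →L[ℝ] W} {K c : ℝ} (hK : 0 ≤ K)
    (hc : 0 < c) (hA : ∀ t, 0 ≤ t → ‖flow A t‖ ≤ K * Real.exp (-c * t))
    (hB : ∀ t, 0 ≤ t → ‖flow B t‖ ≤ K * Real.exp (-c * t)) (hD : ‖D‖ ≤ K) {t : ℝ} (ht : 0 ≤ t) :
    ‖flow (tri A D B) t‖ ≤ (K + 2 * K ^ 3 / c) * Real.exp (-(c / 2) * t) := by
  refine ContinuousLinearMap.opNorm_le_bound _ (by positivity) fun v => ?_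
  have he : Real.exp (-c * t) ≤ Real.exp (-(c / 2) * t) := by
    rw [Real.exp_le_exp]; nlinarith
  have hte : t * Real.exp (-c * t) ≤ 2 / c * Real.exp (-(c / 2) * t) := by
    have h1 : Real.exp (-c * t) = Real.exp (-(c / 2) * t) * Real.exp (-(c / 2) * t) := by
      rw [← Real.exp_add]; ring_nf
    have h2 : c / 2 * t * Real.exp (-(c / 2) * t) ≤ 1 := by
      rw [neg_mul, Real.exp_neg, ← div_eq_mul_inv, div_le_one (Real.exp_pos _)]
      linarith [Real.add_one_le_exp (c / 2 * t)]
    rw [h1, ← mul_assoc]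
    refine mul_le_mul_of_nonneg_right ?_ (Real.exp_pos _).le
    rw [le_div_iff₀ hc]
    linarith
  have h1 : ‖flow A t v.1‖ ≤ K * Real.exp (-c * t) * ‖v‖ := ((flow A t).le_opNorm _).trans
    (mul_le_mul (hA t ht) (norm_fst_le v) (norm_nonneg _) (by positivity))
  have h2 : ‖flow B t v.2‖ ≤ K * Real.exp (-c * t) * ‖v‖ := ((flow B t).le_opNorm _).trans
    (mul_le_mul (hB t ht) (norm_snd_le v) (norm_nonneg _) (by positivity))
  have h3 : ‖∫ s in (0 : ℝ)..t, flow B (t - s) (-(D (flow A s v.1)))‖ ≤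
      K ^ 3 * Real.exp (-c * t) * ‖v‖ * |t - 0| := by
    refine intervalIntegral.norm_integral_le_of_norm_le_const fun s hs => ?_
    rw [uIoc_of_le ht] at hs
    have e1 : Real.exp (-c * t) = Real.exp (-c * (t - s)) * Real.exp (-c * s) := by
      rw [← Real.exp_add]; ring_nf
    have e2 : ‖-(D (flow A s v.1))‖ ≤ K * (K * Real.exp (-c * s) * ‖v‖) := by
      rw [norm_neg]
      refine (D.le_opNorm _).trans (mul_le_mul hD ?_ (norm_nonneg _) hK)
      exact ((flow A s).le_opNorm _).trans
        (mul_le_mul (hA s hs.1.le) (norm_fst_le v) (norm_nonneg _) (by positivity))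
    calc _ ≤ K * Real.exp (-c * (t - s)) * (K * (K * Real.exp (-c * s) * ‖v‖)) :=
          ((flow B (t - s)).le_opNorm _).trans
            (mul_le_mul (hB _ (by linarith [hs.2])) e2 (norm_nonneg _) (by positivity))
      _ = _ := by rw [e1]; ring
  rw [sub_zero, abs_of_nonneg ht] at h3
  have hv := norm_nonneg v
  have hp := (Real.exp_pos (-(c / 2) * t)).le
  refine max_le ?_ ?_
  · rw [flow_tri_fst]
    refine h1.trans ?_
    gcongr
    have : 0 ≤ 2 * K ^ 3 / c := by positivity
    linarith
  · rw [flow_tri_snd _ _ _ ht]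
    refine (norm_add_le _ _).trans ((add_le_add h2 h3).trans ?_)
    have e3 := mul_le_mul_of_nonneg_left he (mul_nonneg hK hv)
    have e4 := mul_le_mul_of_nonneg_left hte (mul_nonneg (pow_nonneg hK 3) hv)
    calc _ = K * ‖v‖ * Real.exp (-c * t) + K ^ 3 * ‖v‖ * (t * Real.exp (-c * t)) := by ring
      _ ≤ K * ‖v‖ * Real.exp (-(c / 2) * t) +
          K ^ 3 * ‖v‖ * (2 / c * Real.exp (-(c / 2) * t)) := add_le_add e3 e4
      _ = _ := by ring

theorem map_affPath {A : V →L[ℝ] V} {B : W →L[ℝ] W} {T : V →L[ℝ] W}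
    (h : ∀ v, T (A v) = B (T v)) (a u : V) {m : ℝ → V} (hm : Continuous m) (t : ℝ) :
    T (affPath A a u m t) = affPath B (T a) (T u) (fun s => T (m s)) t := by
  rw [affPath, map_add, map_add, flow_intertwine h, ← T.intervalIntegral_comp_comm
    ((continuous_duhamel_integrand A (by fun_prop) t).intervalIntegrable _ _)]
  simp only [flow_intertwine h, affPath, map_sub, h]

theorem affPath_tri_snd (A : V →L[ℝ] V) (D : V →L[ℝ] W) (B : W →L[ℝ] W) (a u : V) (b w : W)
    {m : ℝ → V} (hm : Continuous m) {t : ℝ} (ht : 0 ≤ t) :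
    (affPath (tri A D B) (a, b) (u, w) (fun s => (m s, 0)) t).2 =
      flow B t w + ∫ s in (0 : ℝ)..t, flow B (t - s) (b - D (affPath A a u m s)) := by
  have hm' : Continuous fun s => (m s, (0 : W)) := by fun_prop
  have hT := continuous_affPath (tri A D B) (a, b) (u, w) hm'
  have hcA := continuous_affPath A a u hm
  have hfst : ∀ s, (affPath (tri A D B) (a, b) (u, w) (fun s => (m s, 0)) s).1 =
      affPath A a u m s := fun s => map_affPath (T := .fst ℝ V W) (fun _ => rfl) _ _ hm' s
  refine eq_duhamel B (y := fun t => (affPath (tri A D B) (a, b) (u, w) (fun s => (m s, 0)) t).2)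
    (by fun_prop) (by fun_prop) (fun r _ => ?_) ht
  have h1 := congrArg Prod.snd (affPath_integral_eq (tri A D B) (a, b) (u, w) hm' r)
  rw [h1, Prod.snd_add, Prod.snd_add, add_zero]
  congr 1
  have h2 := (ContinuousLinearMap.snd ℝ V W).intervalIntegral_comp_comm (μ := volume) (a := 0)
    (b := r) (f := fun s => (a, b) - tri A D B
      (affPath (tri A D B) (a, b) (u, w) (fun s => (m s, 0)) s))
    (Continuous.intervalIntegrable (by fun_prop) _ _)
  refine h2.symm.trans ?_
  congr 1
  funext s
  simp [hfst, sub_sub]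

end Triangular

/-! ### Differentiation of solutions in the parameter. -/

section Prolongation

/-- A product rule in which one factor is merely continuous: the other vanishes at the point, so the
missing term is `o(1) * O(‖η - θ‖)`. -/
theorem HasFDerivAt.clm_apply_of_continuousAt {Θ E F : Type*} [NormedAddCommGroup Θ]
    [NormedSpace ℝ Θ] [NormedAddCommGroup E] [NormedSpace ℝ E] [NormedAddCommGroup F]
    [NormedSpace ℝ F] {J : Θ → E →L[ℝ] F} {Δ : Θ → E} {Δ' : Θ →L[ℝ] E} {θ : Θ}
    (hJ : ContinuousAt J θ) (hΔ : HasFDerivAt Δ Δ' θ) (h0 : Δ θ = 0) :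
    HasFDerivAt (fun η => J η (Δ η)) ((J θ).comp Δ') θ := by
  have h1 : HasFDerivAt (fun η => J θ (Δ η)) ((J θ).comp Δ') θ := (J θ).hasFDerivAt.comp θ hΔ
  have hO : (fun η => Δ η) =O[𝓝 θ] fun η => η - θ := by
    simpa [h0] using hΔ.isBigO_sub
  have ho : (fun η => J η - J θ) =o[𝓝 θ] fun _ => (1 : ℝ) :=
    (Asymptotics.isLittleO_one_iff ℝ).2 (by simpa using hJ.sub_const (J θ))
  have h2 : HasFDerivAt (fun η => (J η - J θ) (Δ η)) (0 : Θ →L[ℝ] F) θ := by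
    refine HasFDerivAt.of_isLittleO ?_
    have : (fun η => (J η - J θ) (Δ η)) =o[𝓝 θ] fun η => (1 : ℝ) * ‖η - θ‖ := by
      refine Asymptotics.IsBigO.trans_isLittleO ?_ (ho.norm_left.mul_isBigO hO.norm_norm)
      exact Asymptotics.IsBigO.of_bound 1 (Eventually.of_forall fun η => by
        simpa using (J η - J θ).le_opNorm (Δ η))
    simpa [h0] using this.trans_isBigO (by simpa using Asymptotics.isBigO_refl _ _ |>.norm_left)
  have h3 := h2.add h1
  rw [zero_add] at h3
  refine h3.congr_of_eventuallyEq (Eventually.of_forall fun η => ?_)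
  simp

variable {V : Type*} [NormedAddCommGroup V] [NormedSpace ℝ V] [CompleteSpace V]
  {Θ : Type*} [NormedAddCommGroup Θ] [NormedSpace ℝ Θ]

theorem continuous_flow_left (t : ℝ) : Continuous fun A : V →L[ℝ] V => flow A t := by
  let _ : NormedAlgebra ℚ (V →L[ℝ] V) := NormedAlgebra.restrictScalars ℚ ℝ _
  exact NormedSpace.exp_continuous.comp (by fun_prop)

theorem continuousAt_integral_flow_comp {X : Type*} [NormedAddCommGroup X] [NormedSpace ℝ X]
    {A : Θ → V →L[ℝ] V} {K : ℝ} (hK : ∀ θ t, 0 ≤ t → ‖flow (A θ) t‖ ≤ K) {θ : Θ}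
    (hA : ContinuousAt A θ) {R : ℝ → X →L[ℝ] V} (hR : Continuous R) {t : ℝ} (ht : 0 ≤ t) :
    ContinuousAt (fun η => ∫ s in (0 : ℝ)..t, (flow (A η) (t - s)).comp (R s)) θ := by
  have hint : ∀ η, Continuous fun s => (flow (A η) (t - s)).comp (R s) := fun η =>
    ((continuous_flow _).comp (by fun_prop)).clm_comp hR
  have hb : IntervalIntegrable (fun s => K * ‖R s‖) volume 0 t :=
    Continuous.intervalIntegrable (by fun_prop) _ _
  refine intervalIntegral.continuousAt_of_dominated_interval (bound := fun s => K * ‖R s‖)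
    (Eventually.of_forall fun η => (hint η).aestronglyMeasurable)
    (Eventually.of_forall fun η => Eventually.of_forall fun s hs => ?_) hb
    (Eventually.of_forall fun s _ => ?_)
  · rw [uIoc_of_le ht] at hs
    exact (ContinuousLinearMap.opNorm_comp_le _ _).trans
      (mul_le_mul_of_nonneg_right (hK η _ (by linarith [hs.2])) (norm_nonneg _))
  · have : ContinuousAt (fun η => flow (A η) (t - s)) θ :=
      (continuous_flow_left (t - s)).continuousAt.comp hA
    exact this.clm_comp continuousAt_const

theorem flow_compL_apply (A : V →L[ℝ] V) (t : ℝ) (y : Θ →L[ℝ] V) :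
    flow (ContinuousLinearMap.compL ℝ Θ V V A) t y = (flow A t).comp y := by
  ext v
  exact flow_intertwine (A := ContinuousLinearMap.compL ℝ Θ V V A) (B := A)
    (T := ContinuousLinearMap.apply ℝ V v) (fun _ => rfl) t y

/-- The operator of the equation for a solution and its derivative in the parameter. -/
noncomputable def prolOp (A : Θ → V →L[ℝ] V) (A' : Θ → Θ →L[ℝ] V →L[ℝ] V) (θ : Θ) :
    V × (Θ →L[ℝ] V) →L[ℝ] V × (Θ →L[ℝ] V) :=
  tri (A θ) (A' θ).flip (ContinuousLinearMap.compL ℝ Θ V V (A θ))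

/-- The difference of the solutions at `η` and `θ` solves the `η`-equation, forced by the
coefficient differences along the `θ`-path. It is thus `J η` applied to quantities vanishing at `θ`,
and the exponential need only be continuous, not differentiable, in its generator. -/
theorem hasFDerivAt_affPath_param {A : Θ → V →L[ℝ] V} {A' : Θ → Θ →L[ℝ] V →L[ℝ] V} {a : Θ → V}
    {a' : Θ → Θ →L[ℝ] V} {K : ℝ} (hK : ∀ θ t, 0 ≤ t → ‖flow (A θ) t‖ ≤ K) {θ : Θ}
    (hA : HasFDerivAt A (A' θ) θ) (ha : HasFDerivAt a (a' θ) θ) (u : V) {m : ℝ → V}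
    (hm : Continuous m) {t : ℝ} (ht : 0 ≤ t) :
    HasFDerivAt (fun η => affPath (A η) (a η) u m t)
      (affPath (prolOp A A' θ) (a θ, a' θ) (u, 0) (fun s => (m s, 0)) t).2 θ := by
  have hx := continuous_affPath (A θ) (a θ) u hm
  set x := affPath (A θ) (a θ) u m with hxdef
  set R : ℝ → (V × (V →L[ℝ] V)) →L[ℝ] V := fun s =>
    .fst ℝ V (V →L[ℝ] V) - (ContinuousLinearMap.apply ℝ V (x s)).comp (.snd ℝ V (V →L[ℝ] V)) with hR
  have hRc : Continuous R := by
    refine continuous_const.sub (Continuous.clm_comp ?_ continuous_const)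
    exact (ContinuousLinearMap.continuous _).comp hx
  set J : Θ → (V × (V →L[ℝ] V)) →L[ℝ] V := fun η =>
    ∫ s in (0 : ℝ)..t, (flow (A η) (t - s)).comp (R s) with hJ
  have hint : ∀ η, Continuous fun s => (flow (A η) (t - s)).comp (R s) := fun η =>
    ((continuous_flow _).comp (by fun_prop)).clm_comp hRc
  have hJapp : ∀ η q, J η q = ∫ s in (0 : ℝ)..t, flow (A η) (t - s) (q.1 - q.2 (x s)) := fun η q =>
    ContinuousLinearMap.intervalIntegral_apply ((hint η).intervalIntegrable _ _) q
  have hJc : ContinuousAt J θ := continuousAt_integral_flow_comp hK hA.continuousAt hRc ht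
  have hdiff : ∀ η, affPath (A η) (a η) u m t = x t + J η (a η - a θ, A η - A θ) := fun η => by
    have hxη := continuous_affPath (A η) (a η) u hm
    have h1 := eq_duhamel (A η) (y₀ := 0) (p := fun s => (a η - a θ) - (A η - A θ) (x s))
      (y := fun s => affPath (A η) (a η) u m s - x s) (by fun_prop) (by fun_prop) (fun r hr => by
        rw [affPath_integral_eq (A η) (a η) u hm r, hxdef, affPath_integral_eq (A θ) (a θ) u hm r,
          ← hxdef, zero_add]
        rw [add_sub_add_right_eq_sub, add_sub_add_left_eq_sub, ← intervalIntegral.integral_sub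
          (Continuous.intervalIntegrable (by fun_prop) _ _)
          (Continuous.intervalIntegrable (by fun_prop) _ _)]
        congr 1
        funext s
        simp only [sub_apply, map_sub]
        abel) ht
    rw [hJapp, ← sub_eq_iff_eq_add', h1, map_zero, zero_add]
  have hD : HasFDerivAt (fun η => (a η - a θ, A η - A θ)) ((a' θ).prod (A' θ)) θ :=
    (ha.sub_const _).prodMk (hA.sub_const _)
  have h2 := (hD.clm_apply_of_continuousAt hJc (by simp)).const_add (x t)
  have h3 : (affPath (prolOp A A' θ) (a θ, a' θ) (u, 0) (fun s => (m s, 0)) t).2 =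
      (J θ).comp ((a' θ).prod (A' θ)) := by
    ext η
    rw [prolOp, affPath_tri_snd _ _ _ _ _ _ _ hm ht, map_zero, zero_add]
    have hc : Continuous fun s => flow (ContinuousLinearMap.compL ℝ Θ V V (A θ)) (t - s)
        (a' θ - (A' θ).flip (affPath (A θ) (a θ) u m s)) :=
      continuous_duhamel_integrand _
        (continuous_const.sub ((A' θ).flip.continuous.comp hx)) t
    rw [ContinuousLinearMap.intervalIntegral_apply (hc.intervalIntegrable _ _),
      ContinuousLinearMap.comp_apply, hJapp]
    simp only [flow_compL_apply]
    rfl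
  rw [h3]
  exact h2.congr_of_eventuallyEq (Eventually.of_forall hdiff)

end Prolongation

/-! ### Parameter derivatives of transition operators. -/

section ParamDeriv

variable {Ω : Type*} [MeasurableSpace Ω] {P : Measure Ω} [IsProbabilityMeasure P]
  {ι : Type*} [Fintype ι]
  {Θ : Type*} [NormedAddCommGroup Θ] [NormedSpace ℝ Θ] [FiniteDimensional ℝ Θ]
  {V : Type*} [NormedAddCommGroup V] [NormedSpace ℝ V] [FiniteDimensional ℝ V] [CompleteSpace V]
  [MeasurableSpace V] [BorelSpace V]
  {E : Type*} [NormedAddCommGroup E] [NormedSpace ℝ E] [CompleteSpace E]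
  {A : Θ → V →L[ℝ] V} {A' : Θ → Θ →L[ℝ] V →L[ℝ] V} {a : Θ → V} {a' : Θ → Θ →L[ℝ] V}
  {e : ι → V} {n : ℝ → Ω → V} {K c : ℝ}

/-- The pair consisting of a solution and its derivative in the parameter solves a linear equation
of the same kind. -/
theorem LinFam.prol (h : LinFam P A a e n K c) (hA' : ∀ θ, ‖A' θ‖ ≤ K) (ha' : ∀ θ, ‖a' θ‖ ≤ K) :
    LinFam P (prolOp A A') (fun θ => (a θ, a' θ)) (fun i => (e i, (0 : Θ →L[ℝ] V)))
      (fun t ω => (n t ω, (0 : Θ →L[ℝ] V))) (2 * K + 2 * K ^ 3 / c) (c / 2) := by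
  have hK := h.one_le
  have hc := h.pos
  have hK3 : 0 ≤ 2 * K ^ 3 / c := by positivity
  have hcomp : ∀ B : V →L[ℝ] V, ∀ k : ℝ, 0 ≤ k → ‖B‖ ≤ k →
      ‖ContinuousLinearMap.compL ℝ Θ V V B‖ ≤ k := fun B k hk hB =>
    ContinuousLinearMap.opNorm_le_bound _ hk fun y => (ContinuousLinearMap.opNorm_comp_le _ _).trans
      (mul_le_mul_of_nonneg_right hB (norm_nonneg _))
  refine ⟨by linarith, by positivity, fun θ => ?_, fun θ => ?_, fun i => ?_, fun θ t ht => ?_,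
    h.noise.map (.inl ℝ V (Θ →L[ℝ] V))⟩
  · refine (norm_tri_le (K := K) (h.norm_A θ) ?_ (hcomp _ _ (by linarith) (h.norm_A θ))).trans
      (by linarith)
    rw [ContinuousLinearMap.opNorm_flip]
    exact hA' θ
  · exact (norm_prod_le_iff.2 ⟨h.norm_a θ, ha' θ⟩).trans (by linarith)
  · exact (norm_prod_le_iff.2 ⟨h.norm_e i, by rw [norm_zero]; linarith⟩).trans (by linarith)
  · refine (norm_flow_tri_le (K := K) (by linarith) hc (h.decay θ) (fun s hs => ?_) ?_ ht).trans ?_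
    · refine ContinuousLinearMap.opNorm_le_bound _ (by positivity) fun y => ?_
      rw [flow_compL_apply]
      exact (ContinuousLinearMap.opNorm_comp_le _ _).trans
        (mul_le_mul_of_nonneg_right (h.decay θ s hs) (norm_nonneg _))
    · rw [ContinuousLinearMap.opNorm_flip]
      exact hA' θ
    · exact mul_le_mul_of_nonneg_right (by linarith) (Real.exp_pos _).le

omit [FiniteDimensional ℝ Θ] [FiniteDimensional ℝ V] [CompleteSpace V] [MeasurableSpace V]
  [BorelSpace V] [CompleteSpace E] in
theorem PolyBdd.fderiv_comp {C : ℝ} {N : ℕ} {ψ : V → E} (h : PolyBdd C N (fderiv ℝ ψ)) :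
    PolyBdd C (N + 1) (fun p : V × (Θ →L[ℝ] V) => (fderiv ℝ ψ p.1).comp p.2) := fun p => by
  refine (ContinuousLinearMap.opNorm_comp_le _ _).trans ?_
  have h1 : (1 + ‖p.1‖) ^ N ≤ (1 + ‖p‖) ^ N := by
    have := norm_fst_le p
    gcongr
  have hC := h.nonneg
  rw [pow_succ, ← mul_assoc]
  exact mul_le_mul ((h p.1).trans (mul_le_mul_of_nonneg_left h1 hC))
    ((norm_snd_le p).trans (by linarith)) (norm_nonneg _) (by positivity)

/-- The chain rule along each path, dominated by a power of `pathWeight` uniformly in the parameter.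
As the derivative is a transition operator of the prolonged system started at `(u, 0)`, the moment
and convergence estimates apply to it unchanged. -/
theorem LinFam.hasFDerivAt_transOp_param (h : LinFam P A a e n K c)
    (hA : ∀ θ, HasFDerivAt A (A' θ) θ) (ha : ∀ θ, HasFDerivAt a (a' θ) θ)
    (hA' : ∀ θ, ‖A' θ‖ ≤ K) (ha' : ∀ θ, ‖a' θ‖ ≤ K) {C : ℝ} {N : ℕ} {ψ : V → E}
    (hψ : ContDiff ℝ 1 ψ) (hb : PolyBdd C N ψ) (hb' : PolyBdd C N (fderiv ℝ ψ)) (θ : Θ) (u : V)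
    {t : ℝ} (ht : 0 ≤ t) :
    HasFDerivAt (fun η => transOp P (A η) (a η) n t ψ u)
      (transOp P (prolOp A A' θ) (a θ, a' θ) (fun t ω => (n t ω, (0 : Θ →L[ℝ] V))) t
        (fun p => (fderiv ℝ ψ p.1).comp p.2) (u, 0)) θ := by
  have h2 := h.prol hA' ha'
  have hfst : ∀ η ω, (affPath (prolOp A A' η) (a η, a' η) (u, 0) (fun s => (n s ω, 0)) t).1 =
      affPath (A η) (a η) u (fun s => n s ω) t := fun η ω =>
    map_affPath (T := .fst ℝ V (Θ →L[ℝ] V)) (fun _ => rfl) _ _ (h2.noise.continuous ω) t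
  have hC := hb.nonneg
  refine (hasFDerivAt_integral_of_bound (s := univ)
    (b := fun ω => C * (3 * (2 * K + 2 * K ^ 3 / c) ^ 2 * (1 + t) *
      (1 + ‖(u, (0 : Θ →L[ℝ] V))‖)) ^ (N + 1) *
        pathWeight (fun s => (n s ω, (0 : Θ →L[ℝ] V))) t ^ (N + 1))
    (F := fun η ω => ψ (affPath (A η) (a η) u (fun s => n s ω) t))
    (F' := fun η ω => (fun p => (fderiv ℝ ψ p.1).comp p.2)
      (affPath (prolOp A A' η) (a η, a' η) (u, 0) (fun s => (n s ω, 0)) t))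
    univ_mem (fun η => h.noise.aestronglyMeasurable_comp_affPath _ _ _ _ hψ.continuous)
    (h.integrable_comp θ ht hψ.continuous hb u) (Eventually.of_forall fun ω η _ => ?_)
    ((h2.noise.integrable_pathWeight_pow (N + 1) ht).const_mul _)
    (Eventually.of_forall fun ω η _ => ?_)).2
  · refine (hb'.fderiv_comp _).trans ?_
    rw [mul_assoc, ← mul_pow]
    refine mul_le_mul_of_nonneg_left (pow_le_pow_left₀ (by positivity) ?_ _) hC
    exact h2.norm_affPath_le η _ (h2.noise.continuous ω) ht
  · have h3 := hasFDerivAt_affPath_param (fun θ t ht => h.norm_flow_le θ ht) (hA η) (ha η) u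
      (h.noise.continuous ω) ht
    have h4 := ((hψ.differentiable one_ne_zero) _).hasFDerivAt.comp η h3
    simp only [hfst]
    exact h4

end ParamDeriv

/-! ### Calculus of `C²` functions with polynomial growth. -/

section PolyC2

variable {V : Type*} [NormedAddCommGroup V] [NormedSpace ℝ V]
  {V' : Type*} [NormedAddCommGroup V'] [NormedSpace ℝ V']
  {E : Type*} [NormedAddCommGroup E] [NormedSpace ℝ E]
  {F : Type*} [NormedAddCommGroup F] [NormedSpace ℝ F]
  {G : Type*} [NormedAddCommGroup G] [NormedSpace ℝ G]
  {C D : ℝ} {N M : ℕ}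

namespace PolyC2

theorem of_iteratedFDeriv {ψ : V → E} (hψ : ContDiff ℝ 2 ψ)
    (h : ∀ i ≤ 2, ∀ v, ‖iteratedFDeriv ℝ i ψ v‖ ≤ C * (1 + ‖v‖) ^ N) : PolyC2 C N ψ where
  contDiff := hψ
  bdd v := by simpa using h 0 (by norm_num) v
  bdd_fderiv v := by simpa [norm_iteratedFDeriv_one] using h 1 (by norm_num) v
  bdd_fderiv_fderiv v := by
    rw [← norm_iteratedFDeriv_one, norm_iteratedFDeriv_fderiv]
    exact h 2 le_rfl v

theorem norm_iteratedFDeriv_le {ψ : V → E} (h : PolyC2 C N ψ) {i : ℕ} (hi : i ≤ 2) (v : V) :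
    ‖iteratedFDeriv ℝ i ψ v‖ ≤ C * (1 + ‖v‖) ^ N := by
  interval_cases i
  · simpa using h.bdd v
  · simpa [norm_iteratedFDeriv_one] using h.bdd_fderiv v
  · have := h.bdd_fderiv_fderiv v
    rwa [← norm_iteratedFDeriv_one, norm_iteratedFDeriv_fderiv] at this

theorem clm (T : V →L[ℝ] E) : PolyC2 ‖T‖ 1 T where
  contDiff := T.contDiff
  bdd v := (T.le_opNorm v).trans (mul_le_mul_of_nonneg_left (by simp) (norm_nonneg _))
  bdd_fderiv v := by
    rw [T.fderiv, pow_one]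
    exact le_mul_of_one_le_right (norm_nonneg _) (by simp)
  bdd_fderiv_fderiv v := by
    have : fderiv ℝ (T : V → E) = fun _ => T := funext fun _ => T.fderiv
    rw [this, fderiv_fun_const]
    rw [Pi.zero_apply, norm_zero (E := V →L[ℝ] V →L[ℝ] E)]
    positivity

theorem comp_clm {ψ : V → E} (h : PolyC2 C N ψ) {T : V' →L[ℝ] V} (hT : ‖T‖ ≤ 1) :
    PolyC2 C N (fun v => ψ (T v)) := by
  refine of_iteratedFDeriv (h.contDiff.comp T.contDiff) fun i hi v => ?_
  have h1 : iteratedFDeriv ℝ i (fun v => ψ (T v)) v =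
      (iteratedFDeriv ℝ i ψ (T v)).compContinuousLinearMap fun _ => T :=
    T.iteratedFDeriv_comp_right h.contDiff v (by exact_mod_cast hi)
  have hC := h.bdd.nonneg
  have hTv : ‖T v‖ ≤ ‖v‖ := (T.le_opNorm v).trans (mul_le_of_le_one_left (norm_nonneg _) hT)
  rw [h1]
  refine (ContinuousMultilinearMap.norm_compContinuousLinearMap_le _ _).trans ?_
  refine (mul_le_of_le_one_right (norm_nonneg _) ?_).trans
    ((h.norm_iteratedFDeriv_le hi (T v)).trans ?_)
  · rw [Finset.prod_const]
    exact pow_le_one₀ (norm_nonneg _) hT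
  · gcongr

theorem bilin (B : E →L[ℝ] F →L[ℝ] G) {φ : V → E} {ψ : V → F} (hφ : PolyC2 C N φ)
    (hψ : PolyC2 D M ψ) : PolyC2 (4 * ‖B‖ * C * D) (N + M) (fun v => B (φ v) (ψ v)) := by
  have hC := hφ.bdd.nonneg
  have hD := hψ.bdd.nonneg
  refine of_iteratedFDeriv ((B.contDiff.comp hφ.contDiff).clm_apply hψ.contDiff) fun i hi v => ?_
  refine (B.norm_iteratedFDeriv_le_of_bilinear hφ.contDiff hψ.contDiff v
    (by exact_mod_cast hi)).trans ?_
  have h2 : ∑ j ∈ Finset.range (i + 1), (i.choose j : ℝ) * ‖iteratedFDeriv ℝ j φ v‖ *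
      ‖iteratedFDeriv ℝ (i - j) ψ v‖ ≤
      ∑ j ∈ Finset.range (i + 1), (i.choose j : ℝ) * ((C * (1 + ‖v‖) ^ N) * (D * (1 + ‖v‖) ^ M)) := by
    refine Finset.sum_le_sum fun j hj => ?_
    rw [mul_assoc]
    refine mul_le_mul_of_nonneg_left (mul_le_mul (hφ.norm_iteratedFDeriv_le ?_ v)
      (hψ.norm_iteratedFDeriv_le (by omega) v) (norm_nonneg _) (by positivity)) (by positivity)
    have := Finset.mem_range.1 hj
    omega
  -- The binomial coefficients sum to `2 ^ i`, at most `4` for orders up to two.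
  have h3 : (∑ j ∈ Finset.range (i + 1), (i.choose j : ℝ)) ≤ 4 := by
    rw [← Nat.cast_sum, Nat.sum_range_choose]
    interval_cases i <;> norm_num
  rw [← Finset.sum_mul] at h2
  calc _ ≤ ‖B‖ * (4 * ((C * (1 + ‖v‖) ^ N) * (D * (1 + ‖v‖) ^ M))) :=
        mul_le_mul_of_nonneg_left (h2.trans (mul_le_mul_of_nonneg_right h3 (by positivity)))
          (norm_nonneg B)
    _ = _ := by rw [pow_add]; ring

theorem clm_comp (L : E →L[ℝ] F) {φ : V → E} (hφ : PolyC2 C N φ) :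
    PolyC2 (‖L‖ * C) N (fun v => L (φ v)) :=
  of_iteratedFDeriv (L.contDiff.comp hφ.contDiff) fun i hi v =>
    (L.norm_iteratedFDeriv_comp_left hφ.contDiff.contDiffAt (by exact_mod_cast hi)).trans (by
      rw [mul_assoc]
      exact mul_le_mul_of_nonneg_left (hφ.norm_iteratedFDeriv_le hi v) (norm_nonneg _))

theorem sub_const {φ : V → E} (hφ : PolyC2 C N φ) (x : E) :
    PolyC2 (C + ‖x‖) N (fun v => φ v - x) := by
  have h1 : fderiv ℝ (fun v => φ v - x) = fderiv ℝ φ := funext fun v => fderiv_sub_const x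
  have hle : C ≤ C + ‖x‖ := by linarith [norm_nonneg x]
  refine ⟨hφ.contDiff.sub contDiff_const, fun v => ?_, ?_, ?_⟩
  · refine (norm_sub_le _ _).trans ?_
    rw [add_mul]
    exact add_le_add (hφ.bdd v) (le_mul_of_one_le_right (norm_nonneg _)
      (one_le_pow₀ (by linarith [norm_nonneg v])))
  · rw [h1]; exact hφ.bdd_fderiv.mono hle le_rfl
  · rw [h1]; exact hφ.bdd_fderiv_fderiv.mono hle le_rfl

end PolyC2

end PolyC2

/-! ### Stationary distributions: moments and exponential ergodicity. -/

section Invariant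

variable {Ω : Type*} [MeasurableSpace Ω] {P : Measure Ω} [IsProbabilityMeasure P]
  {ι : Type*} [Fintype ι] {Θ : Type*}
  {V : Type*} [NormedAddCommGroup V] [NormedSpace ℝ V] [FiniteDimensional ℝ V] [CompleteSpace V]
  [MeasurableSpace V] [BorelSpace V]
  {E : Type*} [NormedAddCommGroup E] [NormedSpace ℝ E] [CompleteSpace E]
  {e : ι → V} {n n' : ℝ → Ω → V}

theorem IsCenteredGaussian.map_unique {N N' : Ω → V} {q : StrongDual ℝ V → ℝ}
    (h : IsCenteredGaussian P N q) (h' : IsCenteredGaussian P N' q) : P.map N = P.map N' := by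
  have := FiniteDimensional.proper ℝ V
  have := Measure.isProbabilityMeasure_map (μ := P) h.measurable.aemeasurable
  have := Measure.isProbabilityMeasure_map (μ := P) h'.measurable.aemeasurable
  refine Measure.ext_of_charFunDual (funext fun L => ?_)
  have hc : Continuous fun v : V => Complex.exp (L v * Complex.I) := by fun_prop
  rw [charFunDual_apply, charFunDual_apply, integral_map h.measurable.aemeasurable
    hc.aestronglyMeasurable, integral_map h'.measurable.aemeasurable hc.aestronglyMeasurable,
    h.charFun, h'.charFun]

/-- The transition operators depend on the law of the noise only. -/
theorem IsNoise.transOp_congr (h : IsNoise P e n) (h' : IsNoise P e n') (A : V →L[ℝ] V) (a : V)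
    {t : ℝ} (ht : 0 ≤ t) {ψ : V → E} (hψ : Continuous ψ) (u : V) :
    transOp P A a n t ψ u = transOp P A a n' t ψ u := by
  have hN := h.isCenteredGaussian_affPath A ht
  have hN' := h'.isCenteredGaussian_affPath A ht
  have hc : Continuous fun v => ψ (flow A t u + (∫ s in (0 : ℝ)..t, flow A s a) + v) := by fun_prop
  unfold transOp
  simp only [fun ω => affPath_eq_add A a u (h.continuous ω) t,
    fun ω => affPath_eq_add A a u (h'.continuous ω) t]
  rw [← integral_map (f := fun v => ψ (flow A t u + (∫ s in (0 : ℝ)..t, flow A s a) + v))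
    hN.measurable.aemeasurable hc.aestronglyMeasurable, hN.map_unique hN',
    integral_map hN'.measurable.aemeasurable hc.aestronglyMeasurable]

/-- `ν` is a stationary distribution of the equation `dU = (a - A U) dt + dn`. -/
structure IsInvariantDist (P : Measure Ω) (A : V →L[ℝ] V) (a : V) (n : ℝ → Ω → V) (ν : Measure V) :
    Prop where
  isProbabilityMeasure : IsProbabilityMeasure ν
  invariant : ∀ t, 0 ≤ t → ∀ B, MeasurableSet B →
    ∫⁻ x, P {ω | affPath A a x (fun s => n s ω) t ∈ B} ∂ν = ν B

theorem IsNoise.measurable_affPath_initial (h : IsNoise P e n) (A : V →L[ℝ] V) (a : V) (t : ℝ) :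
    Measurable fun p : V × Ω => affPath A a p.1 (fun s => n s p.2) t :=
  (h.stronglyMeasurable_comp_affPath A a continuous_id).measurable.comp
    ((measurable_const.prodMk measurable_fst).prodMk measurable_snd : Measurable
      fun p : V × Ω => ((t, p.1), p.2))

variable {A : Θ → V →L[ℝ] V} {a : Θ → V} {K c : ℝ}

theorem IsInvariantDist.map_eq {A : V →L[ℝ] V} {a : V} {ν : Measure V} (hν : IsInvariantDist P A a n ν)
    (h : IsNoise P e n) {t : ℝ} (ht : 0 ≤ t) :
    (ν.prod P).map (fun p : V × Ω => affPath A a p.1 (fun s => n s p.2) t) = ν := by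
  have := hν.isProbabilityMeasure
  refine Measure.ext fun B hB => ?_
  rw [Measure.map_apply (h.measurable_affPath_initial A a t) hB,
    Measure.prod_apply (h.measurable_affPath_initial A a t hB), ← hν.invariant t ht B hB]
  rfl

/-- Invariance cannot be integrated against an unbounded weight before its integrability is known,
so the weight is truncated at `R`. The solution splits into one started at `0`, with uniform
moments, and `flow (A θ) t` applied to the initial value. With `R` fixed, letting `t → ∞` removes
the latter by dominated convergence; then `R → ∞`. -/
theorem LinFam.exists_invariant_moment (h : LinFam P A a e n K c) (p : ℕ) : ∃ M : ℝ, 0 ≤ M ∧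
    ∀ θ ν, IsInvariantDist P (A θ) (a θ) n ν → Integrable (fun v => (1 + ‖v‖) ^ (p + 1)) ν ∧
      ∫ v, (1 + ‖v‖) ^ (p + 1) ∂ν ≤ M := by
  have hK := h.one_le
  have hmom := h.mom_nonneg (p + 1)
  set M := 2 ^ p * h.mom (p + 1) with hM
  have hM0 : 0 ≤ M := by positivity
  refine ⟨M, hM0, fun θ ν hν => ?_⟩
  have := hν.isProbabilityMeasure
  set w : V → ENNReal := fun v => ENNReal.ofReal ((1 + ‖v‖) ^ (p + 1)) with hw
  have hwm : Measurable w := (by fun_prop : Continuous fun v : V => (1 + ‖v‖) ^ (p + 1)).measurable.ennreal_ofReal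
  have key : ∀ (R : ℕ) (t : ℝ), 0 ≤ t → ∫⁻ v, min (w v) R ∂ν ≤ ENNReal.ofReal M +
      ∫⁻ v, min (ENNReal.ofReal (2 ^ p * (K * Real.exp (-c * t) * ‖v‖) ^ (p + 1))) R ∂ν := by
    intro R t ht
    obtain ⟨b, hbi, hbM, hle⟩ := h.exists_dominating (p + 1) θ ht
    have hb0 : ∀ ω, 0 ≤ b ω := fun ω => by
      have := hle 0 ω
      simp only [norm_zero, add_zero, one_pow, mul_one] at this
      exact le_trans (by positivity) this
    conv_lhs => rw [← hν.map_eq h.noise ht]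
    rw [lintegral_map (hwm.min measurable_const) (h.noise.measurable_affPath_initial _ _ t)]
    have hpt : ∀ q : V × Ω, min (w (affPath (A θ) (a θ) q.1 (fun s => n s q.2) t)) R ≤
        ENNReal.ofReal (2 ^ p * b q.2) +
        min (ENNReal.ofReal (2 ^ p * (K * Real.exp (-c * t) * ‖q.1‖) ^ (p + 1))) R := by
      intro q
      have e1 : affPath (A θ) (a θ) q.1 (fun s => n s q.2) t =
          affPath (A θ) (a θ) 0 (fun s => n s q.2) t + flow (A θ) t q.1 := by
        rw [affPath_eq_add _ (a θ) q.1 (h.noise.continuous q.2), affPath_eq_add _ (a θ) 0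
          (h.noise.continuous q.2), map_zero]
        abel
      have e2 : 1 + ‖affPath (A θ) (a θ) q.1 (fun s => n s q.2) t‖ ≤
          (1 + ‖affPath (A θ) (a θ) 0 (fun s => n s q.2) t‖) + K * Real.exp (-c * t) * ‖q.1‖ := by
        rw [e1, add_assoc]
        gcongr
        exact (norm_add_le _ _).trans (add_le_add le_rfl ((ContinuousLinearMap.le_opNorm _ _).trans
          (mul_le_mul_of_nonneg_right (h.decay θ t ht) (norm_nonneg _))))
      have e3 : (1 + ‖affPath (A θ) (a θ) q.1 (fun s => n s q.2) t‖) ^ (p + 1) ≤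
          2 ^ p * b q.2 + 2 ^ p * (K * Real.exp (-c * t) * ‖q.1‖) ^ (p + 1) := by
        refine (pow_le_pow_left₀ (by positivity) e2 _).trans
          ((add_pow_le (by positivity) (by positivity) _).trans ?_)
        have := hle 0 q.2
        simp only [norm_zero, add_zero, one_pow, mul_one] at this
        rw [Nat.add_sub_cancel, mul_add]
        gcongr
      have e4 := ENNReal.ofReal_le_ofReal e3
      rw [ENNReal.ofReal_add (mul_nonneg (by positivity) (hb0 _)) (by positivity)] at e4
      refine (min_le_min_right _ e4).trans ?_
      rw [← min_add_add_left]
      exact min_le_min le_rfl le_add_self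
    refine (lintegral_mono hpt).trans ?_
    have hbm : AEMeasurable (fun q : V × Ω => ENNReal.ofReal (2 ^ p * b q.2)) (ν.prod P) :=
      ((hbi.aestronglyMeasurable.aemeasurable.comp_quasiMeasurePreserving
        Measure.quasiMeasurePreserving_snd).const_mul _).ennreal_ofReal
    have hmm : Measurable fun v : V =>
        min (ENNReal.ofReal (2 ^ p * (K * Real.exp (-c * t) * ‖v‖) ^ (p + 1))) (R : ENNReal) :=
      (by fun_prop : Continuous fun v : V =>
        2 ^ p * (K * Real.exp (-c * t) * ‖v‖) ^ (p + 1)).measurable.ennreal_ofReal.min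
          measurable_const
    have hmm2 : ∫⁻ q : V × Ω, min (ENNReal.ofReal
        (2 ^ p * (K * Real.exp (-c * t) * ‖q.1‖) ^ (p + 1))) (R : ENNReal) ∂(ν.prod P) =
        ∫⁻ v, ∫⁻ _, min (ENNReal.ofReal
          (2 ^ p * (K * Real.exp (-c * t) * ‖v‖) ^ (p + 1))) (R : ENNReal) ∂P ∂ν :=
      lintegral_prod _ (hmm.comp measurable_fst).aemeasurable
    rw [lintegral_add_left' hbm, lintegral_prod _ hbm, hmm2]
    simp only [lintegral_const, measure_univ, mul_one]
    gcongr
    rw [← ofReal_integral_eq_lintegral_ofReal (hbi.const_mul _)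
      (Eventually.of_forall fun ω => mul_nonneg (by positivity) (hb0 ω)), integral_const_mul]
    exact ENNReal.ofReal_le_ofReal (mul_le_mul_of_nonneg_left hbM (by positivity))
  have hlim : ∀ R : ℕ, Tendsto (fun k : ℕ => ∫⁻ v,
      min (ENNReal.ofReal (2 ^ p * (K * Real.exp (-c * k) * ‖v‖) ^ (p + 1))) R ∂ν) atTop (𝓝 0) := by
    intro R
    rw [← lintegral_zero (μ := ν)]
    refine tendsto_lintegral_of_dominated_convergence (fun _ => (R : ENNReal)) (fun k => ?_)
      (fun k => Eventually.of_forall fun v => min_le_right _ _) (by simp)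
      (Eventually.of_forall fun v => ?_)
    · exact (by fun_prop : Continuous fun v : V =>
        2 ^ p * (K * Real.exp (-c * k) * ‖v‖) ^ (p + 1)).measurable.ennreal_ofReal.min
          measurable_const
    · have e0 : Tendsto (fun k : ℕ => Real.exp (-c * k)) atTop (𝓝 0) := by
        refine Real.tendsto_exp_atBot.comp ?_
        exact tendsto_natCast_atTop_atTop.const_mul_atTop_of_neg (by linarith [h.pos])
      have e1 : Tendsto (fun k : ℕ => 2 ^ p * (K * Real.exp (-c * k) * ‖v‖) ^ (p + 1)) atTop
          (𝓝 (2 ^ p * (K * 0 * ‖v‖) ^ (p + 1))) :=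
        (((e0.const_mul K).mul_const _).pow _).const_mul _
      have e2 := (ENNReal.tendsto_ofReal e1).min (tendsto_const_nhds (x := (R : ENNReal)))
      simpa using e2
  have hR : ∀ R : ℕ, ∫⁻ v, min (w v) R ∂ν ≤ ENNReal.ofReal M := fun R => by
    have := (hlim R).const_add (ENNReal.ofReal M)
    rw [add_zero] at this
    exact ge_of_tendsto' this fun k => key R k (by positivity)
  have hfin : ∫⁻ v, w v ∂ν ≤ ENNReal.ofReal M := by
    refine le_of_tendsto' (lintegral_tendsto_of_tendsto_of_monotone (μ := ν)
      (f := fun (R : ℕ) v => min (w v) R) (fun R => (hwm.min measurable_const).aemeasurable)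
      (Eventually.of_forall fun v R R' hRR' => min_le_min le_rfl (by exact_mod_cast hRR'))
      (Eventually.of_forall fun v => ?_)) hR
    obtain ⟨R, hR⟩ := ENNReal.exists_nat_gt (ENNReal.ofReal_ne_top (r := (1 + ‖v‖) ^ (p + 1)))
    refine tendsto_const_nhds.congr' ?_
    filter_upwards [eventually_ge_atTop R] with k hk
    exact (min_eq_left (hR.le.trans (by exact_mod_cast hk))).symm
  have hcont : Continuous fun v : V => (1 + ‖v‖) ^ (p + 1) := by fun_prop
  have hint : Integrable (fun v : V => (1 + ‖v‖) ^ (p + 1)) ν := by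
    refine ⟨hcont.aestronglyMeasurable, ?_⟩
    rw [hasFiniteIntegral_iff_ofReal (Eventually.of_forall fun v => by positivity)]
    exact hfin.trans_lt ENNReal.ofReal_lt_top
  refine ⟨hint, ?_⟩
  rw [integral_eq_lintegral_of_nonneg_ae (Eventually.of_forall fun v => by positivity)
    hcont.aestronglyMeasurable]
  exact ENNReal.toReal_le_of_le_ofReal hM0 hfin

/-- Integrals over a stationary distribution, and the exponential convergence to it. -/
theorem LinFam.exists_ergodic (h : LinFam P A a e n K c) (N : ℕ) : ∃ M : ℝ, 0 ≤ M ∧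
    ∀ (C : ℝ) (ψ : V → E), PolyC2 C N ψ → ∀ θ ν, IsInvariantDist P (A θ) (a θ) n ν →
      Integrable ψ ν ∧ ‖∫ v, ψ v ∂ν‖ ≤ C * M ∧ ∀ t, 0 ≤ t → ∀ u,
        ‖transOp P (A θ) (a θ) n t ψ u - ∫ v, ψ v ∂ν‖ ≤
          C * M * Real.exp (-c * t) * (1 + ‖u‖) ^ (N + 1) := by
  obtain ⟨M, hM, hMb⟩ := h.exists_invariant_moment N
  have hK := h.one_le
  have hmom := h.mom_nonneg N
  refine ⟨max M (K ^ 2 * h.mom N * M), le_max_of_le_left hM, fun C ψ hψ θ ν hν => ?_⟩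
  have := hν.isProbabilityMeasure
  have hC := hψ.bdd.nonneg
  obtain ⟨hi, hle⟩ := hMb θ ν hν
  have hcψ := hψ.contDiff.continuous
  have hb : ∀ v, ‖ψ v‖ ≤ C * (1 + ‖v‖) ^ (N + 1) := hψ.bdd.mono le_rfl (Nat.le_succ N)
  have hint : Integrable ψ ν := (hi.const_mul C).mono' hcψ.aestronglyMeasurable
    (Eventually.of_forall hb)
  refine ⟨hint, ?_, fun t ht u => ?_⟩
  · refine (norm_integral_le_of_norm_le (hi.const_mul C) (Eventually.of_forall hb)).trans ?_
    rw [integral_const_mul]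
    exact mul_le_mul_of_nonneg_left (hle.trans (le_max_left _ _)) hC
  · have hmeas := h.noise.measurable_affPath_initial (A θ) (a θ) t
    -- Since the mean of `ψ` is also the mean of `T_t ψ`, the distance to equilibrium is an average
    -- of coupling estimates.
    have hinv : ∫ v, ψ v ∂ν = ∫ x, transOp P (A θ) (a θ) n t ψ x ∂ν := by
      have hi2 : Integrable (fun q : V × Ω => ψ (affPath (A θ) (a θ) q.1 (fun s => n s q.2) t))
          (ν.prod P) := by
        refine (integrable_map_measure (f := fun q : V × Ω =>
          affPath (A θ) (a θ) q.1 (fun s => n s q.2) t) hcψ.aestronglyMeasurable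
          hmeas.aemeasurable).1 ?_
        rw [hν.map_eq h.noise ht]
        exact hint
      conv_lhs => rw [← hν.map_eq h.noise ht]
      rw [integral_map hmeas.aemeasurable hcψ.aestronglyMeasurable, integral_prod _ hi2]
      rfl
    have hTi : Integrable (transOp P (A θ) (a θ) n t ψ) ν := by
      refine (hi.const_mul (C * h.mom N)).mono'
        (h.transOp_polyC2 θ ht hψ).1.continuous.aestronglyMeasurable
        (Eventually.of_forall fun v => (h.norm_transOp_le θ ht hψ.bdd v).trans ?_)
      refine mul_le_mul_of_nonneg_left (pow_le_pow_right₀ ?_ (Nat.le_succ N)) (by positivity)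
      linarith [norm_nonneg v]
    have e1 : transOp P (A θ) (a θ) n t ψ u - ∫ v, ψ v ∂ν =
        ∫ x, (transOp P (A θ) (a θ) n t ψ u - transOp P (A θ) (a θ) n t ψ x) ∂ν := by
      rw [integral_sub (integrable_const _) hTi, hinv]
      simp
    rw [e1]
    refine (norm_integral_le_of_norm_le ((hi.mul_const ((1 + ‖u‖) ^ (N + 1))).const_mul
      (K ^ 2 * C * h.mom N * Real.exp (-c * t)))
      (Eventually.of_forall fun x => h.norm_transOp_sub_le θ ht hψ x u)).trans ?_
    rw [integral_const_mul, integral_mul_const]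
    calc K ^ 2 * C * h.mom N * Real.exp (-c * t) * ((∫ x, (1 + ‖x‖) ^ (N + 1) ∂ν) *
          (1 + ‖u‖) ^ (N + 1))
        ≤ K ^ 2 * C * h.mom N * Real.exp (-c * t) * (M * (1 + ‖u‖) ^ (N + 1)) := by gcongr
      _ = C * (K ^ 2 * h.mom N * M) * Real.exp (-c * t) * (1 + ‖u‖) ^ (N + 1) := by ring
      _ ≤ _ := by
        gcongr
        exact le_max_right _ _

end Invariant

/-! ### Differentiability of exponentially convergent limits. -/

section Limit

/-- The derivatives are Cauchy uniformly in `θ`, so differentiation passes to the limit; only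
integer times are needed for this. Applied to the transition operators, it differentiates the
stationary mean without differentiating the stationary measure. -/
theorem exists_hasFDerivAt_of_exp_cauchy {Θ F : Type*} [NormedAddCommGroup Θ] [NormedSpace ℝ Θ]
    [NormedAddCommGroup F] [NormedSpace ℝ F] [CompleteSpace F] {r : ℝ → Θ → F} {m : Θ → F}
    {r' : ℝ → Θ → Θ →L[ℝ] F} {B c : ℝ} (hc : 0 < c)
    (hr : ∀ t, 0 ≤ t → ∀ θ, HasFDerivAt (r t) (r' t θ) θ)
    (hm : ∀ θ, Tendsto (fun t => r t θ) atTop (𝓝 (m θ)))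
    (hr' : ∀ s t, 0 ≤ s → 0 ≤ t → ∀ θ, ‖r' (s + t) θ - r' t θ‖ ≤ B * Real.exp (-c * t)) :
    ∃ m' : Θ → Θ →L[ℝ] F, (∀ θ, HasFDerivAt m (m' θ) θ) ∧
      ∀ t, 0 ≤ t → ∀ θ, ‖r' t θ - m' θ‖ ≤ B * Real.exp (-c * t) := by
  have hexp : Tendsto (fun k : ℕ => B * Real.exp (-c * k)) atTop (𝓝 0) := by
    rw [← mul_zero B]
    exact (Real.tendsto_exp_atBot.comp
      (tendsto_natCast_atTop_atTop.const_mul_atTop_of_neg (by linarith))).const_mul B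
  have hcauchy : ∀ θ, CauchySeq fun k : ℕ => r' k θ := fun θ => by
    refine cauchySeq_of_le_tendsto_0' _ (fun k l hkl => ?_) hexp
    have := hr' ((l : ℝ) - k) k (by simpa using hkl) (by positivity) θ
    rw [sub_add_cancel] at this
    rw [dist_comm, dist_eq_norm (r' l θ) (r' k θ)]
    exact this
  choose m' hm' using fun θ => cauchySeq_tendsto_of_complete (hcauchy θ)
  have hle : ∀ t, 0 ≤ t → ∀ θ, ‖r' t θ - m' θ‖ ≤ B * Real.exp (-c * t) := fun t ht θ => by
    have h1 : Tendsto (fun k : ℕ => ‖r' k θ - r' t θ‖) atTop (𝓝 ‖m' θ - r' t θ‖) :=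
      ((hm' θ).sub_const (r' t θ)).norm
    rw [norm_sub_rev (r' t θ) (m' θ)]
    refine le_of_tendsto h1 ?_
    filter_upwards [tendsto_natCast_atTop_atTop.eventually_ge_atTop t] with k hk
    have := hr' ((k : ℝ) - t) t (by linarith) ht θ
    rwa [sub_add_cancel] at this
  refine ⟨m', fun θ => ?_, hle⟩
  refine hasFDerivAt_of_tendstoUniformlyOnFilter (l := atTop) (f := fun k : ℕ => r k)
    (f' := fun k : ℕ => r' k) ?_ (Eventually.of_forall fun q => hr _ (by positivity) _)
    (Eventually.of_forall fun η => (hm η).comp tendsto_natCast_atTop_atTop)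
  refine TendstoUniformly.tendstoUniformlyOnFilter ?_ |>.mono_right le_top
  rw [Metric.tendstoUniformly_iff]
  intro ε hε
  filter_upwards [(hexp.eventually (gt_mem_nhds hε))] with k hk θ
  rw [dist_comm, dist_eq_norm (r' k θ) (m' θ)]
  exact (hle k (by positivity) θ).trans_lt hk

end Limit

/-! ### The potential of a centred product and its parameter derivative. -/

section ProductPotential

variable {Ω : Type*} [MeasurableSpace Ω] {P : Measure Ω} [IsProbabilityMeasure P]
  {ι : Type*} [Fintype ι]
  {Θ : Type*} [NormedAddCommGroup Θ] [NormedSpace ℝ Θ] [FiniteDimensional ℝ Θ]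
  {V : Type*} [NormedAddCommGroup V] [NormedSpace ℝ V] [FiniteDimensional ℝ V] [CompleteSpace V]
  [MeasurableSpace V] [BorelSpace V]
  {F : Type*} [NormedAddCommGroup F] [NormedSpace ℝ F] [CompleteSpace F]
  {A : Θ → V →L[ℝ] V} {A' : Θ → Θ →L[ℝ] V →L[ℝ] V} {a : Θ → V} {a' : Θ → Θ →L[ℝ] V}
  {e : ι → V} {n : ℝ → Ω → V} {K c : ℝ}

/-- Decay and differentiability in the parameter of the potential of a centred function
`(φ - m) • ψ`, when the transition operators act separately on the two factors. -/
theorem LinFam.exists_product_potential (h : LinFam P A a e n K c)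
    (hA : ∀ θ, HasFDerivAt A (A' θ) θ) (ha : ∀ θ, HasFDerivAt a (a' θ) θ)
    (hA' : ∀ θ, ‖A' θ‖ ≤ K) (ha' : ∀ θ, ‖a' θ‖ ≤ K) {C B : ℝ} {N M : ℕ} {φ : V → ℝ} {ψ : V → F}
    {m : Θ → ℝ} (hφ : PolyC2 C N φ)
    (hφ' : PolyC2 C N (fun p : V × (Θ →L[ℝ] V) => (fderiv ℝ φ p.1).comp p.2))
    (hψ : PolyC2 C N ψ)
    (hm : ∀ θ t, 0 ≤ t → ∀ u, ‖transOp P (A θ) (a θ) n t φ u - m θ‖ ≤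
      B * Real.exp (-c * t) * (1 + ‖u‖) ^ M)
    (hfac : ∀ θ t, 0 ≤ t → ∀ u, transOp P (A θ) (a θ) n t (fun v => φ v • ψ v) u =
      transOp P (A θ) (a θ) n t φ u • transOp P (A θ) (a θ) n t ψ u) :
    ∃ (D : ℝ) (N' : ℕ), 0 ≤ D ∧
      (∀ θ t, 0 ≤ t → ∀ u, ‖transOp P (A θ) (a θ) n t (fun v => (φ v - m θ) • ψ v) u‖ ≤
        D * Real.exp (-c * t) * (1 + ‖u‖) ^ N') ∧
      ∀ θ u, ∃ F' : Θ →L[ℝ] F, ‖F'‖ ≤ D * (1 + ‖u‖) ^ N' ∧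
        HasFDerivAt (fun η => ∫ t in Ioi (0 : ℝ),
          transOp P (A η) (a η) n t (fun v => (φ v - m η) • ψ v) u) F' θ := by
  have hC := hφ.bdd.nonneg
  have hc := h.pos
  have hB : 0 ≤ B := by simpa using (norm_nonneg _).trans (hm 0 0 le_rfl 0)
  set h4 := h.prol hA' ha'
  set K4 := 2 * K + 2 * K ^ 3 / c
  have hM0 := h.mom_nonneg N
  have hM1 := h4.mom_nonneg N
  have hM2 := h4.mom_nonneg (N + 1)
  have hexp1 : ∀ t, 0 ≤ t → Real.exp (-c * t) ≤ Real.exp (-(c / 2) * t) := fun t ht => by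
    rw [Real.exp_le_exp]; nlinarith
  -- the bound for all factors
  set S := B + C * h.mom N + K4 ^ 2 * C * h4.mom N * h4.mom (N + 1) + C * h4.mom (N + 1) with hS
  have hS1 : B ≤ S := by
    have : 0 ≤ C * h.mom N + K4 ^ 2 * C * h4.mom N * h4.mom (N + 1) + C * h4.mom (N + 1) := by
      positivity
    linarith
  have hS2 : C * h.mom N ≤ S := by
    have : 0 ≤ B + K4 ^ 2 * C * h4.mom N * h4.mom (N + 1) + C * h4.mom (N + 1) := by positivity
    linarith
  have hS3 : K4 ^ 2 * C * h4.mom N * h4.mom (N + 1) ≤ S := by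
    have : 0 ≤ B + C * h.mom N + C * h4.mom (N + 1) := by positivity
    linarith
  have hS4 : C * h4.mom (N + 1) ≤ S := by
    have : 0 ≤ B + C * h.mom N + K4 ^ 2 * C * h4.mom N * h4.mom (N + 1) := by positivity
    linarith
  have hS0 : 0 ≤ S := hB.trans hS1
  -- Large enough for all exponents that occur: `M`, `N`, `N + 1` and `2 * (N + 1)`.
  set q := M + 2 * (N + 1) with hq
  have hw : ∀ (u : V) (k : ℕ), k ≤ q → (1 + ‖u‖) ^ k ≤ (1 + ‖u‖) ^ q := fun u k hk =>
    pow_le_pow_right₀ (by linarith [norm_nonneg u]) hk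
  -- Centring commutes with the factorisation, so one factor decays and the other stays bounded in
  -- time.
  have hT : ∀ θ t, 0 ≤ t → ∀ u, transOp P (A θ) (a θ) n t (fun v => (φ v - m θ) • ψ v) u =
      (transOp P (A θ) (a θ) n t φ u - m θ) • transOp P (A θ) (a θ) n t ψ u := by
    intro θ t ht u
    have hprod : PolyBdd (C * C) (N + N) (fun v => φ v • ψ v) := fun v => by
      rw [norm_smul, pow_add]
      calc _ ≤ (C * (1 + ‖v‖) ^ N) * (C * (1 + ‖v‖) ^ N) :=
            mul_le_mul (hφ.bdd v) (hψ.bdd v) (norm_nonneg _) (by positivity)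
        _ = _ := by ring
    have i1 := h.integrable_comp θ ht (hφ.contDiff.continuous.smul hψ.contDiff.continuous) hprod u
    have i2 := h.integrable_comp θ ht hψ.contDiff.continuous hψ.bdd u
    rw [sub_smul, ← hfac θ t ht u]
    unfold transOp
    simp only [sub_smul]
    exact (integral_sub i1 (i2.smul (m θ))).trans (congrArg _ (integral_smul _ _))
  have hp : ∀ θ t, 0 ≤ t → ∀ u, ‖transOp P (A θ) (a θ) n t φ u - m θ‖ ≤
      S * (1 + ‖u‖) ^ q * Real.exp (-c * t) := fun θ t ht u => (hm θ t ht u).trans (by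
    rw [mul_right_comm]
    have := hw u M (by omega)
    gcongr)
  have hQ : ∀ θ t, 0 ≤ t → ∀ u, ‖transOp P (A θ) (a θ) n t ψ u‖ ≤ S * (1 + ‖u‖) ^ q :=
    fun θ t ht u => (h.norm_transOp_le θ ht hψ.bdd u).trans (by
      have := hw u N (by omega)
      gcongr)
  have hQ' : ∀ θ t, 0 ≤ t → ∀ u, ‖transOp P (prolOp A A' θ) (a θ, a' θ)
      (fun t ω => (n t ω, (0 : Θ →L[ℝ] V))) t (fun p => (fderiv ℝ ψ p.1).comp p.2) (u, 0)‖ ≤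
      S * (1 + ‖u‖) ^ q := fun θ t ht u => by
    have h1 := h4.norm_transOp_le θ ht (hψ.bdd_fderiv.fderiv_comp (Θ := Θ)) (u, 0)
    have h2 : ‖(u, (0 : Θ →L[ℝ] V))‖ = ‖u‖ := by simp [Prod.norm_def]
    rw [h2] at h1
    refine h1.trans ?_
    have := hw u (N + 1) (by omega)
    gcongr
  -- The `θ`-derivative of `T_t φ` is a transition operator of the prolonged system, hence
  -- exponentially Cauchy. This is the step that needs two derivatives of `p ↦ Dφ(p.1) p.2`.
  have hlim : ∀ u, ∃ m' : Θ → Θ →L[ℝ] ℝ, (∀ θ, HasFDerivAt m (m' θ) θ) ∧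
      ∀ t, 0 ≤ t → ∀ θ, ‖transOp P (prolOp A A' θ) (a θ, a' θ)
        (fun t ω => (n t ω, (0 : Θ →L[ℝ] V))) t (fun p => (fderiv ℝ φ p.1).comp p.2) (u, 0) - m' θ‖
        ≤ S * (1 + ‖u‖) ^ q * Real.exp (-(c / 2) * t) := fun u => by
    refine exists_hasFDerivAt_of_exp_cauchy (c := c / 2)
      (r := fun t θ => transOp P (A θ) (a θ) n t φ u) (by positivity)
      (fun t ht θ => h.hasFDerivAt_transOp_param hA ha hA' ha' (hφ.contDiff.of_le (by norm_num))
        hφ.bdd hφ.bdd_fderiv θ u ht) (fun θ => ?_) (fun s t hs ht θ => ?_)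
    · rw [tendsto_iff_norm_sub_tendsto_zero]
      refine squeeze_zero' (Eventually.of_forall fun _ => norm_nonneg _)
        ((eventually_ge_atTop 0).mono fun t ht => hp θ t ht u) ?_
      rw [← mul_zero (S * (1 + ‖u‖) ^ q)]
      exact (Real.tendsto_exp_atBot.comp
        (tendsto_id.const_mul_atTop_of_neg (by linarith))).const_mul _
    · have h1 := h4.norm_transOp_add_sub_le θ hs ht hφ' (u, 0)
      have h2 : ‖(u, (0 : Θ →L[ℝ] V))‖ = ‖u‖ := by simp [Prod.norm_def]
      rw [h2, mul_right_comm] at h1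
      refine h1.trans ?_
      have := hw u (2 * (N + 1)) (by omega)
      gcongr
  refine ⟨max (S * S) (2 * (S * S) / (c / 2)), q + q, le_max_of_le_left (by positivity),
    fun θ t ht u => ?_, fun θ u => ?_⟩
  · rw [hT θ t ht u, norm_smul]
    calc _ ≤ (S * (1 + ‖u‖) ^ q * Real.exp (-c * t)) * (S * (1 + ‖u‖) ^ q) :=
          mul_le_mul (hp θ t ht u) (hQ θ t ht u) (norm_nonneg _) (by positivity)
      _ = S * S * Real.exp (-c * t) * (1 + ‖u‖) ^ (q + q) := by rw [pow_add]; ring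
      _ ≤ _ := by
          gcongr
          exact le_max_left _ _
  · obtain ⟨m', hm', hr'⟩ := hlim u
    set w := S * (1 + ‖u‖) ^ q with hwdef
    have hw0 : 0 ≤ w := by positivity
    set p' : Θ → ℝ → Θ →L[ℝ] ℝ := fun η t => transOp P (prolOp A A' η) (a η, a' η)
      (fun t ω => (n t ω, (0 : Θ →L[ℝ] V))) t (fun p => (fderiv ℝ φ p.1).comp p.2) (u, 0) - m' η
    set Q' : Θ → ℝ → Θ →L[ℝ] F := fun η t => transOp P (prolOp A A' η) (a η, a' η)
      (fun t ω => (n t ω, (0 : Θ →L[ℝ] V))) t (fun p => (fderiv ℝ ψ p.1).comp p.2) (u, 0)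
    -- Leibniz rule: each summand contains exactly one decaying factor, either the centred mean or
    -- its `θ`-derivative.
    set F' : Θ → ℝ → Θ →L[ℝ] F := fun η t =>
      (transOp P (A η) (a η) n t φ u - m η) • Q' η t +
        (p' η t).smulRight (transOp P (A η) (a η) n t ψ u)
    have hbd : ∀ η t, 0 ≤ t → ‖F' η t‖ ≤ 2 * (w * w) * Real.exp (-(c / 2) * t) := fun η t ht => by
      refine (norm_add_le ((transOp P (A η) (a η) n t φ u - m η) • Q' η t)
        ((p' η t).smulRight (transOp P (A η) (a η) n t ψ u))).trans ?_
      rw [norm_smul, ContinuousLinearMap.norm_smulRight_apply]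
      have e1 : ‖transOp P (A η) (a η) n t φ u - m η‖ * ‖Q' η t‖ ≤
          w * Real.exp (-(c / 2) * t) * w :=
        mul_le_mul ((hp η t ht u).trans (mul_le_mul_of_nonneg_left (hexp1 t ht) hw0))
          (hQ' η t ht u) (norm_nonneg _) (by positivity)
      have e2 : ‖p' η t‖ * ‖transOp P (A η) (a η) n t ψ u‖ ≤ w * Real.exp (-(c / 2) * t) * w :=
        mul_le_mul (hr' t ht η) (hQ η t ht u) (norm_nonneg _) (by positivity)
      linarith
    have hmem : ∀ᵐ t ∂volume.restrict (Ioi (0 : ℝ)), 0 ≤ t :=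
      (ae_restrict_mem measurableSet_Ioi).mono fun t ht => le_of_lt ht
    have hmeas : ∀ η, AEStronglyMeasurable (fun t => transOp P (A η) (a η) n t
        (fun v => (φ v - m η) • ψ v) u) (volume.restrict (Ioi (0 : ℝ))) := fun η =>
      (h.measurable_transOp η ((hφ.contDiff.continuous.sub continuous_const).smul
        hψ.contDiff.continuous) u).aestronglyMeasurable
    have hbi : Integrable (fun t => 2 * (w * w) * Real.exp (-(c / 2) * t))
        (volume.restrict (Ioi (0 : ℝ))) :=
      (integrableOn_exp_neg (by positivity : 0 < c / 2)).const_mul _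
    have key := hasFDerivAt_integral_of_bound (μ := volume.restrict (Ioi (0 : ℝ)))
      (F := fun η t => transOp P (A η) (a η) n t (fun v => (φ v - m η) • ψ v) u) (F' := F')
      (v₀ := θ) (s := univ) (b := fun t => 2 * (w * w) * Real.exp (-(c / 2) * t)) univ_mem hmeas
      ?_ (hmem.mono fun t ht η _ => hbd η t ht) hbi (hmem.mono fun t ht η _ => ?_)
    · refine ⟨∫ t in Ioi (0 : ℝ), F' θ t, ?_, key.2⟩
      refine (norm_integral_le_of_norm_le hbi (hmem.mono fun t ht => hbd θ t ht)).trans ?_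
      rw [integral_const_mul, integral_Ioi_exp_neg (by positivity)]
      calc 2 * (w * w) * (1 / (c / 2)) = 2 * (S * S) / (c / 2) * (1 + ‖u‖) ^ (q + q) := by
            rw [hwdef, pow_add]; ring
        _ ≤ _ := by
            gcongr
            exact le_max_right _ _
    · refine Integrable.mono' (g := fun t => w * w * Real.exp (-(c / 2) * t))
        ((integrableOn_exp_neg (by positivity : 0 < c / 2)).const_mul _) (hmeas θ)
        (hmem.mono fun t ht => ?_)
      rw [hT θ t ht u, norm_smul]
      calc _ ≤ (w * Real.exp (-(c / 2) * t)) * w :=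
            mul_le_mul ((hp θ t ht u).trans (mul_le_mul_of_nonneg_left (hexp1 t ht) hw0))
              (hQ θ t ht u) (norm_nonneg _) (by positivity)
        _ = _ := by ring
    · simp only [hT _ t ht u]
      exact ((h.hasFDerivAt_transOp_param hA ha hA' ha' (hφ.contDiff.of_le (by norm_num))
        hφ.bdd hφ.bdd_fderiv η u ht).sub (hm' η)).smul
        (h.hasFDerivAt_transOp_param hA ha hA' ha' (hψ.contDiff.of_le (by norm_num))
        hψ.bdd hψ.bdd_fderiv η u ht)

end ProductPotential

/-! ### Brownian motion as noise. -/

section BrownianNoise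

variable {Ω : Type*} [MeasurableSpace Ω] {P : Measure Ω} [IsProbabilityMeasure P]

theorem integral_exp_eq_charFun {X : Ω → ℝ} (hX : AEMeasurable X P) :
    ∫ ω, Complex.exp ((X ω : ℝ) * Complex.I) ∂P = charFun (P.map X) 1 := by
  rw [charFun_apply_real, integral_map hX (by fun_prop : Continuous fun x : ℝ =>
    Complex.exp ((1 : ℝ) * x * Complex.I)).aestronglyMeasurable]
  simp

theorem integral_exp_sum_of_iIndepFun {κ : Type*} {X : κ → Ω → ℝ} (hX : iIndepFun X P)
    (s : Finset κ) (hm : ∀ i ∈ s, AEMeasurable (X i) P) :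
    ∫ ω, Complex.exp ((∑ i ∈ s, X i ω : ℝ) * Complex.I) ∂P =
      ∏ i ∈ s, ∫ ω, Complex.exp ((X i ω : ℝ) * Complex.I) ∂P := by
  rw [integral_exp_eq_charFun (Finset.aemeasurable_fun_sum s hm),
    (hX.restrict s).charFun_map_fun_finsetSum_eq_prod hm, Finset.prod_apply]
  exact Finset.prod_congr rfl fun i hi => (integral_exp_eq_charFun (hm i hi)).symm

theorem integral_exp_mul_increment {B : ℝ≥0 → Ω → ℝ} (hB : IsPreBrownianReal B P) {s t : ℝ≥0}
    (hst : s ≤ t) (γ : ℝ) :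
    ∫ ω, Complex.exp ((γ * (B t ω - B s ω) : ℝ) * Complex.I) ∂P =
      Complex.exp (-(((t : ℝ) - s) * γ ^ 2 : ℝ) / 2) := by
  have hl := hB.hasLaw_sub t s
  have h1 : ∫ ω, Complex.exp ((γ * (B t ω - B s ω) : ℝ) * Complex.I) ∂P =
      charFun (P.map (B t - B s)) γ := by
    rw [charFun_apply_real, integral_map hl.aemeasurable (by fun_prop : Continuous fun x : ℝ =>
      Complex.exp (γ * x * Complex.I)).aestronglyMeasurable]
    simp
  have h2 : ((nndist s t : ℝ≥0) : ℝ) = t - s := by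
    rw [coe_nndist, dist_comm, NNReal.dist_eq, abs_of_nonneg (by simpa using hst)]
  rw [h1, hl.map_eq, charFun_gaussianReal]
  congr 1
  rw [show nndist t.1 s.1 = nndist s t from nndist_comm _ _]
  simp only [Complex.ofReal_zero, mul_zero, zero_mul, zero_sub]
  rw [show (((nndist s t : ℝ≥0) : ℝ) : ℂ) = ((t - s : ℝ) : ℂ) from congrArg _ h2]
  push_cast
  ring

theorem integral_exp_sum_increments {B : ℝ≥0 → Ω → ℝ} (hB : IsPreBrownianReal B P) (m : ℕ)
    {s : ℕ → ℝ≥0} (hs : Monotone s) (γ : ℕ → ℝ) :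
    ∫ ω, Complex.exp ((∑ j ∈ Finset.range m, γ j * (B (s (j + 1)) ω - B (s j) ω) : ℝ) *
      Complex.I) ∂P =
      Complex.exp (-((∑ j ∈ Finset.range m, ((s (j + 1) : ℝ) - s j) * γ j ^ 2 : ℝ) : ℂ) / 2) := by
  have hind := (hB.hasIndepIncrements.nat hs).comp (fun j x => γ j * x) (fun j => by fun_prop)
  have := integral_exp_sum_of_iIndepFun hind (Finset.range m) (fun j _ => by
    exact ((hB.aemeasurable _).sub (hB.aemeasurable _)).const_mul (γ j))
  refine this.trans ((Finset.prod_congr rfl fun j _ =>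
    integral_exp_mul_increment hB (hs (Nat.le_succ j)) (γ j)).trans ?_)
  rw [← Complex.exp_sum]
  congr 1
  push_cast
  rw [← Finset.sum_div, Finset.sum_neg_distrib]

/-- Expanding the functionals in coordinates and exchanging sums isolates the independent
one-dimensional motions. -/
theorem IsBrownianVec.integral_exp {d : ℕ} {W : ℝ≥0 → Ω → Vec d} (hW : IsBrownianVec W P) (m : ℕ)
    {s : ℕ → ℝ≥0} (hs : Monotone s) (L : ℕ → StrongDual ℝ (Vec d)) :
    ∫ ω, Complex.exp ((∑ j ∈ Finset.range m, L j (W (s (j + 1)) ω - W (s j) ω) : ℝ) *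
      Complex.I) ∂P =
      Complex.exp (-((∑ j ∈ Finset.range m, ((s (j + 1) : ℝ) - s j) *
        ∑ i, (L j (EuclideanSpace.basisFun (Fin d) ℝ i)) ^ 2 : ℝ) : ℂ) / 2) := by
  have hL : ∀ j (v : Vec d), L j v = ∑ i, L j (EuclideanSpace.basisFun (Fin d) ℝ i) * v i := by
    intro j v
    conv_lhs => rw [← (EuclideanSpace.basisFun (Fin d) ℝ).sum_repr v]
    simp [map_sum, mul_comm]
  have hsum : ∀ ω, ∑ j ∈ Finset.range m, L j (W (s (j + 1)) ω - W (s j) ω) =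
      ∑ i, ∑ j ∈ Finset.range m, L j (EuclideanSpace.basisFun (Fin d) ℝ i) *
        (W (s (j + 1)) ω i - W (s j) ω i) := fun ω => by
    rw [Finset.sum_comm]
    refine Finset.sum_congr rfl fun j _ => ?_
    rw [hL]
    rfl
  have hind := hW.indep.comp (fun i p => ∑ j ∈ Finset.range m,
    L j (EuclideanSpace.basisFun (Fin d) ℝ i) * (p (s (j + 1)) - p (s j))) (fun i => by fun_prop)
  have hB := fun i => (hW.brownian i).toIsPreBrownianReal
  have := integral_exp_sum_of_iIndepFun hind Finset.univ (fun i _ => by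
    refine Finset.aemeasurable_fun_sum _ fun j _ => ?_
    exact (((hB i).aemeasurable _).sub ((hB i).aemeasurable _)).const_mul _)
  simp only [hsum]
  refine this.trans ((Finset.prod_congr rfl fun i _ => integral_exp_sum_increments (hB i) m hs
    (fun j => L j (EuclideanSpace.basisFun (Fin d) ℝ i))).trans ?_)
  rw [← Complex.exp_sum]
  congr 1
  rw [← Finset.sum_div, Finset.sum_neg_distrib, ← Complex.ofReal_sum, Finset.sum_comm]
  simp only [Finset.mul_sum]

/-- Two independent Brownian motions, after a modification on a null set, form a noise. -/
theorem IsBrownianVec.exists_isNoise {d : ℕ} {W W' : ℝ≥0 → Ω → Vec d} (hW : IsBrownianVec W P)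
    (hW' : IsBrownianVec W' P) (hind : IndepFun (fun ω t => W t ω) (fun ω t => W' t ω) P) :
    ∃ n : ℝ → Ω → Vec d × Vec d,
      IsNoise P (Sum.elim (fun i => (EuclideanSpace.basisFun (Fin d) ℝ i, (0 : Vec d)))
        (fun i => ((0 : Vec d), EuclideanSpace.basisFun (Fin d) ℝ i))) n ∧
      ∀ᵐ ω ∂P, ∀ t, n t ω = (W t.toNNReal ω, W' t.toNNReal ω) := by
  have hgood : ∀ {W : ℝ≥0 → Ω → Vec d}, IsBrownianVec W P →
      ∀ᵐ ω ∂P, Continuous (fun t => W t ω) ∧ W 0 ω = 0 := fun {W} h => by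
    have h1 : ∀ᵐ ω ∂P, ∀ i, Continuous (fun t => W t ω i) := ae_all_iff.2 fun i => (h.brownian i).cont
    have h2 : ∀ᵐ ω ∂P, ∀ i, W 0 ω i = 0 :=
      ae_all_iff.2 fun i => (h.brownian i).toIsPreBrownianReal.eval_zero_ae_eq_zero
    filter_upwards [h1, h2] with ω a1 a2
    exact ⟨(PiLp.continuous_toLp 2 _).comp (continuous_pi a1), by ext i; simpa using a2 i⟩
  have hall : ∀ᵐ ω ∂P, (Continuous (fun t => W t ω) ∧ W 0 ω = 0) ∧
      (Continuous (fun t => W' t ω) ∧ W' 0 ω = 0) := (hgood hW).and (hgood hW')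
  -- The exceptional paths are enclosed in a measurable null set and replaced there by `0`, so that
  -- continuity and the zero start hold for every `ω`.
  obtain ⟨S, hSsub, hSm, hS0⟩ := exists_measurable_superset_of_null (ae_iff.1 hall)
  have hgood' : ∀ ω, ω ∉ S → (Continuous (fun t => W t ω) ∧ W 0 ω = 0) ∧
      (Continuous (fun t => W' t ω) ∧ W' 0 ω = 0) := fun ω hω => by
    by_contra hcon
    exact hω (hSsub hcon)
  classical
  set n : ℝ → Ω → Vec d × Vec d := fun t ω =>
    if ω ∈ S then 0 else (W t.toNNReal ω, W' t.toNNReal ω) with hn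
  have hae : ∀ᵐ ω ∂P, ∀ t, n t ω = (W t.toNNReal ω, W' t.toNNReal ω) := by
    have : ∀ᵐ ω ∂P, ω ∉ S := measure_eq_zero_iff_ae_notMem.1 hS0
    filter_upwards [this] with ω hω t
    simp [hn, hω]
  refine ⟨n, ⟨fun t => ?_, fun ω => ?_, fun ω => ?_, fun m s hs0 hs L => ?_⟩, hae⟩
  · exact Measurable.ite hSm measurable_const ((hW.measurable _).prodMk (hW'.measurable _))
  · by_cases hω : ω ∈ S
    · simpa [hn, hω] using continuous_const
    · simp only [hn, hω, if_false]
      exact ((hgood' ω hω).1.1.comp continuous_real_toNNReal).prodMk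
        ((hgood' ω hω).2.1.comp continuous_real_toNNReal)
  · by_cases hω : ω ∈ S
    · simp [hn, hω]
    · simp only [hn, hω, if_false, Real.toNNReal_zero, (hgood' ω hω).1.2, (hgood' ω hω).2.2]
      rfl
  · have hsm : Monotone fun j => (s j).toNNReal := fun i j hij => Real.toNNReal_mono (hs hij)
    have hcoe : ∀ j, (((s j).toNNReal : ℝ≥0) : ℝ) = s j := fun j =>
      Real.coe_toNNReal _ (hs0.trans (hs (Nat.zero_le j)))
    -- Each functional on the product splits along the two factors, and the resulting sums are
    -- independent.
    set L₁ : ℕ → StrongDual ℝ (Vec d) := fun j => (L j).comp (.inl ℝ _ _)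
    set L₂ : ℕ → StrongDual ℝ (Vec d) := fun j => (L j).comp (.inr ℝ _ _)
    have hL : ∀ j (v : Vec d × Vec d), L j v = L₁ j v.1 + L₂ j v.2 := fun j v => by
      simp [L₁, L₂, ← map_add]
    have hpm : ∀ L : ℕ → StrongDual ℝ (Vec d), Measurable fun p : ℝ≥0 → Vec d =>
        ∑ j ∈ Finset.range m, L j (p (s (j + 1)).toNNReal - p (s j).toNNReal) := fun L =>
      Finset.measurable_fun_sum _ fun j _ => (L j).continuous.measurable.comp
        ((measurable_pi_apply _).sub (measurable_pi_apply _))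
    have hXY := hind.comp (hpm L₁) (hpm L₂)
    have hmX : Measurable fun ω => ∑ j ∈ Finset.range m,
        L₁ j (W (s (j + 1)).toNNReal ω - W (s j).toNNReal ω) :=
      Finset.measurable_fun_sum _ fun j _ => (L₁ j).continuous.measurable.comp
        ((hW.measurable _).sub (hW.measurable _))
    have hmY : Measurable fun ω => ∑ j ∈ Finset.range m,
        L₂ j (W' (s (j + 1)).toNNReal ω - W' (s j).toNNReal ω) :=
      Finset.measurable_fun_sum _ fun j _ => (L₂ j).continuous.measurable.comp
        ((hW'.measurable _).sub (hW'.measurable _))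
    have h1 : ∫ ω, Complex.exp ((∑ j ∈ Finset.range m, L j (n (s (j + 1)) ω - n (s j) ω) : ℝ) *
        Complex.I) ∂P = ∫ ω, Complex.exp (((∑ j ∈ Finset.range m,
          L₁ j (W (s (j + 1)).toNNReal ω - W (s j).toNNReal ω)) + ∑ j ∈ Finset.range m,
          L₂ j (W' (s (j + 1)).toNNReal ω - W' (s j).toNNReal ω) : ℝ) * Complex.I) ∂P := by
      refine integral_congr_ae ?_
      filter_upwards [hae] with ω hω
      simp only [hω, hL, Finset.sum_add_distrib, Prod.fst_sub, Prod.snd_sub]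
    have h2 := congrFun (hXY.charFun_map_fun_add_eq_mul hmX.aemeasurable hmY.aemeasurable) 1
    refine h1.trans (Eq.trans (integral_exp_eq_charFun (P := P) (hmX.add hmY).aemeasurable)
      (Eq.trans h2 ?_))
    rw [Pi.mul_apply]
    have h3 := (integral_exp_eq_charFun hmX.aemeasurable (P := P)).symm.trans
      (hW.integral_exp m hsm L₁)
    have h4 := (integral_exp_eq_charFun hmY.aemeasurable (P := P)).symm.trans
      (hW'.integral_exp m hsm L₂)
    refine (congrArg₂ (· * ·) h3 h4).trans ?_
    rw [← Complex.exp_add]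
    congr 1
    simp only [hcoe, Fintype.sum_sum_type, Sum.elim_inl, Sum.elim_inr, mul_add,
      Finset.sum_add_distrib, L₁, L₂, ContinuousLinearMap.comp_apply,
      ContinuousLinearMap.inl_apply, ContinuousLinearMap.inr_apply]
    push_cast
    ring

end BrownianNoise

/-! ### Independence of the two blocks. -/

section Independence

variable {Ω : Type*} [MeasurableSpace Ω] {P : Measure Ω} [IsProbabilityMeasure P]
  {ι₁ ι₂ : Type*} [Fintype ι₁] [Fintype ι₂]
  {V₁ : Type*} [NormedAddCommGroup V₁] [NormedSpace ℝ V₁] [FiniteDimensional ℝ V₁]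
  [CompleteSpace V₁] [MeasurableSpace V₁] [BorelSpace V₁]
  {V₂ : Type*} [NormedAddCommGroup V₂] [NormedSpace ℝ V₂] [FiniteDimensional ℝ V₂]
  [CompleteSpace V₂] [MeasurableSpace V₂] [BorelSpace V₂]
  {F : Type*} [NormedAddCommGroup F] [NormedSpace ℝ F] [CompleteSpace F]

omit [IsProbabilityMeasure P] [FiniteDimensional ℝ V₁] [CompleteSpace V₁] in
theorem charFunDual_map (L : StrongDual ℝ V₁) {X : Ω → V₁} (hX : Measurable X) :
    charFunDual (P.map X) L = ∫ ω, Complex.exp ((L (X ω) : ℝ) * Complex.I) ∂P := by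
  rw [charFunDual_apply, integral_map hX.aemeasurable (by fun_prop : Continuous fun v : V₁ =>
    Complex.exp (L v * Complex.I)).aestronglyMeasurable]

/-- The block diagonal flow preserves each of the two groups of noise directions. The variance of a
functional therefore has no cross term, and the joint characteristic function factorises. -/
theorem IsNoise.indepFun_affPath {e₁ : ι₁ → V₁} {e₂ : ι₂ → V₂} {n : ℝ → Ω → V₁ × V₂}
    (h : IsNoise P (Sum.elim (fun i => (e₁ i, (0 : V₂))) (fun i => ((0 : V₁), e₂ i))) n)
    (A₁ : V₁ →L[ℝ] V₁) (A₂ : V₂ →L[ℝ] V₂) {t : ℝ} (ht : 0 ≤ t) :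
    IndepFun (fun ω => (affPath (tri A₁ 0 A₂) 0 0 (fun s => n s ω) t).1)
      (fun ω => (affPath (tri A₁ 0 A₂) 0 0 (fun s => n s ω) t).2) P := by
  have hN := h.isCenteredGaussian_affPath (tri A₁ 0 A₂) ht
  have hm1 : Measurable fun ω => (affPath (tri A₁ 0 A₂) 0 0 (fun s => n s ω) t).1 :=
    measurable_fst.comp hN.measurable
  have hm2 : Measurable fun ω => (affPath (tri A₁ 0 A₂) 0 0 (fun s => n s ω) t).2 :=
    measurable_snd.comp hN.measurable
  refine (indepFun_iff_charFunDual_prod hm1.aemeasurable hm2.aemeasurable).2 fun L => ?_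
  have hf : ∀ r i, flow (tri A₁ (0 : V₁ →L[ℝ] V₂) A₂) r (e₁ i, (0 : V₂)) = (flow A₁ r (e₁ i), 0) :=
    fun r i => (flow_intertwine (A := A₁) (B := tri A₁ (0 : V₁ →L[ℝ] V₂) A₂)
      (T := .inl ℝ V₁ V₂) (fun v => by simp) r (e₁ i)).symm
  have hg : ∀ r i, flow (tri A₁ (0 : V₁ →L[ℝ] V₂) A₂) r ((0 : V₁), e₂ i) = (0, flow A₂ r (e₂ i)) :=
    fun r i => (flow_intertwine (A := A₂) (B := tri A₁ (0 : V₁ →L[ℝ] V₂) A₂)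
      (T := .inr ℝ V₁ V₂) (fun v => by simp) r (e₂ i)).symm
  rw [charFunDual_map _ hm1, charFunDual_map _ hm2, charFunDual_map _ (hm1.prodMk hm2)]
  refine (hN.charFun L).trans ?_
  refine Eq.trans ?_ (congrArg₂ (· * ·)
    (hN.charFun ((L.comp (.inl ℝ V₁ V₂)).comp (.fst ℝ V₁ V₂))).symm
    (hN.charFun ((L.comp (.inr ℝ V₁ V₂)).comp (.snd ℝ V₁ V₂))).symm)
  rw [← Complex.exp_add]
  congr 1
  simp only [Fintype.sum_sum_type, Sum.elim_inl, Sum.elim_inr, hf, hg,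
    ContinuousLinearMap.comp_apply, ContinuousLinearMap.inl_apply, ContinuousLinearMap.inr_apply,
    ContinuousLinearMap.coe_fst', ContinuousLinearMap.coe_snd']
  rw [intervalIntegral.integral_add]
  · have hL0 : L ((0 : V₁), (0 : V₂)) = 0 := map_zero L
    simp [hL0]
    ring
  · refine (continuous_finsetSum _ fun i _ => ?_).intervalIntegrable _ _
    exact (L.continuous.comp (((continuous_flow A₁).clm_apply continuous_const).prodMk
      continuous_const)).pow 2
  · refine (continuous_finsetSum _ fun i _ => ?_).intervalIntegrable _ _
    exact (L.continuous.comp (continuous_const.prodMk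
      ((continuous_flow A₂).clm_apply continuous_const))).pow 2

/-- The transition operators of a pair of independent solutions. -/
theorem IsNoise.transOp_smul {e₁ : ι₁ → V₁} {e₂ : ι₂ → V₂} {n : ℝ → Ω → V₁ × V₂}
    (h : IsNoise P (Sum.elim (fun i => (e₁ i, (0 : V₂))) (fun i => ((0 : V₁), e₂ i))) n)
    (A₁ : V₁ →L[ℝ] V₁) (A₂ : V₂ →L[ℝ] V₂) (a : V₁ × V₂) {t : ℝ} (ht : 0 ≤ t) {φ : V₂ → ℝ}
    {ψ : V₁ → F} (hφ : Continuous φ) (hψ : Continuous ψ) (u : V₁ × V₂) :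
    transOp P (tri A₁ 0 A₂) a n t (fun v => φ v.2 • ψ v.1) u =
      transOp P (tri A₁ 0 A₂) a n t (fun v => φ v.2) u •
        transOp P (tri A₁ 0 A₂) a n t (fun v => ψ v.1) u := by
  have hN := h.isCenteredGaussian_affPath (tri A₁ 0 A₂) ht
  have hm1 : Measurable fun ω => (affPath (tri A₁ 0 A₂) 0 0 (fun s => n s ω) t).1 :=
    measurable_fst.comp hN.measurable
  have hm2 : Measurable fun ω => (affPath (tri A₁ 0 A₂) 0 0 (fun s => n s ω) t).2 :=
    measurable_snd.comp hN.measurable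
  have hind := ((indepFun_iff_map_prod_eq_prod_map_map hm2.aemeasurable hm1.aemeasurable).1
    (h.indepFun_affPath A₁ A₂ ht).symm)
  have := Measure.isProbabilityMeasure_map (μ := P) hm1.aemeasurable
  have := Measure.isProbabilityMeasure_map (μ := P) hm2.aemeasurable
  unfold transOp
  simp only [fun ω => affPath_eq_add (tri A₁ 0 A₂) a u (h.continuous ω) t]
  set v := flow (tri A₁ 0 A₂) t u + ∫ s in (0 : ℝ)..t, flow (tri A₁ 0 A₂) s a
  have hφ' : Continuous fun x => φ (v.2 + x) := by fun_prop
  have hψ' : Continuous fun x => ψ (v.1 + x) := by fun_prop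
  have hc : Continuous fun q : V₂ × V₁ => φ (v.2 + q.1) • ψ (v.1 + q.2) :=
    (hφ'.comp continuous_fst).smul (hψ'.comp continuous_snd)
  have h1 := integral_map (μ := P) (hm2.prodMk hm1).aemeasurable
    (f := fun q : V₂ × V₁ => φ (v.2 + q.1) • ψ (v.1 + q.2)) hc.aestronglyMeasurable
  rw [hind, integral_prod_smul (fun x => φ (v.2 + x)) (fun x => ψ (v.1 + x)), integral_map hm2.aemeasurable hφ'.aestronglyMeasurable,
    integral_map hm1.aemeasurable hψ'.aestronglyMeasurable] at h1
  exact h1.symm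

end Independence

/-! ### Marginal noises and weaker constants. -/

section Marginals

variable {Ω : Type*} [MeasurableSpace Ω] {P : Measure Ω}
  {ι₁ ι₂ : Type*} [Fintype ι₁] [Fintype ι₂]
  {V₁ : Type*} [NormedAddCommGroup V₁] [NormedSpace ℝ V₁] [MeasurableSpace V₁] [BorelSpace V₁]
  {V₂ : Type*} [NormedAddCommGroup V₂] [NormedSpace ℝ V₂] [MeasurableSpace V₂] [BorelSpace V₂]
  [BorelSpace (V₁ × V₂)]

theorem IsNoise.fst {e₁ : ι₁ → V₁} {e₂ : ι₂ → V₂} {n : ℝ → Ω → V₁ × V₂}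
    (h : IsNoise P (Sum.elim (fun i => (e₁ i, (0 : V₂))) (fun i => ((0 : V₁), e₂ i))) n) :
    IsNoise P e₁ (fun t ω => (n t ω).1) := by
  have h1 := h.map (.fst ℝ V₁ V₂)
  refine ⟨h1.measurable, h1.continuous, h1.zero, fun m s hs hm L => ?_⟩
  simpa using h1.charFun m s hs hm L

theorem IsNoise.snd {e₁ : ι₁ → V₁} {e₂ : ι₂ → V₂} {n : ℝ → Ω → V₁ × V₂}
    (h : IsNoise P (Sum.elim (fun i => (e₁ i, (0 : V₂))) (fun i => ((0 : V₁), e₂ i))) n) :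
    IsNoise P e₂ (fun t ω => (n t ω).2) := by
  have h1 := h.map (.snd ℝ V₁ V₂)
  refine ⟨h1.measurable, h1.continuous, h1.zero, fun m s hs hm L => ?_⟩
  simpa using h1.charFun m s hs hm L

theorem LinFam.mono {Θ : Type*} {A : Θ → V₁ →L[ℝ] V₁} {a : Θ → V₁} {e : ι₁ → V₁} {n : ℝ → Ω → V₁}
    {K K' c c' : ℝ} (h : LinFam P A a e n K c) (hK : K ≤ K') (hc : c' ≤ c) (hc' : 0 < c') :
    LinFam P A a e n K' c' := by
  have h1 := h.one_le
  refine ⟨h1.trans hK, hc', fun θ => (h.norm_A θ).trans hK, fun θ => (h.norm_a θ).trans hK,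
    fun i => (h.norm_e i).trans hK, fun θ t ht => (h.decay θ t ht).trans ?_, h.noise⟩
  refine mul_le_mul hK (Real.exp_le_exp.2 ?_) (Real.exp_pos _).le (by linarith)
  nlinarith

end Marginals

/-! ### Decay of the flow from coercivity. -/

section Inner

variable {E : Type*} [NormedAddCommGroup E] [InnerProductSpace ℝ E] [CompleteSpace E]

/-- Energy estimate: along the flow `‖y‖ ^ 2` has derivative `-2 ⟪y, H y⟫ ≤ -2 c ‖y‖ ^ 2`. -/
theorem norm_flow_le_of_le_inner {H : E →L[ℝ] E} {c : ℝ}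
    (hpos : ∀ x : E, c * ‖x‖ ^ 2 ≤ inner ℝ x (H x)) {t : ℝ} (ht : 0 ≤ t) :
    ‖flow H t‖ ≤ Real.exp (-c * t) := by
  refine ContinuousLinearMap.opNorm_le_bound _ (Real.exp_pos _).le fun v => ?_
  have hd : ∀ s, HasDerivAt (fun s => ‖flow H s v‖ ^ 2)
      (2 * inner ℝ (flow H s v) (-(H (flow H s v)))) s := fun s => by
    have h1 := ((hasDerivAt_flow H s).clm_apply (hasDerivAt_const s v)).norm_sq
    refine HasDerivAt.congr_deriv (f := fun s => ‖flow H s v‖ ^ 2) h1 ?_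
    simp
  have h2 := le_exp_mul_of_deriv_le (c := 2 * c) hd (fun s => by
    have := hpos (flow H s v)
    rw [inner_neg_right]
    linarith) ht
  simp only [flow_zero, one_apply_eq_self] at h2
  have h3 : Real.exp (-(2 * c) * t) * ‖v‖ ^ 2 = (Real.exp (-c * t) * ‖v‖) ^ 2 := by
    rw [mul_pow, sq (Real.exp _), ← Real.exp_add]
    ring_nf
  rw [h3] at h2
  exact (sq_le_sq₀ (norm_nonneg _) (by positivity)).1 h2

end Inner

/-! ### The triple as one linear system. -/

section Triple

variable {Ω : Type*} [MeasurableSpace Ω] {P : Measure Ω} [IsProbabilityMeasure P]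
  {κ : Type*} [Fintype κ]
  {Θ : Type*} [NormedAddCommGroup Θ] [NormedSpace ℝ Θ] [FiniteDimensional ℝ Θ]
  {E : Type*} [NormedAddCommGroup E] [NormedSpace ℝ E] [FiniteDimensional ℝ E] [CompleteSpace E]
  [MeasurableSpace E] [BorelSpace E]

/-- The operator of the linear equation for the triple `((X, X̃), X̄)`. -/
noncomputable def tripleOp (h : Θ → E →L[ℝ] E) (θ : Θ) :
    (E × (Θ →L[ℝ] E)) × E →L[ℝ] (E × (Θ →L[ℝ] E)) × E :=
  tri (prolOp h (fderiv ℝ h) θ) 0 (h θ)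

/-- The constant part of the drift of the triple. -/
noncomputable def tripleDrift (g : Θ → E) (θ : Θ) : (E × (Θ →L[ℝ] E)) × E :=
  ((g θ, fderiv ℝ g θ), g θ)

/-- The directions of the noise of the triple. -/
def tripleDir (Θ : Type*) [NormedAddCommGroup Θ] [NormedSpace ℝ Θ] (b : κ → E) :
    κ ⊕ κ → (E × (Θ →L[ℝ] E)) × E :=
  Sum.elim (fun i => ((b i, 0), 0)) (fun i => (0, b i))

/-- The noise of the triple. -/
def tripleNoise (Θ : Type*) [NormedAddCommGroup Θ] [NormedSpace ℝ Θ] (n : ℝ → Ω → E × E) (t : ℝ)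
    (ω : Ω) : (E × (Θ →L[ℝ] E)) × E :=
  (((n t ω).1, 0), (n t ω).2)

/-- `tripleOp` as a linear function of the coefficients and their derivatives. -/
noncomputable def tripleL (Θ E : Type*) [NormedAddCommGroup Θ] [NormedSpace ℝ Θ]
    [NormedAddCommGroup E] [NormedSpace ℝ E] : ((E →L[ℝ] E) × (Θ →L[ℝ] E →L[ℝ] E)) →L[ℝ]
    ((E × (Θ →L[ℝ] E)) × E →L[ℝ] (E × (Θ →L[ℝ] E)) × E) :=
  (triL (E × (Θ →L[ℝ] E)) E).comp (((triL E (Θ →L[ℝ] E)).comp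
    ((ContinuousLinearMap.fst ℝ _ _).prod
      ((((ContinuousLinearMap.flipₗᵢ ℝ Θ E E).toContinuousLinearEquiv :
          (Θ →L[ℝ] E →L[ℝ] E) →L[ℝ] (E →L[ℝ] Θ →L[ℝ] E)).comp
        (ContinuousLinearMap.snd ℝ _ _)).prod
      ((ContinuousLinearMap.compL ℝ Θ E E).comp
        (ContinuousLinearMap.fst ℝ _ _))))).prod
    ((0 : ((E →L[ℝ] E) × (Θ →L[ℝ] E →L[ℝ] E)) →L[ℝ] _).prod (ContinuousLinearMap.fst ℝ _ _)))

omit [FiniteDimensional ℝ Θ] [FiniteDimensional ℝ E] [CompleteSpace E] [MeasurableSpace E]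
  [BorelSpace E] in
theorem tripleOp_eq (h : Θ → E →L[ℝ] E) (θ : Θ) :
    tripleOp h θ = tripleL Θ E (h θ, fderiv ℝ h θ) := rfl

omit [FiniteDimensional ℝ Θ] [FiniteDimensional ℝ E] [CompleteSpace E] [MeasurableSpace E]
  [BorelSpace E] in
theorem norm_triple_le {v : (E × (Θ →L[ℝ] E)) × E} {K : ℝ} (h1 : ‖v.1.1‖ ≤ K) (h2 : ‖v.1.2‖ ≤ K)
    (h3 : ‖v.2‖ ≤ K) : ‖v‖ ≤ K := max_le (max_le h1 h2) h3

theorem IsNoise.triple {b : κ → E} {n : ℝ → Ω → E × E}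
    (hn : IsNoise P (Sum.elim (fun i => (b i, (0 : E))) (fun i => ((0 : E), b i))) n) :
    IsNoise P (tripleDir Θ b) (tripleNoise Θ n) := by
  have h4 : tripleDir Θ b = fun i => (((ContinuousLinearMap.fst ℝ E E).prod
      (0 : E × E →L[ℝ] (Θ →L[ℝ] E))).prod (ContinuousLinearMap.snd ℝ E E))
      (Sum.elim (fun i => (b i, (0 : E))) (fun i => ((0 : E), b i)) i) := by
    funext i
    rcases i with i | i <;> rfl
  rw [h4]
  exact hn.map (((ContinuousLinearMap.fst ℝ E E).prod
      (0 : E × E →L[ℝ] (Θ →L[ℝ] E))).prod (ContinuousLinearMap.snd ℝ E E))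

/-- The triple is a solution of a linear equation with a uniformly decaying flow. -/
theorem LinFam.triple {g : Θ → E} {h : Θ → E →L[ℝ] E} {b : κ → E} {n : ℝ → Ω → E × E} {K c : ℝ}
    (F1 : LinFam P h g b (fun t ω => (n t ω).1) K c) (h1 : ∀ θ, ‖fderiv ℝ h θ‖ ≤ K)
    (g1 : ∀ θ, ‖fderiv ℝ g θ‖ ≤ K)
    (hn : IsNoise P (Sum.elim (fun i => (b i, (0 : E))) (fun i => ((0 : E), b i))) n) :
    ∃ K₃, K ≤ K₃ ∧
      LinFam P (tripleOp h) (tripleDrift g) (tripleDir Θ b) (tripleNoise Θ n) K₃ (c / 4) := by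
  have F12 := F1.prol h1 g1
  have hK1 := F1.one_le
  have hc := F1.pos
  -- Two triangular extensions are stacked: adjoining `X̃` gives `K₂` and rate `c / 2`, adjoining
  -- `X̄` gives `K₃` and rate `c / 4`.
  obtain ⟨K₂, hK₂⟩ : ∃ K₂, K₂ = 2 * K + 2 * K ^ 3 / c := ⟨_, rfl⟩
  rw [← hK₂] at F12
  have hK₂K : K ≤ K₂ := by
    have : 0 ≤ 2 * K ^ 3 / c := by positivity
    linarith
  have hK₂0 : 0 ≤ K₂ := by linarith
  obtain ⟨K₃, hK₃⟩ : ∃ K₃, K₃ = 2 * K₂ + 2 * K₂ ^ 3 / (c / 2) := ⟨_, rfl⟩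
  have hK₃K : 2 * K₂ ≤ K₃ := by
    have : 0 ≤ 2 * K₂ ^ 3 / (c / 2) := by positivity
    linarith
  have hle : K₂ + 2 * K₂ ^ 3 / (c / 2) ≤ K₃ := by linarith
  have hKK₃ : K ≤ K₃ := by linarith
  have hK₃0 : 0 ≤ K₃ := by linarith
  have hone : 1 ≤ K₃ := by linarith
  have hc2 : 0 < c / 2 := by positivity
  have hc4 : c / 2 / 2 = c / 4 := by ring
  have hzero : ‖(0 : E × (Θ →L[ℝ] E) →L[ℝ] E)‖ ≤ K₂ :=
    ContinuousLinearMap.opNorm_zero.trans_le hK₂0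
  refine ⟨K₃, hKK₃, hone, by positivity, fun θ => ?_, fun θ => ?_, fun i => ?_, fun θ t ht => ?_,
    hn.triple⟩
  · exact (norm_tri_le (F12.norm_A θ) hzero ((F1.norm_A θ).trans hK₂K)).trans hK₃K
  · exact norm_triple_le ((F1.norm_a θ).trans hKK₃) ((g1 θ).trans hKK₃) ((F1.norm_a θ).trans hKK₃)
  · rcases i with i | i
    · exact norm_triple_le (v := tripleDir Θ b (Sum.inl i)) ((F1.norm_e i).trans hKK₃)
        (norm_zero.trans_le hK₃0) (norm_zero.trans_le hK₃0)
    · exact norm_triple_le (v := tripleDir Θ b (Sum.inr i)) (norm_zero.trans_le hK₃0)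
        (norm_zero.trans_le hK₃0) ((F1.norm_e i).trans hKK₃)
  · have hdec : ∀ s, 0 ≤ s → ‖flow (h θ) s‖ ≤ K₂ * Real.exp (-(c / 2) * s) := fun s hs => by
      refine (F1.decay θ s hs).trans (mul_le_mul hK₂K (Real.exp_le_exp.2 ?_) (Real.exp_pos _).le hK₂0)
      nlinarith
    have h3 := norm_flow_tri_le hK₂0 hc2 (F12.decay θ) hdec hzero ht
    rw [hc4] at h3
    exact h3.trans (mul_le_mul_of_nonneg_right hle (Real.exp_pos _).le)

set_option maxSynthPendingDepth 3

omit [FiniteDimensional ℝ Θ] [FiniteDimensional ℝ E] [CompleteSpace E] [MeasurableSpace E]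
  [BorelSpace E] in
-- The operator is a fixed linear image of `(h, Dh)`, so its derivative is the image of `(Dh, D²h)`.
-- Here the second derivatives of the coefficients enter.
theorem exists_hasFDerivAt_tripleOp {h : Θ → E →L[ℝ] E} (hh : ContDiff ℝ 2 h) {K : ℝ}
    (h1 : ∀ θ, ‖fderiv ℝ h θ‖ ≤ K) (h2 : ∀ θ, ‖fderiv ℝ (fderiv ℝ h) θ‖ ≤ K) :
    ∃ A' : Θ → Θ →L[ℝ] (E × (Θ →L[ℝ] E)) × E →L[ℝ] (E × (Θ →L[ℝ] E)) × E,
      (∀ θ, HasFDerivAt (tripleOp h) (A' θ) θ) ∧ ∀ θ, ‖A' θ‖ ≤ ‖tripleL Θ E‖ * K := by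
  have hdh : ∀ θ, HasFDerivAt h (fderiv ℝ h θ) θ := fun θ =>
    (hh.differentiable (by norm_num) θ).hasFDerivAt
  have hddh : ∀ θ, HasFDerivAt (fderiv ℝ h) (fderiv ℝ (fderiv ℝ h) θ) θ := fun θ =>
    ((hh.fderiv_right (m := 1) (by norm_num)).differentiable (by norm_num) θ).hasFDerivAt
  have heq : tripleOp h = fun θ => tripleL Θ E (h θ, fderiv ℝ h θ) := funext (tripleOp_eq h)
  rw [heq]
  generalize tripleL Θ E = L
  have hd : ∀ θ, HasFDerivAt (fun θ => (h θ, fderiv ℝ h θ))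
      ((fderiv ℝ h θ).prod (fderiv ℝ (fderiv ℝ h) θ)) θ := fun θ => (hdh θ).prodMk (hddh θ)
  refine ⟨fun θ => L.comp ((fderiv ℝ h θ).prod (fderiv ℝ (fderiv ℝ h) θ)),
    fun θ => L.hasFDerivAt.comp θ (hd θ), fun θ => ?_⟩
  refine (ContinuousLinearMap.opNorm_comp_le _ _).trans (mul_le_mul_of_nonneg_left ?_
    (norm_nonneg _))
  rw [ContinuousLinearMap.opNorm_prod]
  exact norm_prod_le_iff.2 ⟨h1 θ, h2 θ⟩

omit [FiniteDimensional ℝ Θ] [FiniteDimensional ℝ E] [CompleteSpace E] [MeasurableSpace E]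
  [BorelSpace E] in
theorem exists_hasFDerivAt_tripleDrift {g : Θ → E} (hg : ContDiff ℝ 2 g) {K : ℝ}
    (g1 : ∀ θ, ‖fderiv ℝ g θ‖ ≤ K) (g2 : ∀ θ, ‖fderiv ℝ (fderiv ℝ g) θ‖ ≤ K) :
    ∃ a' : Θ → Θ →L[ℝ] (E × (Θ →L[ℝ] E)) × E,
      (∀ θ, HasFDerivAt (tripleDrift g) (a' θ) θ) ∧ ∀ θ, ‖a' θ‖ ≤ K := by
  have hdg : ∀ θ, HasFDerivAt g (fderiv ℝ g θ) θ := fun θ =>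
    (hg.differentiable (by norm_num) θ).hasFDerivAt
  have hddg : ∀ θ, HasFDerivAt (fderiv ℝ g) (fderiv ℝ (fderiv ℝ g) θ) θ := fun θ =>
    ((hg.fderiv_right (m := 1) (by norm_num)).differentiable (by norm_num) θ).hasFDerivAt
  refine ⟨fun θ => ((fderiv ℝ g θ).prod (fderiv ℝ (fderiv ℝ g) θ)).prod (fderiv ℝ g θ),
    fun θ => ((hdg θ).prodMk (hddg θ)).prodMk (hdg θ), fun θ => ?_⟩
  rw [ContinuousLinearMap.opNorm_prod]
  refine norm_prod_le_iff.2 ⟨?_, g1 θ⟩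
  rw [ContinuousLinearMap.opNorm_prod]
  exact norm_prod_le_iff.2 ⟨g1 θ, g2 θ⟩

/-- A single pair of constants is produced for both marginals and the triple, because the estimates
on them are later combined. -/
theorem exists_linFam {g : Θ → E} {h : Θ → E →L[ℝ] E} {b : κ → E}
    (hg : ContDiff ℝ 2 g) (hh : ContDiff ℝ 2 h)
    (hgb : ∃ K : ℝ, ∀ i ≤ 2, ∀ θ, ‖iteratedFDeriv ℝ i g θ‖ ≤ K)
    (hhb : ∃ K : ℝ, ∀ i ≤ 2, ∀ θ, ‖iteratedFDeriv ℝ i h θ‖ ≤ K)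
    {c : ℝ} (hc : 0 < c) (hflow : ∀ θ t, 0 ≤ t → ‖flow (h θ) t‖ ≤ Real.exp (-c * t))
    {n : ℝ → Ω → E × E}
    (hn : IsNoise P (Sum.elim (fun i => (b i, (0 : E))) (fun i => ((0 : E), b i))) n) :
    ∃ (K c : ℝ) (A' : Θ → Θ →L[ℝ] (E × (Θ →L[ℝ] E)) × E →L[ℝ] (E × (Θ →L[ℝ] E)) × E)
      (a' : Θ → Θ →L[ℝ] (E × (Θ →L[ℝ] E)) × E),
      LinFam P h g b (fun t ω => (n t ω).1) K c ∧
      LinFam P h g b (fun t ω => (n t ω).2) K c ∧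
      LinFam P (tripleOp h) (tripleDrift g) (tripleDir Θ b) (tripleNoise Θ n) K c ∧
      (∀ θ, HasFDerivAt (tripleOp h) (A' θ) θ) ∧ (∀ θ, HasFDerivAt (tripleDrift g) (a' θ) θ) ∧
      (∀ θ, ‖A' θ‖ ≤ K) ∧ (∀ θ, ‖a' θ‖ ≤ K) := by
  obtain ⟨Kg, hKg⟩ := hgb
  obtain ⟨Kh, hKh⟩ := hhb
  have hb0 : 0 ≤ ∑ i, ‖b i‖ := by positivity
  obtain ⟨K, hKdef⟩ : ∃ K, K = 1 + |Kg| + |Kh| + ∑ i, ‖b i‖ := ⟨_, rfl⟩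
  have a1 := abs_nonneg Kg
  have a2 := abs_nonneg Kh
  have hK1 : 1 ≤ K := by linarith
  have hKgK : Kg ≤ K := by linarith [le_abs_self Kg]
  have hKhK : Kh ≤ K := by linarith [le_abs_self Kh]
  have he : ∀ i, ‖b i‖ ≤ K := fun i =>
    (Finset.single_le_sum (f := fun i => ‖b i‖) (fun i _ => norm_nonneg _)
      (Finset.mem_univ i)).trans (by linarith)
  have g0 : ∀ θ, ‖g θ‖ ≤ K := fun θ => by
    simpa using (hKg 0 (by norm_num) θ).trans hKgK
  have g1 : ∀ θ, ‖fderiv ℝ g θ‖ ≤ K := fun θ => by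
    simpa [norm_iteratedFDeriv_one] using (hKg 1 (by norm_num) θ).trans hKgK
  have g2 : ∀ θ, ‖fderiv ℝ (fderiv ℝ g) θ‖ ≤ K := fun θ => by
    rw [← norm_iteratedFDeriv_one, norm_iteratedFDeriv_fderiv]
    exact (hKg 2 le_rfl θ).trans hKgK
  have h0 : ∀ θ, ‖h θ‖ ≤ K := fun θ => by
    simpa using (hKh 0 (by norm_num) θ).trans hKhK
  have h1 : ∀ θ, ‖fderiv ℝ h θ‖ ≤ K := fun θ => by
    simpa [norm_iteratedFDeriv_one] using (hKh 1 (by norm_num) θ).trans hKhK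
  have h2 : ∀ θ, ‖fderiv ℝ (fderiv ℝ h) θ‖ ≤ K := fun θ => by
    rw [← norm_iteratedFDeriv_one, norm_iteratedFDeriv_fderiv]
    exact (hKh 2 le_rfl θ).trans hKhK
  have hdec : ∀ θ t, 0 ≤ t → ‖flow (h θ) t‖ ≤ K * Real.exp (-c * t) := fun θ t ht =>
    (hflow θ t ht).trans (le_mul_of_one_le_left (Real.exp_pos _).le hK1)
  have F1 : LinFam P h g b (fun t ω => (n t ω).1) K c := ⟨hK1, hc, h0, g0, he, hdec, hn.fst⟩
  have F2 : LinFam P h g b (fun t ω => (n t ω).2) K c := ⟨hK1, hc, h0, g0, he, hdec, hn.snd⟩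
  obtain ⟨K₃, hKK₃, F3⟩ := F1.triple h1 g1 hn
  obtain ⟨A', hA, hA'⟩ := exists_hasFDerivAt_tripleOp hh h1 h2
  obtain ⟨a', ha, ha'⟩ := exists_hasFDerivAt_tripleDrift hg g1 g2
  obtain ⟨R, hR⟩ : ∃ R, R = max K₃ (‖tripleL Θ E‖ * K) := ⟨_, rfl⟩
  have hR1 : K₃ ≤ R := hR ▸ le_max_left _ _
  have hR2 : ‖tripleL Θ E‖ * K ≤ R := hR ▸ le_max_right _ _
  have hc4 : c / 4 ≤ c := by linarith
  have hc40 : 0 < c / 4 := by positivity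
  exact ⟨R, c / 4, A', a', F1.mono (hKK₃.trans hR1) hc4 hc40, F2.mono (hKK₃.trans hR1) hc4 hc40,
    F3.mono hR1 le_rfl hc40, hA, ha, fun θ => (hA' θ).trans hR2,
    fun θ => (ha' θ).trans (hKK₃.trans hR1)⟩

end Triple

/-! ### Regularity of the integrand. -/

section Integrand

set_option maxSynthPendingDepth 3

variable {V : Type*} [NormedAddCommGroup V] [NormedSpace ℝ V]
  {E : Type*} [NormedAddCommGroup E] [NormedSpace ℝ E]
  {Θ : Type*} [NormedAddCommGroup Θ] [NormedSpace ℝ Θ]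
  {F : Type*} [NormedAddCommGroup F] [NormedSpace ℝ F] {C : ℝ} {N : ℕ}

theorem PolyC2.fderiv_comp {f : E → ℝ} (hf : PolyC2 C N (fderiv ℝ f)) {T : V →L[ℝ] E}
    (hT : ‖T‖ ≤ 1) (S : V →L[ℝ] Θ →L[ℝ] E) :
    PolyC2 (4 * ‖ContinuousLinearMap.compL ℝ Θ E ℝ‖ * C * ‖S‖) (N + 1)
      (fun v => (fderiv ℝ f (T v)).comp (S v)) :=
  PolyC2.bilin (ContinuousLinearMap.compL ℝ Θ E ℝ) (hf.comp_clm hT) (PolyC2.clm S)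

/-- The function `(f(x̄) - m) x̃ᵀ ∇f(x)`, where `S` identifies the dual of the parameter space with
a vector space. -/
noncomputable def tripleG (f : E → ℝ) (S : (Θ →L[ℝ] ℝ) →L[ℝ] F) (m : ℝ)
    (v : (E × (Θ →L[ℝ] E)) × E) : F :=
  (f v.2 - m) • S ((fderiv ℝ f v.1.1).comp v.1.2)

/-- These are the three functions whose growth the product potential requires. The last two contain
`Df` and must be `C²`. -/
theorem exists_polyC2_tripleG {f : E → ℝ} (hf : PolyC2 C N f) (hf' : PolyC2 C N (fderiv ℝ f))
    (S : (Θ →L[ℝ] ℝ) →L[ℝ] F) : ∃ (D : ℝ) (M : ℕ), 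
      PolyC2 D M (fun v : (E × (Θ →L[ℝ] E)) × E => f v.2) ∧
      PolyC2 D M (fun p : ((E × (Θ →L[ℝ] E)) × E) × (Θ →L[ℝ] (E × (Θ →L[ℝ] E)) × E) =>
        (fderiv ℝ (fun v : (E × (Θ →L[ℝ] E)) × E => f v.2) p.1).comp p.2) ∧
      PolyC2 D M (fun v : (E × (Θ →L[ℝ] E)) × E => S ((fderiv ℝ f v.1.1).comp v.1.2)) := by
  have h1 : PolyC2 C N (fun v : (E × (Θ →L[ℝ] E)) × E => f v.2) :=
    hf.comp_clm (ContinuousLinearMap.norm_snd_le ℝ (E × (Θ →L[ℝ] E)) E)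
  have hT2 : ‖(ContinuousLinearMap.snd ℝ (E × (Θ →L[ℝ] E)) E).comp (ContinuousLinearMap.fst ℝ
      ((E × (Θ →L[ℝ] E)) × E) (Θ →L[ℝ] (E × (Θ →L[ℝ] E)) × E))‖ ≤ 1 :=
    (ContinuousLinearMap.opNorm_comp_le _ _).trans (mul_le_one₀
      (ContinuousLinearMap.norm_snd_le ℝ _ _) (norm_nonneg _)
      (ContinuousLinearMap.norm_fst_le ℝ _ _))
  have hT3 : ‖(ContinuousLinearMap.fst ℝ E (Θ →L[ℝ] E)).comp (ContinuousLinearMap.fst ℝ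
      (E × (Θ →L[ℝ] E)) E)‖ ≤ 1 :=
    (ContinuousLinearMap.opNorm_comp_le _ _).trans (mul_le_one₀
      (ContinuousLinearMap.norm_fst_le ℝ _ _) (norm_nonneg _)
      (ContinuousLinearMap.norm_fst_le ℝ _ _))
  have h2 := hf'.fderiv_comp hT2 ((ContinuousLinearMap.compL ℝ Θ ((E × (Θ →L[ℝ] E)) × E) E
    (ContinuousLinearMap.snd ℝ (E × (Θ →L[ℝ] E)) E)).comp (ContinuousLinearMap.snd ℝ
      ((E × (Θ →L[ℝ] E)) × E) (Θ →L[ℝ] (E × (Θ →L[ℝ] E)) × E)))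
  have h3 := (hf'.fderiv_comp hT3 ((ContinuousLinearMap.snd ℝ E (Θ →L[ℝ] E)).comp
    (ContinuousLinearMap.fst ℝ (E × (Θ →L[ℝ] E)) E))).clm_comp S
  have hfd : ∀ w : (E × (Θ →L[ℝ] E)) × E, fderiv ℝ (fun v : (E × (Θ →L[ℝ] E)) × E => f v.2) w =
      (fderiv ℝ f w.2).comp (ContinuousLinearMap.snd ℝ (E × (Θ →L[ℝ] E)) E) := fun w =>
    (((hf.contDiff.differentiable (by norm_num) w.2).hasFDerivAt).comp w
      hasFDerivAt_snd).fderiv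
  generalize hc1 : 4 * ‖ContinuousLinearMap.compL ℝ Θ E ℝ‖ * C * _ = c1 at h2
  generalize hc2 : ‖S‖ * _ = c2 at h3
  refine ⟨max C (max c1 c2), N + 1, h1.mono (le_max_left _ _) (Nat.le_succ _), ?_,
    h3.mono ((le_max_right _ _).trans (le_max_right _ _)) le_rfl⟩
  simp only [hfd, ContinuousLinearMap.comp_assoc]
  exact h2.mono ((le_max_left _ _).trans (le_max_right _ _)) le_rfl

end Integrand

/-! ### The potential of the integrand. -/

section TriplePotential

set_option maxSynthPendingDepth 3

variable {Ω : Type*} [MeasurableSpace Ω] {P : Measure Ω} [IsProbabilityMeasure P]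
  {κ : Type*} [Fintype κ]
  {Θ : Type*} [NormedAddCommGroup Θ] [NormedSpace ℝ Θ] [FiniteDimensional ℝ Θ]
  {E : Type*} [NormedAddCommGroup E] [NormedSpace ℝ E] [FiniteDimensional ℝ E] [CompleteSpace E]
  [MeasurableSpace E] [BorelSpace E]
  {F : Type*} [NormedAddCommGroup F] [NormedSpace ℝ F] [CompleteSpace F]
  {g : Θ → E} {h : Θ → E →L[ℝ] E} {b : κ → E} {n : ℝ → Ω → E × E} {K c : ℝ}

/-- The third component is driven by the second noise, while stationarity is known for the process
driven by the first. Both noises have the same law, so the transition operators agree. -/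
theorem transOp_triple_snd {e : κ → E} (h1 : IsNoise P e (fun t ω => (n t ω).1))
    (h2 : IsNoise P e (fun t ω => (n t ω).2)) {f : E → ℝ} (hf : Continuous f) (θ : Θ) {t : ℝ}
    (ht : 0 ≤ t) (u : (E × (Θ →L[ℝ] E)) × E) (h3 : ∀ ω, Continuous fun t => tripleNoise Θ n t ω) :
    transOp P (tripleOp h θ) (tripleDrift g θ) (tripleNoise Θ n) t (fun v => f v.2) u =
      transOp P (h θ) (g θ) (fun t ω => (n t ω).1) t f u.2 := by
  rw [h1.transOp_congr h2 (h θ) (g θ) ht hf u.2]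
  unfold transOp
  refine integral_congr_ae (Eventually.of_forall fun ω => ?_)
  have hi : ∀ v, (ContinuousLinearMap.snd ℝ (E × (Θ →L[ℝ] E)) E) (tripleOp h θ v) =
      h θ ((ContinuousLinearMap.snd ℝ (E × (Θ →L[ℝ] E)) E) v) := fun v => by
    simp [tripleOp, tri_apply]
  exact congrArg f (map_affPath hi (tripleDrift g θ) u (h3 ω) t)

theorem exists_triple_potential
    {A' : Θ → Θ →L[ℝ] (E × (Θ →L[ℝ] E)) × E →L[ℝ] (E × (Θ →L[ℝ] E)) × E}
    {a' : Θ → Θ →L[ℝ] (E × (Θ →L[ℝ] E)) × E}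
    (h1 : LinFam P h g b (fun t ω => (n t ω).1) K c)
    (h2 : LinFam P h g b (fun t ω => (n t ω).2) K c)
    (h3 : LinFam P (tripleOp h) (tripleDrift g) (tripleDir Θ b) (tripleNoise Θ n) K c)
    (hA : ∀ θ, HasFDerivAt (tripleOp h) (A' θ) θ) (ha : ∀ θ, HasFDerivAt (tripleDrift g) (a' θ) θ)
    (hA' : ∀ θ, ‖A' θ‖ ≤ K) (ha' : ∀ θ, ‖a' θ‖ ≤ K) {C : ℝ} {N : ℕ} {f : E → ℝ}
    (hf : PolyC2 C N f) (hf' : PolyC2 C N (fderiv ℝ f)) (S : (Θ →L[ℝ] ℝ) →L[ℝ] F)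
    {ν : Θ → Measure E}
    (hν : ∀ θ, IsInvariantDist P (h θ) (g θ) (fun t ω => (n t ω).1) (ν θ)) :
    (∀ θ, Integrable f (ν θ)) ∧
    (∀ θ t, 0 ≤ t → ∀ u, Integrable (fun ω => tripleG f S (∫ w, f w ∂ν θ)
      (affPath (tripleOp h θ) (tripleDrift g θ) u (fun s => tripleNoise Θ n s ω) t)) P) ∧
    (∀ θ u, IntegrableOn (fun t => transOp P (tripleOp h θ) (tripleDrift g θ) (tripleNoise Θ n) t
      (tripleG f S (∫ w, f w ∂ν θ)) u) (Ioi 0)) ∧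
    (∀ θ u, fderiv ℝ (fun u => ∫ t in Ioi (0 : ℝ), transOp P (tripleOp h θ) (tripleDrift g θ)
        (tripleNoise Θ n) t (tripleG f S (∫ w, f w ∂ν θ)) u) u
          (tripleDrift g θ - tripleOp h θ u) +
      (1 / 2 : ℝ) • ∑ i, fderiv ℝ (fderiv ℝ fun u => ∫ t in Ioi (0 : ℝ), transOp P (tripleOp h θ)
        (tripleDrift g θ) (tripleNoise Θ n) t (tripleG f S (∫ w, f w ∂ν θ)) u) u
          (tripleDir Θ b i) (tripleDir Θ b i) = -tripleG f S (∫ w, f w ∂ν θ) u) ∧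
    ∃ (D : ℝ) (M : ℕ), (∀ θ, PolyC2 D M (fun u => ∫ t in Ioi (0 : ℝ), transOp P (tripleOp h θ)
        (tripleDrift g θ) (tripleNoise Θ n) t (tripleG f S (∫ w, f w ∂ν θ)) u)) ∧
      ∀ θ u, ∃ F' : Θ →L[ℝ] F, ‖F'‖ ≤ D * (1 + ‖u‖) ^ M ∧
        HasFDerivAt (fun η => ∫ t in Ioi (0 : ℝ), transOp P (tripleOp h η) (tripleDrift g η)
          (tripleNoise Θ n) t (tripleG f S (∫ w, f w ∂ν η)) u) F' θ := by
  obtain ⟨R, hR, herg⟩ := h1.exists_ergodic (E := ℝ) N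
  have herg' := fun θ => herg C f hf θ (ν θ) (hν θ)
  obtain ⟨D, M, hφ, hφ', hψ⟩ := exists_polyC2_tripleG hf hf' S
  have hC := hf.bdd.nonneg
  have hm : ∀ θ t, 0 ≤ t → ∀ u, ‖transOp P (tripleOp h θ) (tripleDrift g θ) (tripleNoise Θ n) t
      (fun v => f v.2) u - ∫ w, f w ∂ν θ‖ ≤ C * R * Real.exp (-c * t) * (1 + ‖u‖) ^ (N + 1) :=
    fun θ t ht u => by
      rw [transOp_triple_snd h1.noise h2.noise hf.contDiff.continuous θ ht u h3.noise.continuous]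
      refine ((herg' θ).2.2 t ht u.2).trans (mul_le_mul_of_nonneg_left ?_ (by positivity))
      exact pow_le_pow_left₀ (by positivity) (by linarith [norm_snd_le u]) _
  -- The pair `(X, X̃)` sees only the first noise and `X̄` only the second, so the expectation of
  -- the product factorises.
  have hfac : ∀ θ t, 0 ≤ t → ∀ u, transOp P (tripleOp h θ) (tripleDrift g θ) (tripleNoise Θ n) t
      (fun v => f v.2 • S ((fderiv ℝ f v.1.1).comp v.1.2)) u =
      transOp P (tripleOp h θ) (tripleDrift g θ) (tripleNoise Θ n) t (fun v => f v.2) u •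
      transOp P (tripleOp h θ) (tripleDrift g θ) (tripleNoise Θ n) t
        (fun v => S ((fderiv ℝ f v.1.1).comp v.1.2)) u := fun θ t ht u => by
    refine IsNoise.transOp_smul (e₁ := fun i => (b i, (0 : Θ →L[ℝ] E))) (e₂ := b) h3.noise
      (prolOp h (fderiv ℝ h) θ) (h θ) (tripleDrift g θ) ht hf.contDiff.continuous
      (ψ := fun p => S ((fderiv ℝ f p.1).comp p.2)) ?_ u
    exact S.continuous.comp ((hf'.contDiff.continuous.comp continuous_fst).clm_comp continuous_snd)
  obtain ⟨D', M', hD', hdec, hder⟩ := h3.exists_product_potential hA ha hA' ha' hφ hφ' hψ hm hfac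
  -- The stationary means are bounded uniformly in `θ`, hence so are the growth constants of the
  -- centred integrand.
  have hG : ∃ (D : ℝ) (M : ℕ), ∀ θ, PolyC2 D M
      (tripleG f S (∫ w, f w ∂ν θ) : (E × (Θ →L[ℝ] E)) × E → F) := by
    refine ⟨_, _, fun θ => PolyC2.bilin (ContinuousLinearMap.lsmul ℝ ℝ)
      ((hφ.sub_const (∫ w, f w ∂ν θ)).mono (add_le_add_right (herg' θ).2.1 D) le_rfl) hψ⟩
  obtain ⟨D₁, M₁, hG⟩ := hG
  refine ⟨fun θ => (herg' θ).1, fun θ t ht u => h3.integrable_comp θ ht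
    (hG θ).contDiff.continuous (hG θ).bdd u, fun θ u => h3.integrableOn_transOp θ
    (hG θ).contDiff.continuous (hdec θ) u, fun θ u => h3.poisson_equation θ (hG θ) (hdec θ) u, ?_⟩
  have hpot := fun θ => h3.potential_polyC2 θ (hG θ) (hdec θ)
  generalize max (D' / c) _ = D₂ at hpot
  refine ⟨max D₂ D', max (max M₁ M') M', fun θ => (hpot θ).mono (le_max_left _ _)
    (le_max_left _ _), fun θ u => ?_⟩
  obtain ⟨F', hF', hd⟩ := hder θ u
  refine ⟨F', hF'.trans (mul_le_mul (le_max_right _ _) (pow_le_pow_right₀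
    (by linarith [norm_nonneg u]) (le_max_right _ _)) (by positivity)
    (hD'.trans (le_max_right _ _))), hd⟩

end TriplePotential

/-! ### Derivatives of restrictions to affine subspaces. -/

section Sections

variable {V : Type*} [NormedAddCommGroup V] [NormedSpace ℝ V]
  {W : Type*} [NormedAddCommGroup W] [NormedSpace ℝ W]
  {F : Type*} [NormedAddCommGroup F] [NormedSpace ℝ F] {Φ : V → F}

theorem fderiv_comp_clm_add (hΦ : Differentiable ℝ Φ) (L : W →L[ℝ] V) (v : V) (x : W) :
    fderiv ℝ (fun x => Φ (L x + v)) x = (fderiv ℝ Φ (L x + v)).comp L :=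
  ((hΦ (L x + v)).hasFDerivAt.comp x (L.hasFDerivAt.add_const v)).fderiv

theorem iteratedFDeriv_two_comp_clm_add (hΦ : ContDiff ℝ 2 Φ) (L : W →L[ℝ] V) (v : V) (x : W) :
    iteratedFDeriv ℝ 2 (fun x => Φ (L x + v)) x =
      (iteratedFDeriv ℝ 2 Φ (L x + v)).compContinuousLinearMap fun _ => L := by
  have h1 : ContDiff ℝ 2 fun w => Φ (w + v) := hΦ.comp (contDiff_id.add contDiff_const)
  have h2 := L.iteratedFDeriv_comp_right h1 x (i := 2) le_rfl
  rw [iteratedFDeriv_comp_add_right'] at h2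
  exact h2

theorem iteratedFDeriv_two_comp_clm_add_apply (hΦ : ContDiff ℝ 2 Φ) (L : W →L[ℝ] V) (v : V)
    (x w w' : W) : iteratedFDeriv ℝ 2 (fun x => Φ (L x + v)) x ![w, w'] =
      fderiv ℝ (fderiv ℝ Φ) (L x + v) (L w) (L w') := by
  rw [iteratedFDeriv_two_comp_clm_add hΦ,
    ContinuousMultilinearMap.compContinuousLinearMap_apply, iteratedFDeriv_two_apply]
  rfl

theorem continuous_iteratedFDeriv_two_comp (hΦ : ContDiff ℝ 2 Φ) (L : W →L[ℝ] V) :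
    Continuous fun u =>
      (iteratedFDeriv ℝ 2 Φ u).compContinuousLinearMap fun _ : Fin 2 => L :=
  (ContinuousMultilinearMap.compContinuousLinearMapL (𝕜 := ℝ) (F := F)
    (fun _ : Fin 2 => L)).continuous.comp (hΦ.continuous_iteratedFDeriv le_rfl)

theorem laplacian_comp_clm_add {E : Type*} [NormedAddCommGroup E] [InnerProductSpace ℝ E]
    [FiniteDimensional ℝ E] {κ : Type*} [Fintype κ] (b : OrthonormalBasis κ ℝ E)
    (hΦ : ContDiff ℝ 2 Φ) (L : E →L[ℝ] V) (v : V) (x : E) :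
    Laplacian.laplacian (fun x => Φ (L x + v)) x =
      ∑ i, fderiv ℝ (fderiv ℝ Φ) (L x + v) (L (b i)) (L (b i)) := by
  rw [InnerProductSpace.laplacian_eq_iteratedFDeriv_orthonormalBasis _ b]
  simp only [iteratedFDeriv_two_comp_clm_add_apply hΦ]

end Sections

/-! ### Partial derivatives on the triple product. -/

section TripleSections

variable {Θ : Type*} [NormedAddCommGroup Θ] [NormedSpace ℝ Θ]
  {E : Type*} [NormedAddCommGroup E]

/-- The inclusion of the first component of the triple. -/
noncomputable def inX (Θ E : Type*) [NormedAddCommGroup Θ] [NormedSpace ℝ Θ]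
    [NormedAddCommGroup E] [NormedSpace ℝ E] : E →L[ℝ] (E × (Θ →L[ℝ] E)) × E :=
  (ContinuousLinearMap.inl ℝ (E × (Θ →L[ℝ] E)) E).comp (ContinuousLinearMap.inl ℝ E (Θ →L[ℝ] E))

/-- The inclusion of the second component of the triple. -/
noncomputable def inY (Θ E : Type*) [NormedAddCommGroup Θ] [NormedSpace ℝ Θ]
    [NormedAddCommGroup E] [NormedSpace ℝ E] : (Θ →L[ℝ] E) →L[ℝ] (E × (Θ →L[ℝ] E)) × E :=
  (ContinuousLinearMap.inl ℝ (E × (Θ →L[ℝ] E)) E).comp (ContinuousLinearMap.inr ℝ E (Θ →L[ℝ] E))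

/-- The inclusion of the third component of the triple. -/
noncomputable def inZ (Θ E : Type*) [NormedAddCommGroup Θ] [NormedSpace ℝ Θ]
    [NormedAddCommGroup E] [NormedSpace ℝ E] : E →L[ℝ] (E × (Θ →L[ℝ] E)) × E :=
  ContinuousLinearMap.inr ℝ (E × (Θ →L[ℝ] E)) E

theorem inX_add [NormedSpace ℝ E] (x : E) (y : Θ →L[ℝ] E) (z : E) :
    inX Θ E x + ((0, y), z) = ((x, y), z) := by
  simp [inX]

theorem inY_add [NormedSpace ℝ E] (x : E) (y : Θ →L[ℝ] E) (z : E) :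
    inY Θ E y + ((x, 0), z) = ((x, y), z) := by
  simp [inY]

theorem inZ_add [NormedSpace ℝ E] (x : E) (y : Θ →L[ℝ] E) (z : E) :
    inZ Θ E z + ((x, y), 0) = ((x, y), z) := by
  simp [inZ]

section Normed

variable [NormedSpace ℝ E] {F : Type*} [NormedAddCommGroup F] [NormedSpace ℝ F]
  {Φ : (E × (Θ →L[ℝ] E)) × E → F} (x : E) (y : Θ →L[ℝ] E) (z : E)

theorem fderiv_section_x (hΦ : ContDiff ℝ 2 Φ) :
    fderiv ℝ (fun x => Φ ((x, y), z)) x = (fderiv ℝ Φ ((x, y), z)).comp (inX Θ E) := by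
  have := fderiv_comp_clm_add (hΦ.differentiable (by norm_num)) (inX Θ E) ((0, y), z) x
  simpa only [inX_add] using this

theorem fderiv_section_y (hΦ : ContDiff ℝ 2 Φ) :
    fderiv ℝ (fun y => Φ ((x, y), z)) y = (fderiv ℝ Φ ((x, y), z)).comp (inY Θ E) := by
  have := fderiv_comp_clm_add (hΦ.differentiable (by norm_num)) (inY Θ E) ((x, 0), z) y
  simpa only [inY_add] using this

theorem fderiv_section_z (hΦ : ContDiff ℝ 2 Φ) :
    fderiv ℝ (fun z => Φ ((x, y), z)) z = (fderiv ℝ Φ ((x, y), z)).comp (inZ Θ E) := by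
  have := fderiv_comp_clm_add (hΦ.differentiable (by norm_num)) (inZ Θ E) ((x, y), 0) z
  simpa only [inZ_add] using this

theorem iteratedFDeriv_two_section_x (hΦ : ContDiff ℝ 2 Φ) :
    iteratedFDeriv ℝ 2 (fun x => Φ ((x, y), z)) x =
      (iteratedFDeriv ℝ 2 Φ ((x, y), z)).compContinuousLinearMap fun _ => inX Θ E := by
  have := iteratedFDeriv_two_comp_clm_add hΦ (inX Θ E) ((0, y), z) x
  simpa only [inX_add] using this

theorem iteratedFDeriv_two_section_z (hΦ : ContDiff ℝ 2 Φ) :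
    iteratedFDeriv ℝ 2 (fun z => Φ ((x, y), z)) z =
      (iteratedFDeriv ℝ 2 Φ ((x, y), z)).compContinuousLinearMap fun _ => inZ Θ E := by
  have := iteratedFDeriv_two_comp_clm_add hΦ (inZ Θ E) ((x, y), 0) z
  simpa only [inZ_add] using this

theorem contDiff_section_x (hΦ : ContDiff ℝ 2 Φ) : ContDiff ℝ 2 fun x => Φ ((x, y), z) :=
  hΦ.comp ((contDiff_id.prodMk contDiff_const).prodMk contDiff_const)

theorem contDiff_section_y (hΦ : ContDiff ℝ 2 Φ) : ContDiff ℝ 2 fun y => Φ ((x, y), z) :=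
  hΦ.comp ((contDiff_const.prodMk contDiff_id).prodMk contDiff_const)

theorem contDiff_section_z (hΦ : ContDiff ℝ 2 Φ) : ContDiff ℝ 2 fun z => Φ ((x, y), z) :=
  hΦ.comp (contDiff_const.prodMk contDiff_id)

theorem norm_inX_le : ‖inX Θ E‖ ≤ 1 :=
  ContinuousLinearMap.opNorm_le_bound _ zero_le_one fun v => by
    simp [inX]

theorem norm_inZ_le : ‖inZ Θ E‖ ≤ 1 :=
  ContinuousLinearMap.opNorm_le_bound _ zero_le_one fun v => by
    simp [inZ]

theorem norm_fderiv_comp_inX_le (u : (E × (Θ →L[ℝ] E)) × E) :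
    ‖(fderiv ℝ Φ u).comp (inX Θ E)‖ ≤ ‖fderiv ℝ Φ u‖ :=
  (ContinuousLinearMap.opNorm_comp_le _ _).trans
    (mul_le_of_le_one_right (norm_nonneg _) norm_inX_le)

theorem norm_fderiv_comp_inZ_le (u : (E × (Θ →L[ℝ] E)) × E) :
    ‖(fderiv ℝ Φ u).comp (inZ Θ E)‖ ≤ ‖fderiv ℝ Φ u‖ :=
  (ContinuousLinearMap.opNorm_comp_le _ _).trans
    (mul_le_of_le_one_right (norm_nonneg _) norm_inZ_le)

end Normed

/-- The generator of the triple in terms of the total derivatives. -/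
theorem generator_section [InnerProductSpace ℝ E] [FiniteDimensional ℝ E] {κ : Type*} [Fintype κ]
    (b : OrthonormalBasis κ ℝ E)
    {Φ : (E × (Θ →L[ℝ] E)) × E → ℝ} (hΦ : ContDiff ℝ 2 Φ) (g : Θ → E) (h : Θ → E →L[ℝ] E) (σ : ℝ)
    (θ : Θ) (x : E) (y : Θ →L[ℝ] E) (z : E) :
    fderiv ℝ (fun x' => Φ ((x', y), z)) x (g θ - h θ x)
      + σ ^ 2 / 2 * Laplacian.laplacian (fun x' => Φ ((x', y), z)) x
      + fderiv ℝ (fun y' => Φ ((x, y'), z)) y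
          (fderiv ℝ g θ - (fderiv ℝ h θ).flip x - (h θ).comp y)
      + fderiv ℝ (fun z' => Φ ((x, y), z')) z (g θ - h θ z)
      + σ ^ 2 / 2 * Laplacian.laplacian (fun z' => Φ ((x, y), z')) z =
    fderiv ℝ Φ ((x, y), z) (tripleDrift g θ - tripleOp h θ ((x, y), z)) +
      (1 / 2 : ℝ) • ∑ i, fderiv ℝ (fderiv ℝ Φ) ((x, y), z) (tripleDir Θ (fun i => σ • b i) i)
        (tripleDir Θ (fun i => σ • b i) i) := by
  have e1 := laplacian_comp_clm_add b hΦ (inX Θ E) ((0, y), z) x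
  have e2 := laplacian_comp_clm_add b hΦ (inZ Θ E) ((x, y), 0) z
  simp only [inX_add, inZ_add] at e1 e2
  rw [e1, e2, fderiv_section_x x y z hΦ, fderiv_section_y x y z hΦ, fderiv_section_z x y z hΦ]
  -- The drift splits along the three inclusions. The noise directions `σ • b i` in the first and
  -- third slots produce the two terms `σ² / 2` times a Laplacian.
  have hd : tripleDrift g θ - tripleOp h θ ((x, y), z) = inX Θ E (g θ - h θ x) +
      inY Θ E (fderiv ℝ g θ - (fderiv ℝ h θ).flip x - (h θ).comp y) + inZ Θ E (g θ - h θ z) := by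
    refine Prod.ext (Prod.ext ?_ ?_) ?_
    · simp [tripleDrift, tripleOp, prolOp, tri_apply, inX, inY, inZ]
    · simp [tripleDrift, tripleOp, prolOp, tri_apply, inX, inY, inZ, sub_sub]
    · simp [tripleDrift, tripleOp, prolOp, tri_apply, inX, inY, inZ]
  have hl : ∀ i, tripleDir Θ (fun i => σ • b i) (Sum.inl i) = σ • inX Θ E (b i) := fun i => by
    simp [tripleDir, inX]
  have hr : ∀ i, tripleDir Θ (fun i => σ • b i) (Sum.inr i) = σ • inZ Θ E (b i) := fun i => by
    simp [tripleDir, inZ]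
  rw [hd, Fintype.sum_sum_type]
  simp only [hl, hr, map_add, map_smul, smul_apply, ContinuousLinearMap.comp_apply,
    smul_eq_mul, ← mul_assoc, ← Finset.mul_sum]
  ring

end TripleSections

/-! ### Identification of given solutions with the explicit formula. -/

section TriplePath

variable {Θ : Type*} [NormedAddCommGroup Θ] [NormedSpace ℝ Θ]
  {E : Type*} [NormedAddCommGroup E] [NormedSpace ℝ E] [CompleteSpace E]

theorem eq_affPath_of_nnreal {a x : E} {H : E →L[ℝ] E} {w : ℝ → E} (hw : Continuous w)
    {X : ℝ≥0 → E} (hXc : Continuous X)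
    (hX : ∀ t : ℝ≥0, X t = x + (∫ s in (0 : ℝ)..t, (a - H (X s.toNNReal))) + w t) (t : ℝ≥0) :
    X t = affPath H a x w t := by
  have h1 := eq_affPath H hw (hXc.comp continuous_real_toNNReal) (fun t ht => by
    have := hX t.toNNReal
    rwa [Real.coe_toNNReal t ht] at this) t.2
  simpa using h1

/-- The three integral equations are the coordinates of one integral equation in the product space,
whose solution is unique. -/
theorem eq_affPath_triple {g : Θ → E} {h : Θ → E →L[ℝ] E} {θ : Θ} {w w' : ℝ → E}
    (hw : Continuous w) (hw' : Continuous w') {X Z : ℝ≥0 → E} {Y : ℝ≥0 → Θ →L[ℝ] E}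
    {x z : E} {y : Θ →L[ℝ] E} (hXc : Continuous X) (hYc : Continuous Y) (hZc : Continuous Z)
    (hX : ∀ t : ℝ≥0, X t = x + (∫ s in (0 : ℝ)..t, (g θ - h θ (X s.toNNReal))) + w t)
    (hY : ∀ t : ℝ≥0, Y t = y + ∫ s in (0 : ℝ)..t,
      (fderiv ℝ g θ - (fderiv ℝ h θ).flip (X s.toNNReal) - (h θ).comp (Y s.toNNReal)))
    (hZ : ∀ t : ℝ≥0, Z t = z + (∫ s in (0 : ℝ)..t, (g θ - h θ (Z s.toNNReal))) + w' t)
    (t : ℝ≥0) : ((X t, Y t), Z t) =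
      affPath (tripleOp h θ) (tripleDrift g θ) ((x, y), z) (fun s => ((w s, 0), w' s)) t := by
  have hc : Continuous fun t : ℝ≥0 => ((X t, Y t), Z t) := (hXc.prodMk hYc).prodMk hZc
  refine eq_affPath_of_nnreal (w := fun s => ((w s, (0 : Θ →L[ℝ] E)), w' s))
    (X := fun t => ((X t, Y t), Z t)) (by fun_prop) hc (fun t => ?_) t
  have hi : IntervalIntegrable (fun s : ℝ => tripleDrift g θ - tripleOp h θ
      ((X s.toNNReal, Y s.toNNReal), Z s.toNNReal)) volume 0 t :=
    (continuous_const.sub ((tripleOp h θ).continuous.comp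
      (hc.comp continuous_real_toNNReal))).intervalIntegrable _ _
  refine Prod.ext (Prod.ext ?_ ?_) ?_
  · have h1 := ((ContinuousLinearMap.fst ℝ E (Θ →L[ℝ] E)).comp (ContinuousLinearMap.fst ℝ
      (E × (Θ →L[ℝ] E)) E)).intervalIntegral_comp_comm hi
    refine (hX t).trans (congrArg (fun v => x + v + w t) (Eq.trans ?_ h1))
    simp [tripleDrift, tripleOp, prolOp, tri_apply]
  · have h1 := ((ContinuousLinearMap.snd ℝ E (Θ →L[ℝ] E)).comp (ContinuousLinearMap.fst ℝ
      (E × (Θ →L[ℝ] E)) E)).intervalIntegral_comp_comm hi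
    refine (hY t).trans (Eq.trans (congrArg (fun v => y + v) (Eq.trans ?_ h1)) (add_zero _).symm)
    simp [tripleDrift, tripleOp, prolOp, tri_apply, sub_sub]
  · have h1 := (ContinuousLinearMap.snd ℝ (E × (Θ →L[ℝ] E)) E).intervalIntegral_comp_comm hi
    refine (hZ t).trans (congrArg (fun v => z + v + w' t) (Eq.trans ?_ h1))
    simp [tripleDrift, tripleOp, tri_apply]

end TriplePath

/-! ### Conversion between forms of polynomial growth. -/

section Growth

theorem exists_polyC2_of_growth {E : Type*} [NormedAddCommGroup E] [NormedSpace ℝ E] {f : E → ℝ}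
    (hf : ContDiff ℝ 3 f) (hfb : ∃ C m : ℝ, 0 < m ∧ ∀ x,
      |f x| + ∑ i ∈ Finset.Icc 1 3, ‖iteratedFDeriv ℝ i f x‖ ≤ C * (1 + ‖x‖ ^ m)) :
    ∃ (C : ℝ) (N : ℕ), PolyC2 C N f ∧ PolyC2 C N (fderiv ℝ f) := by
  obtain ⟨C, m, hm, hb⟩ := hfb
  -- The real exponent is rounded up, and the factor `2` accounts for the two summands of `1 + ‖x‖ ^
  -- m`.
  have hb' : ∀ i ≤ 3, ∀ x, ‖iteratedFDeriv ℝ i f x‖ ≤ 2 * |C| * (1 + ‖x‖) ^ ⌈m⌉₊ := fun i hi x => by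
    have h1 : ‖iteratedFDeriv ℝ i f x‖ ≤
        |f x| + ∑ i ∈ Finset.Icc 1 3, ‖iteratedFDeriv ℝ i f x‖ := by
      rcases Nat.eq_zero_or_pos i with rfl | h0
      · rw [norm_iteratedFDeriv_zero, Real.norm_eq_abs]
        exact le_add_of_nonneg_right (by positivity)
      · exact (Finset.single_le_sum (f := fun i => ‖iteratedFDeriv ℝ i f x‖)
          (fun _ _ => norm_nonneg _) (Finset.mem_Icc.2 ⟨h0, hi⟩)).trans
          (le_add_of_nonneg_left (abs_nonneg _))
    have hx1 : 1 ≤ 1 + ‖x‖ := by linarith [norm_nonneg x]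
    have h2 : ‖x‖ ^ m ≤ (1 + ‖x‖) ^ ⌈m⌉₊ :=
      (Real.rpow_le_rpow (norm_nonneg x) (by linarith) hm.le).trans
        ((Real.rpow_le_rpow_of_exponent_le hx1 (Nat.le_ceil m)).trans_eq (Real.rpow_natCast _ _))
    have h3 : (1 : ℝ) ≤ (1 + ‖x‖) ^ ⌈m⌉₊ := one_le_pow₀ hx1
    calc ‖iteratedFDeriv ℝ i f x‖ ≤ C * (1 + ‖x‖ ^ m) := h1.trans (hb x)
      _ ≤ |C| * (1 + ‖x‖ ^ m) := mul_le_mul_of_nonneg_right (le_abs_self C) (by positivity)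
      _ ≤ |C| * ((1 + ‖x‖) ^ ⌈m⌉₊ + (1 + ‖x‖) ^ ⌈m⌉₊) :=
        mul_le_mul_of_nonneg_left (by linarith) (abs_nonneg C)
      _ = _ := by ring
  refine ⟨2 * |C|, ⌈m⌉₊, .of_iteratedFDeriv (hf.of_le (by norm_num)) fun i hi =>
    hb' i (by omega), .of_iteratedFDeriv (hf.fderiv_right (by norm_num)) fun i hi x => ?_⟩
  rw [norm_iteratedFDeriv_fderiv]
  exact hb' (i + 1) (by omega) x

/-- With `M` the largest of `1, a, b, c`, one has `1 + r ≤ 4 * M`. Raising the exponent to `N + 1`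
keeps it positive even when `N = 0`. -/
theorem one_add_pow_le {a b c r : ℝ} (ha : 0 ≤ a) (hb : 0 ≤ b) (hc : 0 ≤ c) (hr : r ≤ a + b + c)
    (h0 : 0 ≤ r) (N : ℕ) : (1 + r) ^ N ≤
      4 ^ (N + 1) * (1 + a ^ ((N + 1 : ℕ) : ℝ) + b ^ ((N + 1 : ℕ) : ℝ) + c ^ ((N + 1 : ℕ) : ℝ)) := by
  simp only [Real.rpow_natCast]
  refine (pow_le_pow_right₀ (by linarith) (Nat.le_succ N)).trans ?_
  obtain ⟨M, h1, h2, h3, h4, h5⟩ : ∃ M, 1 ≤ M ∧ a ≤ M ∧ b ≤ M ∧ c ≤ M ∧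
      M ^ (N + 1) ≤ 1 + a ^ (N + 1) + b ^ (N + 1) + c ^ (N + 1) := by
    have p1 := pow_nonneg ha (N + 1)
    have p2 := pow_nonneg hb (N + 1)
    have p3 := pow_nonneg hc (N + 1)
    refine ⟨max (max 1 a) (max b c), by simp, by simp, by simp, by simp, ?_⟩
    rcases max_choice (max 1 a) (max b c) with h | h <;> rw [h]
    · rcases max_choice 1 a with h | h <;> rw [h] <;> [rw [one_pow]; skip] <;> linarith
    · rcases max_choice b c with h | h <;> rw [h] <;> linarith
  calc (1 + r) ^ (N + 1) ≤ (4 * M) ^ (N + 1) := pow_le_pow_left₀ (by linarith) (by linarith) _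
    _ = 4 ^ (N + 1) * M ^ (N + 1) := mul_pow _ _ _
    _ ≤ _ := mul_le_mul_of_nonneg_left h5 (by positivity)

end Growth

/-! ### The Riesz identification of the integrand. -/

section Dual

set_option maxSynthPendingDepth 3

/-- The identification of the dual of a Euclidean space with the space. -/
noncomputable def dualVec (l : ℕ) : (Vec l →L[ℝ] ℝ) →L[ℝ] Vec l :=
  LinearMap.toContinuousLinearMap
    { toFun := (InnerProductSpace.toDual ℝ (Vec l)).symm
      map_add' := map_add _
      map_smul' := fun r L => by simp }

/-- The vector `x̃ᵀ ∇f(x)` is the Riesz representative of the functional `Df(x) ∘ x̃`. -/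
theorem poissonG_eq_tripleG {d l : ℕ} (f : Vec d → ℝ) (ν : Measure (Vec d)) (x : Vec d)
    (y : Mat d l) (z : Vec d) :
    poissonG f ν x y z = tripleG f (dualVec l) (∫ w, f w ∂ν) ((x, y), z) := by
  unfold poissonG tripleG
  congr 1
  refine ext_inner_right ℝ fun w => ?_
  have h1 : inner ℝ (dualVec l ((fderiv ℝ f x).comp y)) w = ((fderiv ℝ f x).comp y) w :=
    InnerProductSpace.toDual_symm_apply
  have h2 : inner ℝ (gradient f x) (y w) = fderiv ℝ f x (y w) :=
    InnerProductSpace.toDual_symm_apply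
  rw [h1, ContinuousLinearMap.adjoint_inner_left, h2]
  rfl

end Dual

/-! ### The given processes in terms of the noise. -/

section Processes

set_option maxSynthPendingDepth 3

variable {Ω : Type*} [MeasurableSpace Ω] {P : Measure Ω} [IsProbabilityMeasure P] {d l : ℕ}

theorem IsBrownianVec.exists_isNoise_smul {W W' : ℝ≥0 → Ω → Vec d} (hW : IsBrownianVec W P)
    (hW' : IsBrownianVec W' P) (hind : IndepFun (fun ω t => W t ω) (fun ω t => W' t ω) P) (σ : ℝ) :
    ∃ n : ℝ → Ω → Vec d × Vec d,
      IsNoise P (Sum.elim (fun i => (σ • EuclideanSpace.basisFun (Fin d) ℝ i, (0 : Vec d)))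
        (fun i => ((0 : Vec d), σ • EuclideanSpace.basisFun (Fin d) ℝ i))) n ∧
      ∀ᵐ ω ∂P, ∀ t : ℝ≥0, n t ω = (σ • W t ω, σ • W' t ω) := by
  obtain ⟨n, hn, hae⟩ := hW.exists_isNoise hW' hind
  have h1 := hn.map (σ • ContinuousLinearMap.id ℝ (Vec d × Vec d))
  have h2 : (fun i => (σ • ContinuousLinearMap.id ℝ (Vec d × Vec d)) (Sum.elim
        (fun i => (EuclideanSpace.basisFun (Fin d) ℝ i, (0 : Vec d)))
        (fun i => ((0 : Vec d), EuclideanSpace.basisFun (Fin d) ℝ i)) i)) =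
      Sum.elim (fun i => (σ • EuclideanSpace.basisFun (Fin d) ℝ i, (0 : Vec d)))
        (fun i => ((0 : Vec d), σ • EuclideanSpace.basisFun (Fin d) ℝ i)) := by
    funext i
    rcases i with i | i <;> simp
  rw [h2] at h1
  refine ⟨_, h1, ?_⟩
  filter_upwards [hae] with ω hω t
  rw [hω, Real.toNNReal_coe]
  rfl

variable {n : ℝ → Ω → Vec d × Vec d} {σ : ℝ} {W W' : ℝ≥0 → Ω → Vec d}

/-- One null set serves all times, since the equations hold pathwise. -/
theorem ae_eq_affPath_triple (hn : ∀ ω, Continuous fun t => n t ω)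
    (hae : ∀ᵐ ω ∂P, ∀ t : ℝ≥0, n t ω = (σ • W t ω, σ • W' t ω))
    {g : Vec l → Vec d} {h : Vec l → Mat d d} {θ : Vec l} {x z : Vec d} {y : Mat d l}
    {X Z : ℝ≥0 → Ω → Vec d} {Y : ℝ≥0 → Ω → Mat d l}
    (hX : IsOUSolution P (g θ) (h θ) σ W x X) (hY : IsSensitivitySolution P g h θ X y Y)
    (hZ : IsOUSolution P (g θ) (h θ) σ W' z Z) :
    ∀ᵐ ω ∂P, ∀ t : ℝ≥0, ((X t ω, Y t ω), Z t ω) =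
      affPath (tripleOp h θ) (tripleDrift g θ) ((x, y), z)
        (fun s => tripleNoise (Vec l) n s ω) t := by
  filter_upwards [hae, hX, hY, hZ] with ω h1 ⟨hXc, hX'⟩ ⟨hYc, hY'⟩ ⟨hZc, hZ'⟩ t
  refine eq_affPath_triple (w := fun s => (n s ω).1) (w' := fun s => (n s ω).2)
    (continuous_fst.comp (hn ω)) (continuous_snd.comp (hn ω)) hXc hYc hZc
    (fun t => ?_) hY' (fun t => ?_) t
  · rw [h1 t]; exact hX' t
  · rw [h1 t]; exact hZ' t

theorem IsStationaryDist.isInvariantDist (hn : ∀ ω, Continuous fun t => n t ω)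
    (hae : ∀ᵐ ω ∂P, ∀ t : ℝ≥0, n t ω = (σ • W t ω, σ • W' t ω))
    {a : Vec d} {H : Mat d d} {X : Vec d → ℝ≥0 → Ω → Vec d} {ν : Measure (Vec d)}
    (hX : ∀ x, IsOUSolution P a H σ W x (X x)) (hν : IsStationaryDist P X ν) :
    IsInvariantDist P H a (fun t ω => (n t ω).1) ν := by
  refine ⟨hν.isProbabilityMeasure, fun t ht B hB => ?_⟩
  rw [← hν.invariant t.toNNReal B hB]
  refine lintegral_congr fun x => measure_congr ?_
  filter_upwards [hae, hX x] with ω h1 ⟨hXc, hX'⟩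
  have h2 := eq_affPath_of_nnreal (w := fun s => (n s ω).1) (continuous_fst.comp (hn ω)) hXc
    (fun t => by rw [h1 t]; exact hX' t) t.toNNReal
  rw [Real.coe_toNNReal t ht] at h2
  exact congrArg (· ∈ B) h2.symm

end Processes

/-! ### From the total equation to a classical solution. -/

section Classical

set_option maxSynthPendingDepth 3

variable {d l : ℕ}

/-- Joint `C²` regularity on the product space contains all the required partial regularity; the
scalar equations follow by composing with coordinate functionals. -/
theorem isClassicalPoissonSolution_of_poisson {g : Vec l → Vec d} {h : Vec l → Mat d d} {σ : ℝ}
    {θ : Vec l} {G : (Vec d × Mat d l) × Vec d → Vec l} {Φ : (Vec d × Mat d l) × Vec d → Vec l}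
    (hΦ : ContDiff ℝ 2 Φ)
    (heq : ∀ u, fderiv ℝ Φ u (tripleDrift g θ - tripleOp h θ u) +
      (1 / 2 : ℝ) • ∑ i, fderiv ℝ (fderiv ℝ Φ) u
        (tripleDir (Vec l) (fun i => σ • EuclideanSpace.basisFun (Fin d) ℝ i) i)
        (tripleDir (Vec l) (fun i => σ • EuclideanSpace.basisFun (Fin d) ℝ i) i) = G u) :
    IsClassicalPoissonSolution g h σ θ (fun x y z => G ((x, y), z))
      (fun x y z => Φ ((x, y), z)) := by
  have hp : Continuous fun p : Vec d × Mat d l × Vec d => ((p.1, p.2.1), p.2.2) := by fun_prop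
  have hΦ1 : Continuous (fderiv ℝ Φ) := hΦ.continuous_fderiv (by norm_num)
  refine ⟨fun y z => contDiff_section_x y z hΦ,
    fun x z => (contDiff_section_y x z hΦ).of_le (by norm_num),
    fun x y => contDiff_section_z x y hΦ, hΦ.continuous.comp hp, ?_, ?_, ?_, ?_, ?_, ?_⟩
  · simp only [fderiv_section_x _ _ _ hΦ]
    exact (hΦ1.comp hp).clm_comp continuous_const
  · simp only [iteratedFDeriv_two_section_x _ _ _ hΦ]
    exact (continuous_iteratedFDeriv_two_comp hΦ _).comp hp
  · simp only [fderiv_section_y _ _ _ hΦ]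
    exact (hΦ1.comp hp).clm_comp continuous_const
  · simp only [fderiv_section_z _ _ _ hΦ]
    exact (hΦ1.comp hp).clm_comp continuous_const
  · simp only [iteratedFDeriv_two_section_z _ _ _ hΦ]
    exact (continuous_iteratedFDeriv_two_comp hΦ _).comp hp
  · intro x y z i
    have hL : ContDiff ℝ 2 fun u => (EuclideanSpace.proj i : Vec l →L[ℝ] ℝ) (Φ u) :=
      (EuclideanSpace.proj i : Vec l →L[ℝ] ℝ).contDiff.comp hΦ
    have h1 : fderiv ℝ (fun u => (EuclideanSpace.proj i : Vec l →L[ℝ] ℝ) (Φ u)) =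
        fun u => (EuclideanSpace.proj i : Vec l →L[ℝ] ℝ).comp (fderiv ℝ Φ u) := funext fun u =>
      ((EuclideanSpace.proj i : Vec l →L[ℝ] ℝ).hasFDerivAt.comp u
        (hΦ.differentiable (by norm_num) u).hasFDerivAt).fderiv
    have h2 : ∀ u v w, fderiv ℝ (fderiv ℝ fun u => (EuclideanSpace.proj i : Vec l →L[ℝ] ℝ) (Φ u))
        u v w = (EuclideanSpace.proj i : Vec l →L[ℝ] ℝ) (fderiv ℝ (fderiv ℝ Φ) u v w) :=
      fun u v w => by
        have h3 := ((ContinuousLinearMap.compL ℝ ((Vec d × Mat d l) × Vec d) (Vec l) ℝ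
          (EuclideanSpace.proj i)).hasFDerivAt.comp u
          ((hΦ.fderiv_right (m := 1) (by norm_num)).differentiable
            (by norm_num) u).hasFDerivAt).fderiv
        rw [h1]
        exact congrArg (fun T => T v w) h3
    have h4 := generator_section (EuclideanSpace.basisFun (Fin d) ℝ) hL g h σ θ x y z
    refine Eq.trans h4 ?_
    have h5 := congrArg (EuclideanSpace.proj i : Vec l →L[ℝ] ℝ) (heq ((x, y), z))
    refine Eq.trans ?_ h5
    rw [map_add, map_smul, map_sum]
    simp only [h2]
    rw [h1]
    rfl

end Classical

theorem fderiv_neg_poisson {V F ι : Type*} [Fintype ι] [NormedAddCommGroup V] [NormedSpace ℝ V]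
    [NormedAddCommGroup F] [NormedSpace ℝ F] {Ψ : V → F} {u v : V} {e : ι → V} {y : F}
    (h : fderiv ℝ Ψ u v + (1 / 2 : ℝ) • ∑ i, fderiv ℝ (fderiv ℝ Ψ) u (e i) (e i) = -y) :
    fderiv ℝ (fun u => -Ψ u) u v +
      (1 / 2 : ℝ) • ∑ i, fderiv ℝ (fderiv ℝ fun u => -Ψ u) u (e i) (e i) = y := by
  have h1 : (fderiv ℝ fun u => -Ψ u) = fun u => -fderiv ℝ Ψ u := funext fun u => fderiv_fun_neg
  rw [h1, fderiv_fun_neg]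
  simp only [neg_apply, Finset.sum_neg_distrib, smul_neg]
  rw [← neg_add, h, neg_neg]

theorem mainTheorem3 {Ω : Type*} [MeasurableSpace Ω] (P : Measure Ω) [IsProbabilityMeasure P]
    {d l : ℕ} (g : Vec l → Vec d) (h : Vec l → Mat d d) (σ : ℝ) (f : Vec d → ℝ)
    -- `g`, `h` and their derivatives up to order two are uniformly bounded
    (hg : ContDiff ℝ 2 g) (hh : ContDiff ℝ 2 h)
    (hgb : ∃ K : ℝ, ∀ i ≤ 2, ∀ θ, ‖iteratedFDeriv ℝ i g θ‖ ≤ K)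
    (hhb : ∃ K : ℝ, ∀ i ≤ 2, ∀ θ, ‖iteratedFDeriv ℝ i h θ‖ ≤ K)
    -- `h` is symmetric and uniformly positive definite
    (hsymm : ∀ θ, IsSelfAdjoint (h θ))
    (hpos : ∃ c : ℝ, 0 < c ∧ ∀ (θ : Vec l) (x : Vec d), c * ‖x‖ ^ 2 ≤ inner ℝ x (h θ x))
    -- `f` and its derivatives up to order three are polynomially bounded
    (hf : ContDiff ℝ 3 f)
    (hfb : ∃ C m : ℝ, 0 < m ∧ ∀ x,
      |f x| + ∑ i ∈ Finset.Icc 1 3, ‖iteratedFDeriv ℝ i f x‖ ≤ C * (1 + ‖x‖ ^ m))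
    -- two independent Brownian motions, and the processes that they drive
    (W W' : ℝ≥0 → Ω → Vec d) (hW : IsBrownianVec W P) (hW' : IsBrownianVec W' P)
    (hind : IndepFun (fun ω t => W t ω) (fun ω t => W' t ω) P)
    (X : Vec l → Vec d → ℝ≥0 → Ω → Vec d)
    (Y : Vec l → Vec d → Mat d l → ℝ≥0 → Ω → Mat d l)
    (Z : Vec l → Vec d → ℝ≥0 → Ω → Vec d)
    (hX : ∀ θ x, IsOUSolution P (g θ) (h θ) σ W x (X θ x))
    (hY : ∀ θ x y, IsSensitivitySolution P g h θ (X θ x) y (Y θ x y))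
    (hZ : ∀ θ z, IsOUSolution P (g θ) (h θ) σ W' z (Z θ z))
    -- the stationary distributions of the processes `X θ`
    (π : Vec l → Measure (Vec d)) (hπ : ∀ θ, IsStationaryDist P (X θ) (π θ)) :
    -- the expectations and the time integral that define `v²` converge
    (∀ θ, Integrable f (π θ)) ∧
    (∀ θ x y z (t : ℝ≥0),
      Integrable (fun ω => poissonG f (π θ) (X θ x t ω) (Y θ x y t ω) (Z θ z t ω)) P) ∧
    (∀ θ x y z, IntegrableOn (fun t : ℝ => ∫ ω, poissonG f (π θ) (X θ x t.toNNReal ω)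
      (Y θ x y t.toNNReal ω) (Z θ z t.toNNReal ω) ∂P) (Ioi 0)) ∧
    -- `v²` is a classical solution of the Poisson equation
    (∀ θ, IsClassicalPoissonSolution g h σ θ (poissonG f (π θ))
      (fun x y z => poissonV P f π X Y Z x y z θ)) ∧
    -- `v²` is differentiable in `θ`, and the polynomial bound holds uniformly
    (∀ x y z, Differentiable ℝ (fun θ => poissonV P f π X Y Z x y z θ)) ∧
    (∃ C m' : ℝ, 0 < m' ∧ ∀ x y z θ,
      ‖poissonV P f π X Y Z x y z θ‖
        + ‖fderiv ℝ (fun z' => poissonV P f π X Y Z x y z' θ) z‖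
        + ‖fderiv ℝ (fun θ' => poissonV P f π X Y Z x y z θ') θ‖
        + ‖fderiv ℝ (fun x' => poissonV P f π X Y Z x' y z θ) x‖
        ≤ C * (1 + ‖x‖ ^ m' + ‖y‖ ^ m' + ‖z‖ ^ m')) := by

  obtain ⟨c, hc, hpos⟩ := hpos
  obtain ⟨C, N, hfC, hfC'⟩ := exists_polyC2_of_growth hf hfb
  obtain ⟨n, hn, hae⟩ := hW.exists_isNoise_smul hW' hind σ
  obtain ⟨K, c', A', a', F1, F2, F3, hA, ha, hA', ha'⟩ := exists_linFam hg hh hgb hhb hc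
    (fun θ t ht => norm_flow_le_of_le_inner (hpos θ) ht) hn
  obtain ⟨r1, r2, r3, r4, D, M, r5, r6⟩ := exists_triple_potential F1 F2 F3 hA ha hA' ha' hfC hfC'
    (dualVec l) (fun θ => (hπ θ).isInvariantDist hn.continuous hae (hX θ))
  have hpath := fun θ x y z => ae_eq_affPath_triple hn.continuous hae (hX θ x) (hY θ x y) (hZ θ z)
  have hint : ∀ θ x y z (t : ℝ≥0),
      (fun ω => poissonG f (π θ) (X θ x t ω) (Y θ x y t ω) (Z θ z t ω)) =ᵐ[P]
      fun ω => tripleG f (dualVec l) (∫ w, f w ∂π θ) (affPath (tripleOp h θ) (tripleDrift g θ)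
        ((x, y), z) (fun s => tripleNoise (Vec l) n s ω) t) := fun θ x y z t => by
    filter_upwards [hpath θ x y z] with ω hω
    rw [poissonG_eq_tripleG, hω t]
  have hT : ∀ θ x y z (t : ℝ), 0 ≤ t → transOp P (tripleOp h θ) (tripleDrift g θ)
      (tripleNoise (Vec l) n) t (tripleG f (dualVec l) (∫ w, f w ∂π θ)) ((x, y), z) =
      ∫ ω, poissonG f (π θ) (X θ x t.toNNReal ω) (Y θ x y t.toNNReal ω)
        (Z θ z t.toNNReal ω) ∂P := fun θ x y z t ht => by
    rw [integral_congr_ae (hint θ x y z t.toNNReal), Real.coe_toNNReal t ht]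
    rfl
  obtain ⟨Φ, hΦ⟩ : ∃ Φ : Vec l → (Vec d × Mat d l) × Vec d → Vec l, Φ = fun θ u =>
      -∫ t in Ioi (0 : ℝ), transOp P (tripleOp h θ) (tripleDrift g θ) (tripleNoise (Vec l) n) t
        (tripleG f (dualVec l) (∫ w, f w ∂π θ)) u := ⟨_, rfl⟩
  have hV : ∀ x y z θ, poissonV P f π X Y Z x y z θ = Φ θ ((x, y), z) := fun x y z θ => by
    rw [hΦ]
    exact congrArg Neg.neg (setIntegral_congr_fun measurableSet_Ioi fun t ht =>
      (hT θ x y z t (le_of_lt ht)).symm)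
  have hΦC : ∀ θ, PolyC2 (‖-ContinuousLinearMap.id ℝ (Vec l)‖ * D) M (Φ θ) := fun θ => by
    rw [hΦ]
    exact (r5 θ).clm_comp (-ContinuousLinearMap.id ℝ (Vec l))
  have hΦeq : ∀ θ u, fderiv ℝ (Φ θ) u (tripleDrift g θ - tripleOp h θ u) +
      (1 / 2 : ℝ) • ∑ i, fderiv ℝ (fderiv ℝ (Φ θ)) u
        (tripleDir (Vec l) (fun i => σ • EuclideanSpace.basisFun (Fin d) ℝ i) i)
        (tripleDir (Vec l) (fun i => σ • EuclideanSpace.basisFun (Fin d) ℝ i) i) =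
      tripleG f (dualVec l) (∫ w, f w ∂π θ) u := fun θ u => by
    rw [hΦ]
    exact fderiv_neg_poisson (r4 θ u)
  have hΦθ : ∀ θ u, ∃ F' : Vec l →L[ℝ] Vec l, ‖F'‖ ≤ D * (1 + ‖u‖) ^ M ∧
      HasFDerivAt (fun η => Φ η u) F' θ := fun θ u => by
    obtain ⟨F', h1, h2⟩ := r6 θ u
    refine ⟨-F', (norm_neg F').trans_le h1, ?_⟩
    rw [hΦ]
    exact h2.neg
  simp only [hV]
  refine ⟨r1, fun θ x y z t => (r2 θ t t.2 ((x, y), z)).congr (hint θ x y z t).symm,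
    fun θ x y z => (integrableOn_congr_fun (fun t ht => hT θ x y z t (le_of_lt ht))
      measurableSet_Ioi).1 (r3 θ ((x, y), z)), fun θ => ?_, fun x y z θ => ?_, ?_⟩
  · have h1 := isClassicalPoissonSolution_of_poisson (hΦC θ).contDiff (hΦeq θ)
    simpa only [← poissonG_eq_tripleG] using h1
  · obtain ⟨F', -, h2⟩ := hΦθ θ ((x, y), z)
    exact h2.differentiableAt
  · obtain ⟨R, hR1, hR2⟩ : ∃ R, ‖-ContinuousLinearMap.id ℝ (Vec l)‖ * D ≤ R ∧ D ≤ R :=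
      ⟨_, le_max_left _ _, le_max_right _ _⟩
    have hR : 0 ≤ R := (hΦC 0).bdd.nonneg.trans hR1
    -- The leading `4` counts the summands, each at most `R * (1 + ‖u‖) ^ M`; `4 ^ (M + 1)` comes
    -- from separating the three norms.
    refine ⟨4 * R * 4 ^ (M + 1), ((M + 1 : ℕ) : ℝ), by positivity, fun x y z θ => ?_⟩
    have hu : ‖((x, y), z)‖ ≤ ‖x‖ + ‖y‖ + ‖z‖ := by
      have h1 := norm_nonneg x
      have h2 := norm_nonneg y
      have h3 := norm_nonneg z
      exact norm_prod_le_iff.2 ⟨norm_prod_le_iff.2 ⟨by dsimp only; linarith, by dsimp only; linarith⟩,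
        by dsimp only; linarith⟩
    have hpow := one_add_pow_le (norm_nonneg x) (norm_nonneg y) (norm_nonneg z) hu
      (norm_nonneg _) M
    have hp : 0 ≤ (1 + ‖((x, y), z)‖) ^ M := by positivity
    have b1 := ((hΦC θ).bdd ((x, y), z)).trans (mul_le_mul_of_nonneg_right hR1 hp)
    have b2 := ((hΦC θ).bdd_fderiv ((x, y), z)).trans (mul_le_mul_of_nonneg_right hR1 hp)
    have b3 : ‖fderiv ℝ (fun θ' => Φ θ' ((x, y), z)) θ‖ ≤ R * (1 + ‖((x, y), z)‖) ^ M := by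
      obtain ⟨F', h1, h2⟩ := hΦθ θ ((x, y), z)
      rw [h2.fderiv]
      exact h1.trans (mul_le_mul_of_nonneg_right hR2 hp)
    rw [fderiv_section_x x y z (hΦC θ).contDiff, fderiv_section_z x y z (hΦC θ).contDiff]
    have b4 := (norm_fderiv_comp_inX_le (Φ := Φ θ) ((x, y), z)).trans b2
    have b5 := (norm_fderiv_comp_inZ_le (Φ := Φ θ) ((x, y), z)).trans b2
    calc _ ≤ 4 * (R * (1 + ‖((x, y), z)‖) ^ M) := by linarith
      _ ≤ 4 * (R * (4 ^ (M + 1) * (1 + ‖x‖ ^ ((M + 1 : ℕ) : ℝ) + ‖y‖ ^ ((M + 1 : ℕ) : ℝ) +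
          ‖z‖ ^ ((M + 1 : ℕ) : ℝ)))) :=
        mul_le_mul_of_nonneg_left (mul_le_mul_of_nonneg_left hpow hR) (by norm_num)
      _ = _ := by ring
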